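/- Let $M$ be a (Hausdorff) smooth $n$-dimensional manifold and $\mathcal F\colon TM\to[0,\infty)$ a Finsler function: continuous, smooth on $TM\setminus\{0\}$, positively $1$-homogeneous on each $T_xM$, with $g_{ij}=\frac12\frac{\partial^2\mathcal F^2}{\partial y^i\partial y^j}$ positive definite for $y\neq 0$. Let $G^i=\frac14 g^{il}\bigl(2\frac{\partial g_{jl}}{\partial x^k}-\frac{\partial g_{jk}}{\partial x^l}\bigr)y^jy^k$, $G^i_j=\frac{\partial G^i}{\partial y^j}$, $G^i_{jk}=\frac{\partial G^i_j}{\partial y^k}$, and let $$R^i_{jk}=\frac{\partial G^i_j}{\partial x^k}-\frac{\partial G^i_k}{\partial x^j}+G^m_jG^i_{km}-G^m_kG^i_{jm},\qquad \nabla_X\xi=\Bigl(\frac{\partial \xi^i}{\partial x^j}-G^k_j\frac{\partial \xi^i}{\partial y^k}+G^i_{jk}\xi^k\Bigr)X^j\frac{\partial}{\partial y^i}$$ be the curvature and the horizontal Berwald covariant derivative of $\xi=\xi^i(x,y)\frac{\partial}{\partial y^i}$. Assume that * $\mathcal F$ is projectively flat: around every point of $M$ there are local coordinates in which all geodesics (solutions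 of $\ddot x^i+2G^i(x,\dot x)=0$) are straight lines; * $\mathcal F$ has constant flag curvature $\lambda\ne 0$: $R^i_{jk}=\lambda(\delta^i_k g_{jm}y^m-\delta^i_j g_{km}y^m)$ in local coordinates, for $y\ne0$; * $\mathcal F$ is spherically symmetric at $x_o\in M$: in some local coordinates around $x_o$ in which all geodesics are straight lines there are constants $c_1,c_2\neq 0$ with $\mathcal F(x_o,y)=c_1\|y\|$ and $\mathcal P(x_o,y)=c_2\|y\|$, where $\|\cdot\|$ is the Euclidean norm of the coordinates and $\mathcal P$ is the projective factor, i.e. $G^i(x_o,y)=\mathcal P(x_o,y)\,y^i$ for $y\neq0$. Let $\mathcal I_{x_o}=\{y\in T_{x_o}M\mid \mathcal F(x_o,y)=1\}$ be the indicatrix at $x_o$ (in these coordinates a Euclidean sphere, equal to $\mathbb S^{n-1}$ when $c_1=1$), and let $\mathfrak{hol}^*_{x_o}(\mathcal F)$ be the infinitesimal holonomy algebra, i.e. the Lie algebra of vector fields on $\mathcal I_{x_o}$ generated by (the values at $x_o$ of) the curvature vector fields $R(X_1,X_2)=R^i_{jk}X_1^jX_2^k\frac{\partial}{\partial y^i}$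 and their successive covariant derivatives $\nabla_{X_k}\cdots\nabla_{X_3}R(X_1,X_2)$, where $X_1,\dots,X_k$ are smooth vector fields on $M$; all these objects are computed in the coordinates in which $\mathcal F$ is spherically symmetric at $x_o$. Then $\mathfrak{hol}^*_{x_o}(\mathcal F)$ consists of smooth vector fields tangent to $\mathcal I_{x_o}$, and it is dense in the space $\mathfrak X(\mathcal I_{x_o})$ of all smooth vector fields on the indicatrix with respect to the $C^\infty$ topology (uniform convergence of all derivatives). -/

import Mathlib

open scoped Manifold ContDiff Topology UniformConvergence

noncomputable section

namespace FinslerHol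

/-- The model space `ℝⁿ` with its Euclidean norm. -/
abbrev Euc (n : ℕ) : Type := EuclideanSpace ℝ (Fin n)

/-! ### Local coordinate expressions

In local coordinates a Finsler function is a function `L : ℝⁿ → ℝⁿ → ℝ`, where `L x y` is the norm
of the tangent vector `y` at `x`.  The expressions below are meaningful for `x` in an open set on
which `L` is given and `y ≠ 0`. -/

section Coordinates

variable {n : ℕ}

/-- Partial derivative with respect to the position coordinate `xⁱ`. -/
def dX (i : Fin n) (f : Euc n → Euc n → ℝ) (x y : Euc n) : ℝ :=
  fderiv ℝ (fun x' => f x' y) x (EuclideanSpace.single i 1)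

/-- Partial derivative with respect to the fibre coordinate `yⁱ`. -/
def dY (i : Fin n) (f : Euc n → Euc n → ℝ) (x y : Euc n) : ℝ :=
  fderiv ℝ (fun y' => f x y') y (EuclideanSpace.single i 1)

/-- The fundamental tensor `g_{ij} = ½ ∂²L² / ∂yⁱ∂yʲ`. -/
def fundTensor (L : Euc n → Euc n → ℝ) (i j : Fin n) (x y : Euc n) : ℝ :=
  (1 / 2) * dY i (dY j (fun x y => L x y ^ 2)) x y

/-- The inverse matrix `g^{ij}` of the fundamental tensor. -/
def fundTensorInv (L : Euc n → Euc n → ℝ) (i j : Fin n) (x y : Euc n) : ℝ :=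
  (Matrix.of fun a b => fundTensor L a b x y)⁻¹ i j

/-- The geodesic coefficients
`Gⁱ = ¼ g^{il} (2 ∂g_{jl}/∂xᵏ - ∂g_{jk}/∂xˡ) yʲ yᵏ`. -/
def geodCoeff (L : Euc n → Euc n → ℝ) (i : Fin n) (x y : Euc n) : ℝ :=
  (1 / 4) * ∑ l, ∑ j, ∑ k, fundTensorInv L i l x y *
    (2 * dX k (fundTensor L j l) x y - dX l (fundTensor L j k) x y) * y j * y k

/-- `Gⁱ_j = ∂Gⁱ/∂yʲ`. -/
def connCoeff (L : Euc n → Euc n → ℝ) (i j : Fin n) : Euc n → Euc n → ℝ :=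
  dY j (geodCoeff L i)

/-- `Gⁱ_{jk} = ∂Gⁱ_j/∂yᵏ`. -/
def berwaldCoeff (L : Euc n → Euc n → ℝ) (i j k : Fin n) : Euc n → Euc n → ℝ :=
  dY k (connCoeff L i j)

/-- The curvature
`Rⁱ_{jk} = ∂Gⁱ_j/∂xᵏ - ∂Gⁱ_k/∂xʲ + Gᵐ_j Gⁱ_{km} - Gᵐ_k Gⁱ_{jm}`. -/
def curvCoeff (L : Euc n → Euc n → ℝ) (i j k : Fin n) (x y : Euc n) : ℝ :=
  dX k (connCoeff L i j) x y - dX j (connCoeff L i k) x y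
    + ∑ m, (connCoeff L m j x y * berwaldCoeff L i k m x y
      - connCoeff L m k x y * berwaldCoeff L i j m x y)

/-- The curvature vector field `R(X, Y) = Rⁱ_{jk} Xʲ Yᵏ ∂/∂yⁱ`. -/
def curvField (L : Euc n → Euc n → ℝ) (X Y : Euc n → Euc n) (x y : Euc n) : Euc n :=
  WithLp.toLp 2 fun i => ∑ j, ∑ k, curvCoeff L i j k x y * X x j * Y x k

/-- The horizontal Berwald covariant derivative of `ξ = ξⁱ(x, y) ∂/∂yⁱ` along `X = Xⁱ(x) ∂/∂xⁱ`:
`(∇_X ξ)ⁱ = (∂ξⁱ/∂xʲ - Gᵏ_j ∂ξⁱ/∂yᵏ + Gⁱ_{jk} ξᵏ) Xʲ`. -/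
def covDeriv (L : Euc n → Euc n → ℝ) (X : Euc n → Euc n) (ξ : Euc n → Euc n → Euc n)
    (x y : Euc n) : Euc n :=
  WithLp.toLp 2 fun i => ∑ j, (dX j (fun x y => ξ x y i) x y
    - ∑ k, connCoeff L k j x y * dY k (fun x y => ξ x y i) x y
    + ∑ k, berwaldCoeff L i j k x y * ξ x y k) * X x j

/-- The curve `c`, on the open interval `(a, b)`, is a regular geodesic of `L` lying in `D`:
`c̈ⁱ + 2 Gⁱ(c, ċ) = 0`. -/
def IsGeodesicOn (L : Euc n → Euc n → ℝ) (D : Set (Euc n)) (a b : ℝ) (c : ℝ → Euc n) : Prop :=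
  ∀ t ∈ Set.Ioo a b, c t ∈ D ∧ DifferentiableAt ℝ c t ∧ deriv c t ≠ 0 ∧
    DifferentiableAt ℝ (deriv c) t ∧
    ∀ i, deriv (deriv c) t i + 2 * geodCoeff L i (c t) (deriv c t) = 0

/-- `L` is projective on `D`: all geodesics are (pieces of) straight lines. -/
def IsProjectiveOn (L : Euc n → Euc n → ℝ) (D : Set (Euc n)) : Prop :=
  ∀ (a b : ℝ) (c : ℝ → Euc n), IsGeodesicOn L D a b c → Collinear ℝ (c '' Set.Ioo a b)

/-- `p` is the projective factor of `L` at the point `x`: `Gⁱ(x, y) = p(y) yⁱ`. -/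
def IsProjectiveFactorAt (L : Euc n → Euc n → ℝ) (x : Euc n) (p : Euc n → ℝ) : Prop :=
  ∀ y : Euc n, y ≠ 0 → ∀ i, geodCoeff L i x y = p y * y i

end Coordinates

/-! ### Vector fields on an indicatrix

`N : ℝⁿ → ℝ` is the restriction of a Finsler function to one tangent space. -/

section Indicatrix

variable {n : ℕ}

/-- The indicatrix `{y | N y = 1}`. -/
def indicatrix (N : Euc n → ℝ) : Set (Euc n) := {y | N y = 1}

open Classical in
/-- The positively 1-homogeneous extension `y ↦ N(y) X(y / N(y))` to the punctured tangent space of a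
map `X` given on the indicatrix. -/
def homExt (N : Euc n → ℝ) (X : indicatrix N → Euc n) (y : Euc n) : Euc n :=
  if h : (N y)⁻¹ • y ∈ indicatrix N then N y • X ⟨(N y)⁻¹ • y, h⟩ else 0

/-- `X` is a smooth vector field on the indicatrix: it is tangent to it, and it is smooth.  (As the
radial projection `y ↦ y / N(y)` is smooth, `X` is smooth on the hypersurface if and only if its
homogeneous extension is smooth on the punctured tangent space.) -/
structure IsIndicatrixField (N : Euc n → ℝ) (X : indicatrix N → Euc n) : Prop where
  smooth : ContDiffOn ℝ ∞ (homExt N X) {0}ᶜ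
  tangent : ∀ y : indicatrix N, fderiv ℝ N y (X y) = 0

/-- The space `𝔛(I)` of smooth vector fields on the indicatrix `I`. -/
def IndicatrixField (N : Euc n → ℝ) : Type := {X : indicatrix N → Euc n // IsIndicatrixField N X}

/-- The `C^∞` topology on `𝔛(I)`: uniform convergence on `I` of the derivatives of every order
(of the homogeneous extensions). -/
instance (N : Euc n → ℝ) : TopologicalSpace (IndicatrixField N) :=
  ⨅ m : ℕ, TopologicalSpace.induced
    (fun X => UniformFun.ofFun fun y : indicatrix N => iteratedFDeriv ℝ m (homExt N X.1) y)
    (inferInstance : TopologicalSpace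
      (indicatrix N →ᵤ ContinuousMultilinearMap ℝ (fun _ : Fin m => Euc n) (Euc n)))

/-- The Lie bracket of vector fields on the indicatrix, computed with their homogeneous
extensions. -/
def indicatrixBracket (N : Euc n → ℝ) (X Y : indicatrix N → Euc n) : indicatrix N → Euc n :=
  fun y => VectorField.lieBracket ℝ (homExt N X) (homExt N Y) y

/-- The Lie algebra generated by a set `S` of vector fields on the indicatrix: the smallest linear
subspace that contains `S` and is closed under the Lie bracket. -/
inductive LieGenerated (N : Euc n → ℝ) (S : Set (indicatrix N → Euc n)) :
    (indicatrix N → Euc n) → Prop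
  | mem (X : indicatrix N → Euc n) : X ∈ S → LieGenerated N S X
  | zero : LieGenerated N S 0
  | add (X Y : indicatrix N → Euc n) :
      LieGenerated N S X → LieGenerated N S Y → LieGenerated N S (X + Y)
  | smul (a : ℝ) (X : indicatrix N → Euc n) : LieGenerated N S X → LieGenerated N S (a • X)
  | bracket (X Y : indicatrix N → Euc n) :
      LieGenerated N S X → LieGenerated N S Y → LieGenerated N S (indicatrixBracket N X Y)

end Indicatrix

/-! ### Finsler manifolds -/

section Manifold

variable {n : ℕ} {M : Type*} [TopologicalSpace M] [ChartedSpace (Euc n) M]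

/-- `F : TM → ℝ` is a Finsler function. -/
structure IsFinsler [IsManifold (𝓡 n) ∞ M] (F : TangentBundle (𝓡 n) M → ℝ) : Prop where
  nonneg : ∀ p, 0 ≤ F p
  continuous : Continuous F
  smooth : ContMDiffOn (𝓡 n).tangent 𝓘(ℝ, ℝ) ∞ F {p | p.2 ≠ 0}
  homogeneous : ∀ (x : M) (y : TangentSpace (𝓡 n) x) (t : ℝ), 0 < t →
    F ⟨x, t • y⟩ = t * F ⟨x, y⟩
  /-- Positive definiteness of `g_{x,y}(u, v) = ½ ∂²F²(x, y + su + tv)/∂s∂t` at `s = t = 0`. -/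
  posDef : ∀ (x : M) (y : TangentSpace (𝓡 n) x), y ≠ 0 → ∀ u : TangentSpace (𝓡 n) x, u ≠ 0 →
    0 < (1 / 2) * deriv (fun s : ℝ => deriv (fun t : ℝ => F ⟨x, y + s • u + t • u⟩ ^ 2) 0) 0

/-- The local expression of `F` in a chart `φ`. -/
def coordFun (F : TangentBundle (𝓡 n) M → ℝ) (φ : OpenPartialHomeomorph M (Euc n))
    (x y : Euc n) : ℝ :=
  F ⟨φ.symm x, mfderiv (𝓡 n) (𝓡 n) φ.symm x y⟩

/-- The local expression of a vector field on `M` in a chart `φ`. -/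
def coordField (X : (p : M) → TangentSpace (𝓡 n) p) (φ : OpenPartialHomeomorph M (Euc n))
    (x : Euc n) : Euc n :=
  mfderiv (𝓡 n) (𝓡 n) φ (φ.symm x) (X (φ.symm x))

/-- `X` is a smooth vector field on `M`. -/
def IsSmoothField [IsManifold (𝓡 n) ∞ M] (X : (p : M) → TangentSpace (𝓡 n) p) : Prop :=
  ContMDiff (𝓡 n) (𝓡 n).tangent ∞ fun p => (⟨p, X p⟩ : TangentBundle (𝓡 n) M)

/-- `φ` is a local coordinate system of the smooth manifold `M` in which `F` is projective. -/
structure IsProjectiveChart (F : TangentBundle (𝓡 n) M → ℝ)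
    (φ : OpenPartialHomeomorph M (Euc n)) : Prop where
  mem_maximalAtlas : φ ∈ IsManifold.maximalAtlas (𝓡 n) ∞ M
  projective : IsProjectiveOn (coordFun F φ) φ.target

/-- `F` is (locally) projectively flat: around every point there is a local coordinate system in
which `F` is projective. -/
def IsProjectivelyFlat (F : TangentBundle (𝓡 n) M → ℝ) : Prop :=
  ∀ x : M, ∃ φ : OpenPartialHomeomorph M (Euc n), x ∈ φ.source ∧ IsProjectiveChart F φ

/-- `F` has constant flag curvature `lam`: in local coordinates
`Rⁱ_{jk} = lam (δⁱ_k g_{jm} yᵐ - δⁱ_j g_{km} yᵐ)`. -/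
def HasConstantCurvature (F : TangentBundle (𝓡 n) M → ℝ) (lam : ℝ) : Prop :=
  ∀ φ ∈ IsManifold.maximalAtlas (𝓡 n) ∞ M, ∀ x ∈ φ.target, ∀ y : Euc n, y ≠ 0 →
    ∀ i j k : Fin n, curvCoeff (coordFun F φ) i j k x y =
      lam * ((if i = k then ∑ m, fundTensor (coordFun F φ) j m x y * y m else 0)
        - (if i = j then ∑ m, fundTensor (coordFun F φ) k m x y * y m else 0))

/-- `F` is spherically symmetric at `x₀`, as seen in the projective coordinate system `φ`: at `x₀`
both `F` and the projective factor are nonzero multiples of the Euclidean norm. -/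
structure IsSphericallySymmetricAt (F : TangentBundle (𝓡 n) M → ℝ) (x₀ : M)
    (φ : OpenPartialHomeomorph M (Euc n)) : Prop where
  mem_source : x₀ ∈ φ.source
  chart : IsProjectiveChart F φ
  norm_multiple : ∃ c₁ : ℝ, c₁ ≠ 0 ∧ ∀ y : Euc n, coordFun F φ (φ x₀) y = c₁ * ‖y‖
  factor_multiple : ∃ c₂ : ℝ, c₂ ≠ 0 ∧
    IsProjectiveFactorAt (coordFun F φ) (φ x₀) fun y => c₂ * ‖y‖

/-- The curvature vector fields `R(X₁, X₂)` and their successive covariant derivatives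
`∇_{X_k} ⋯ ∇_{X_3} R(X₁, X₂)` with `X₁, …, X_k ∈ 𝔛(M)`, in the coordinates `φ`. -/
inductive IsCurvatureDerivative [IsManifold (𝓡 n) ∞ M] (F : TangentBundle (𝓡 n) M → ℝ)
    (φ : OpenPartialHomeomorph M (Euc n)) : (Euc n → Euc n → Euc n) → Prop
  | curv (X Y : (p : M) → TangentSpace (𝓡 n) p) : IsSmoothField X → IsSmoothField Y →
      IsCurvatureDerivative F φ (curvField (coordFun F φ) (coordField X φ) (coordField Y φ))
  | cov (X : (p : M) → TangentSpace (𝓡 n) p) (ξ : Euc n → Euc n → Euc n) :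
      IsSmoothField X → IsCurvatureDerivative F φ ξ →
      IsCurvatureDerivative F φ (covDeriv (coordFun F φ) (coordField X φ) ξ)

/-- The restriction `F_x` of `F` to the tangent space at `x`, in the coordinates `φ`. -/
abbrev fibreNorm (F : TangentBundle (𝓡 n) M → ℝ) (φ : OpenPartialHomeomorph M (Euc n)) (x : M) :
    Euc n → ℝ :=
  coordFun F φ (φ x)

/-- The infinitesimal holonomy algebra `𝔥𝔬𝔩*_x(F)`, in the coordinates `φ` around `x`: the Lie
algebra of vector fields on the indicatrix at `x` generated by the curvature vector fields and their
successive covariant derivatives. -/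
def infHol [IsManifold (𝓡 n) ∞ M] (F : TangentBundle (𝓡 n) M → ℝ)
    (φ : OpenPartialHomeomorph M (Euc n)) (x : M) :
    Set (indicatrix (fibreNorm F φ x) → Euc n) :=
  {X | LieGenerated (fibreNorm F φ x)
    {Y | ∃ ξ, IsCurvatureDerivative F φ ξ ∧ Y = fun y : indicatrix (fibreNorm F φ x) => ξ (φ x) y} X}

end Manifold

end FinslerHol

end

open FinslerHol

/-!
Over the domain of a projective chart the geodesic coefficients are `Gⁱ = P yⁱ`, and the whole
geometry is carried by the energy `E = L² / 2` and the projective factor `P`.  Since geodesics with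
arbitrary initial velocity exist, straightness of geodesics gives `Gⁱ ∥ y`
(`exists_factor_of_isProjectiveOn`); the Euler–Lagrange form of `Gⁱ` then gives
`∂E/∂xⁱ = 2 (∂P/∂yⁱ) E + P ∂E/∂yⁱ` with `P = (∑ yᵏ ∂E/∂xᵏ) / 4E` (`exists_projectiveData`), and
constant flag curvature gives `∂P/∂xⁱ = P ∂P/∂yⁱ - λ ∂E/∂yⁱ` if `n ≠ 1` (`ProjectiveData.dX_P`).
With these two identities position derivatives are expressed by fibre derivatives, so the curvature
derivatives at `x₀` can be computed from `E(x₀, y)` and `P(x₀, y)` alone.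

*The algebra consists of smooth tangent fields.*  The energy is constant along the horizontal
directions, so covariant differentiation preserves smooth vertical fields that annihilate `E`
(`ProjectiveData.isTangentField_covDeriv`); brackets preserve tangency.

*Generators.*  At `x₀`, where `E` is a multiple of `‖y‖²` and `P` of `‖y‖`, let `V_j` be the
tangential part of `∂/∂yʲ` and `ρ_{ij}` the rotation in the `(i, j)`-plane.  For coordinate fields
`X`, `Y` the fields `R(X, Y)`, `∇_X R(X, Y)` and `∇_X ∇_X R(X, Y)` are, up to nonzero factors and
with `c₁ = 1`, equal to `ρ_{ij}`, `2 yⁱ ρ_{ij} + V_j` and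
`(4 c₂² (yⁱ)² - 3 λ) ρ_{ij} + 8 c₂² yⁱ V_j`.  The sum of the second kind over `i` is a multiple of
`V_j`, and the bracket of `V_i` with `yⁱ ρ_{ij}`, compared with the third kind, yields `yⁱ V_j`.

*All polynomial fields.*  If `f` is a monomial, `[V_z, f V_j]` exchanges `V_j` with one of the
factors of `f`, modulo fields of lower degree.  Three exchanges transpose two factors, which forces
every polynomial field `f V_j` into the algebra (`polyField_mon_mem`).  For `n ≤ 1` there
is nothing to generate: all tangent fields vanish.

*Density.*  A smooth tangent field extends to a compactly supported smooth map `g` on `ℝⁿ`, and on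
the indicatrix it equals `∑ gⱼ Vⱼ`.  Convolving `gⱼ` with a polynomial that is close to a mollifier
on a large ball gives a polynomial near `gⱼ` with all derivatives up to a given order
(`exists_polyFun_iteratedFDeriv_near`), because convolution commutes with derivatives.  Hence the
polynomial fields are dense (`dense_of_polyField_mem`).
-/

namespace FinslerHol

/-! ### Partial derivatives on the slit tangent bundle of a coordinate domain -/

section Calculus

variable {n : ℕ} {D : Set (Euc n)} {f g : Euc n → Euc n → ℝ} {x y : Euc n}

/-- `f` is smooth on `D × (ℝⁿ ∖ 0)`. -/
def SmoothOn (D : Set (Euc n)) (f : Euc n → Euc n → ℝ) : Prop :=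
  ContDiffOn ℝ ∞ (Function.uncurry f) (D ×ˢ {0}ᶜ)

lemma isOpen_slit (hD : IsOpen D) : IsOpen (D ×ˢ ({0}ᶜ : Set (Euc n))) :=
  hD.prod isOpen_compl_singleton

lemma SmoothOn.mono {D' : Set (Euc n)} (hf : SmoothOn D f) (h : D' ⊆ D) : SmoothOn D' f :=
  ContDiffOn.mono hf (Set.prod_mono h subset_rfl)

lemma SmoothOn.congr (hf : SmoothOn D f) (h : ∀ x ∈ D, ∀ y ≠ 0, g x y = f x y) : SmoothOn D g :=
  ContDiffOn.congr hf fun p hp => h p.1 hp.1 p.2 hp.2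

lemma SmoothOn.contDiffAt (hD : IsOpen D) (hf : SmoothOn D f) (hx : x ∈ D) (hy : y ≠ 0) :
    ContDiffAt ℝ ∞ (Function.uncurry f) (x, y) :=
  ContDiffOn.contDiffAt hf ((isOpen_slit hD).mem_nhds ⟨hx, hy⟩)

lemma SmoothOn.differentiableAt (hD : IsOpen D) (hf : SmoothOn D f) (hx : x ∈ D) (hy : y ≠ 0) :
    DifferentiableAt ℝ (Function.uncurry f) (x, y) :=
  (hf.contDiffAt hD hx hy).differentiableAt (by simp)

lemma SmoothOn.differentiableAt_left (hD : IsOpen D) (hf : SmoothOn D f) (hx : x ∈ D)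
    (hy : y ≠ 0) : DifferentiableAt ℝ (fun x' => f x' y) x :=
  (hf.differentiableAt hD hx hy).comp (f := fun x' => (x', y)) x (by fun_prop)

lemma SmoothOn.differentiableAt_right (hD : IsOpen D) (hf : SmoothOn D f) (hx : x ∈ D)
    (hy : y ≠ 0) : DifferentiableAt ℝ (fun y' => f x y') y :=
  (hf.differentiableAt hD hx hy).comp (f := fun y' => (x, y')) y (by fun_prop)

lemma dX_eq_fderiv (hD : IsOpen D) (hf : SmoothOn D f) (hx : x ∈ D) (hy : y ≠ 0) (i : Fin n) :
    dX i f x y = fderiv ℝ (Function.uncurry f) (x, y) (EuclideanSpace.single i 1, 0) := by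
  have h := (hf.differentiableAt hD hx hy).hasFDerivAt.comp (f := fun x' => (x', y)) x
    (hasFDerivAt_prodMk_left x y)
  have h2 := h.fderiv
  unfold dX
  change fderiv ℝ (fun x' => f x' y) x = _ at h2
  rw [h2]; simp

lemma dY_eq_fderiv (hD : IsOpen D) (hf : SmoothOn D f) (hx : x ∈ D) (hy : y ≠ 0) (i : Fin n) :
    dY i f x y = fderiv ℝ (Function.uncurry f) (x, y) (0, EuclideanSpace.single i 1) := by
  have h := (hf.differentiableAt hD hx hy).hasFDerivAt.comp (f := fun y' => (x, y')) y
    (hasFDerivAt_prodMk_right x y)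
  have h2 := h.fderiv
  unfold dY
  change fderiv ℝ (fun y' => f x y') y = _ at h2
  rw [h2]; simp

lemma SmoothOn.fderiv_apply (hD : IsOpen D) (hf : SmoothOn D f) (v : Euc n × Euc n) :
    SmoothOn D fun x y => fderiv ℝ (Function.uncurry f) (x, y) v :=
  (ContDiffOn.fderiv_of_isOpen (m := ∞) hf (isOpen_slit hD) (by simp)).clm_apply contDiffOn_const

lemma SmoothOn.dX (hD : IsOpen D) (hf : SmoothOn D f) (i : Fin n) : SmoothOn D (dX i f) :=
  (hf.fderiv_apply hD _).congr fun _ hx _ hy => dX_eq_fderiv hD hf hx hy i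

lemma SmoothOn.dY (hD : IsOpen D) (hf : SmoothOn D f) (i : Fin n) : SmoothOn D (dY i f) :=
  (hf.fderiv_apply hD _).congr fun _ hx _ hy => dY_eq_fderiv hD hf hx hy i

lemma dX_congr (hD : IsOpen D) (h : ∀ x ∈ D, ∀ y ≠ 0, f x y = g x y) (hx : x ∈ D) (hy : y ≠ 0)
    (i : Fin n) : dX i f x y = dX i g x y := by
  unfold dX
  congr 1
  apply Filter.EventuallyEq.fderiv_eq
  filter_upwards [hD.mem_nhds hx] with x' hx' using h x' hx' y hy

lemma dY_congr (h : ∀ x ∈ D, ∀ y ≠ 0, f x y = g x y) (hx : x ∈ D) (hy : y ≠ 0)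
    (i : Fin n) : dY i f x y = dY i g x y := by
  unfold dY
  congr 1
  apply Filter.EventuallyEq.fderiv_eq
  filter_upwards [isOpen_compl_singleton.mem_nhds hy] with y' hy' using h x hx y' hy'

lemma fderiv_fderiv_apply (hD : IsOpen D) (hf : SmoothOn D f) (hx : x ∈ D) (hy : y ≠ 0)
    (v w : Euc n × Euc n) :
    fderiv ℝ (fun p : Euc n × Euc n => fderiv ℝ (Function.uncurry f) p v) (x, y) w =
      fderiv ℝ (fun p : Euc n × Euc n => fderiv ℝ (Function.uncurry f) p w) (x, y) v := by
  have h1 := hf.contDiffAt hD hx hy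
  have h2 : DifferentiableAt ℝ (fderiv ℝ (Function.uncurry f)) (x, y) :=
    (h1.fderiv_right (m := 1) (by norm_cast)).differentiableAt (by simp)
  have h3 := h1.isSymmSndFDerivAt (by simp; norm_cast)
  rw [fderiv_clm_apply h2 (by fun_prop), fderiv_clm_apply h2 (by fun_prop)]
  simpa using h3 w v

lemma uncurry_fderiv (v : Euc n × Euc n) :
    Function.uncurry (fun x y => fderiv ℝ (Function.uncurry f) (x, y) v) =
      fun p : Euc n × Euc n => fderiv ℝ (Function.uncurry f) p v := rfl

lemma dY_dY (hD : IsOpen D) (hf : SmoothOn D f) (hx : x ∈ D) (hy : y ≠ 0) (i j : Fin n) :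
    dY i (dY j f) x y = dY j (dY i f) x y := by
  rw [dY_congr (fun x hx y hy => dY_eq_fderiv hD hf hx hy j) hx hy,
    dY_congr (fun x hx y hy => dY_eq_fderiv hD hf hx hy i) hx hy,
    dY_eq_fderiv hD (hf.fderiv_apply hD _) hx hy, dY_eq_fderiv hD (hf.fderiv_apply hD _) hx hy,
    uncurry_fderiv, uncurry_fderiv, fderiv_fderiv_apply hD hf hx hy]

lemma dY_dX (hD : IsOpen D) (hf : SmoothOn D f) (hx : x ∈ D) (hy : y ≠ 0) (i j : Fin n) :
    dY i (dX j f) x y = dX j (dY i f) x y := by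
  rw [dY_congr (fun x hx y hy => dX_eq_fderiv hD hf hx hy j) hx hy,
    dX_congr hD (fun x hx y hy => dY_eq_fderiv hD hf hx hy i) hx hy,
    dX_eq_fderiv hD (hf.fderiv_apply hD _) hx hy, dY_eq_fderiv hD (hf.fderiv_apply hD _) hx hy,
    uncurry_fderiv, uncurry_fderiv, fderiv_fderiv_apply hD hf hx hy]

lemma smoothOn_const (c : ℝ) : SmoothOn D fun _ _ => c := contDiffOn_const

lemma smoothOn_coord (j : Fin n) : SmoothOn D fun _ y => y j := by
  have : ContDiff ℝ ∞ (fun p : Euc n × Euc n => p.2 j) := by fun_prop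
  exact this.contDiffOn

lemma SmoothOn.add (hf : SmoothOn D f) (hg : SmoothOn D g) :
    SmoothOn D fun x y => f x y + g x y := ContDiffOn.add hf hg

lemma SmoothOn.sub (hf : SmoothOn D f) (hg : SmoothOn D g) :
    SmoothOn D fun x y => f x y - g x y := ContDiffOn.sub hf hg

lemma SmoothOn.mul (hf : SmoothOn D f) (hg : SmoothOn D g) :
    SmoothOn D fun x y => f x y * g x y := ContDiffOn.mul hf hg

lemma SmoothOn.inv (hf : SmoothOn D f) (h : ∀ x ∈ D, ∀ y ≠ 0, f x y ≠ 0) :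
    SmoothOn D fun x y => (f x y)⁻¹ :=
  ContDiffOn.inv hf fun p hp => h p.1 hp.1 p.2 hp.2

lemma SmoothOn.sum {ι : Type*} {s : Finset ι} {f : ι → Euc n → Euc n → ℝ}
    (hf : ∀ i ∈ s, SmoothOn D (f i)) : SmoothOn D fun x y => ∑ i ∈ s, f i x y := by
  have := ContDiffOn.sum (𝕜 := ℝ) (n := ∞) (f := fun i => Function.uncurry (f i)) hf
  refine this.congr fun p _ => ?_
  simp [Function.uncurry]

lemma SmoothOn.prod {ι : Type*} {s : Finset ι} {f : ι → Euc n → Euc n → ℝ}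
    (hf : ∀ i ∈ s, SmoothOn D (f i)) : SmoothOn D fun x y => ∏ i ∈ s, f i x y := by
  have := contDiffOn_prod (𝕜 := ℝ) (n := ∞) (f := fun i => Function.uncurry (f i)) hf
  refine this.congr fun p _ => ?_
  simp [Function.uncurry]

/-! ### The rules of differentiation -/

lemma dX_const (i : Fin n) (c : ℝ) : dX i (fun _ _ => c) x y = 0 := by simp [dX]

lemma dY_const (i : Fin n) (c : ℝ) : dY i (fun _ _ => c) x y = 0 := by simp [dY]

lemma dX_coord (i j : Fin n) : dX i (fun _ y => y j) x y = 0 := by simp [dX]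

lemma dY_coord (i j : Fin n) : dY i (fun _ y => y j) x y = if i = j then 1 else 0 := by
  have : (fun y : Euc n => y j) = EuclideanSpace.proj (𝕜 := ℝ) j := rfl
  unfold dY
  rw [this, ContinuousLinearMap.fderiv]
  simp [eq_comm]

section Rules

variable (hD : IsOpen D) (hf : SmoothOn D f) (hg : SmoothOn D g) (hx : x ∈ D) (hy : y ≠ 0)
  (i : Fin n)
include hD hf hx hy

lemma dX_const_mul (c : ℝ) : dX i (fun x y => c * f x y) x y = c * dX i f x y := by
  unfold dX
  rw [fderiv_const_mul (hf.differentiableAt_left hD hx hy)]; rfl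

lemma dY_const_mul (c : ℝ) : dY i (fun x y => c * f x y) x y = c * dY i f x y := by
  unfold dY
  rw [fderiv_const_mul (hf.differentiableAt_right hD hx hy)]; rfl

include hg

lemma dX_add : dX i (fun x y => f x y + g x y) x y = dX i f x y + dX i g x y := by
  unfold dX
  rw [fderiv_fun_add (hf.differentiableAt_left hD hx hy) (hg.differentiableAt_left hD hx hy)]; rfl

lemma dY_add : dY i (fun x y => f x y + g x y) x y = dY i f x y + dY i g x y := by
  unfold dY
  rw [fderiv_fun_add (hf.differentiableAt_right hD hx hy) (hg.differentiableAt_right hD hx hy)]; rfl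

lemma dX_sub : dX i (fun x y => f x y - g x y) x y = dX i f x y - dX i g x y := by
  unfold dX
  rw [fderiv_fun_sub (hf.differentiableAt_left hD hx hy) (hg.differentiableAt_left hD hx hy)]; rfl

lemma dY_sub : dY i (fun x y => f x y - g x y) x y = dY i f x y - dY i g x y := by
  unfold dY
  rw [fderiv_fun_sub (hf.differentiableAt_right hD hx hy) (hg.differentiableAt_right hD hx hy)]; rfl

lemma dX_mul : dX i (fun x y => f x y * g x y) x y = dX i f x y * g x y + f x y * dX i g x y := by
  unfold dX
  rw [fderiv_fun_mul (hf.differentiableAt_left hD hx hy) (hg.differentiableAt_left hD hx hy)]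
  simp; ring

lemma dY_mul : dY i (fun x y => f x y * g x y) x y = dY i f x y * g x y + f x y * dY i g x y := by
  unfold dY
  rw [fderiv_fun_mul (hf.differentiableAt_right hD hx hy) (hg.differentiableAt_right hD hx hy)]
  simp; ring

end Rules

lemma dX_sum {ι : Type*} {s : Finset ι} {f : ι → Euc n → Euc n → ℝ} (hD : IsOpen D)
    (hf : ∀ i ∈ s, SmoothOn D (f i)) (hx : x ∈ D) (hy : y ≠ 0) (j : Fin n) :
    dX j (fun x y => ∑ i ∈ s, f i x y) x y = ∑ i ∈ s, dX j (f i) x y := by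
  unfold dX
  rw [fderiv_fun_sum fun i hi => (hf i hi).differentiableAt_left hD hx hy]
  simp

lemma dY_sum {ι : Type*} {s : Finset ι} {f : ι → Euc n → Euc n → ℝ} (hD : IsOpen D)
    (hf : ∀ i ∈ s, SmoothOn D (f i)) (hx : x ∈ D) (hy : y ≠ 0) (j : Fin n) :
    dY j (fun x y => ∑ i ∈ s, f i x y) x y = ∑ i ∈ s, dY j (f i) x y := by
  unfold dY
  rw [fderiv_fun_sum fun i hi => (hf i hi).differentiableAt_right hD hx hy]
  simp

end Calculus

/-! ### Euler's identity and the energy of a projective Finsler function -/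

section Energy

variable {n : ℕ} {D : Set (Euc n)} {f g L E P T : Euc n → Euc n → ℝ} {x y : Euc n} {c d : ℝ}

/-- `f` satisfies Euler's identity of degree `d` in the fibre variable, the infinitesimal form of
positive homogeneity. -/
def EulerOn (D : Set (Euc n)) (d : ℝ) (f : Euc n → Euc n → ℝ) : Prop :=
  ∀ x ∈ D, ∀ y ≠ 0, ∑ k, y k * dY k f x y = d * f x y

lemma sum_mul_ite_left {ι : Type*} [Fintype ι] [DecidableEq ι] (u : ι → ℝ) (i : ι) :
    ∑ k, (if i = k then u k else 0) = u i := by simp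

lemma sum_coord_mul_dY (f : Euc n → Euc n → ℝ) (x y : Euc n) :
    ∑ k, y k * dY k f x y = fderiv ℝ (fun y' => f x y') y y := by
  have hy : y = ∑ k, y k • EuclideanSpace.single k (1 : ℝ) := by
    ext i; simp [Pi.single_apply]
  conv_rhs => rw [hy, map_sum]
  simp only [map_smul, smul_eq_mul]
  rw [← hy]
  rfl

lemma eulerOn_of_homogeneous (hD : IsOpen D) (hf : SmoothOn D f)
    (h : ∀ x ∈ D, ∀ y ≠ 0, ∀ t : ℝ, 0 < t → f x (t • y) = t * f x y) : EulerOn D 1 f := by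
  intro x hx y hy
  rw [sum_coord_mul_dY, one_mul]
  have h1 : HasDerivAt (fun t : ℝ => f x (t • y)) (fderiv ℝ (fun y' => f x y') y y) 1 := by
    have h2 := (hf.differentiableAt_right hD hx hy).hasFDerivAt
    have h3 : HasDerivAt (fun t : ℝ => t • y) y 1 := by
      simpa using (hasDerivAt_id (1 : ℝ)).smul_const y
    have h4 : HasFDerivAt (fun y' => f x y') (fderiv ℝ (fun y' => f x y') y) ((1 : ℝ) • y) := by
      simpa using h2
    exact h4.comp_hasDerivAt (1 : ℝ) h3
  have h2 : HasDerivAt (fun t : ℝ => f x (t • y)) (f x y) 1 := by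
    have h3 : HasDerivAt (fun t : ℝ => t * f x y) (f x y) 1 := by
      simpa using (hasDerivAt_id (1 : ℝ)).mul_const (f x y)
    refine h3.congr_of_eventuallyEq ?_
    filter_upwards [lt_mem_nhds (zero_lt_one : (0 : ℝ) < 1)] with t ht using h x hx y hy t ht
  exact h1.unique h2

lemma EulerOn.congr (hf : EulerOn D d f) (h : ∀ x ∈ D, ∀ y ≠ 0, g x y = f x y) :
    EulerOn D d g := by
  intro x hx y hy
  rw [h x hx y hy, ← hf x hx y hy]
  exact Finset.sum_congr rfl fun k _ => by rw [dY_congr h hx hy]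

lemma EulerOn.mul (hD : IsOpen D) (sf : SmoothOn D f) (sg : SmoothOn D g) (hf : EulerOn D c f)
    (hg : EulerOn D d g) : EulerOn D (c + d) fun x y => f x y * g x y := by
  intro x hx y hy
  have : ∀ k, y k * dY k (fun x y => f x y * g x y) x y =
      (y k * dY k f x y) * g x y + f x y * (y k * dY k g x y) := fun k => by
    rw [dY_mul hD sf sg hx hy]; ring
  simp_rw [this]
  rw [Finset.sum_add_distrib, ← Finset.sum_mul, ← Finset.mul_sum, hf x hx y hy, hg x hx y hy]
  ring

lemma EulerOn.sub (hD : IsOpen D) (sf : SmoothOn D f) (sg : SmoothOn D g) (hf : EulerOn D d f)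
    (hg : EulerOn D d g) : EulerOn D d fun x y => f x y - g x y := by
  intro x hx y hy
  simp_rw [dY_sub hD sf sg hx hy, mul_sub]
  rw [Finset.sum_sub_distrib, hf x hx y hy, hg x hx y hy]

lemma EulerOn.add (hD : IsOpen D) (sf : SmoothOn D f) (sg : SmoothOn D g) (hf : EulerOn D d f)
    (hg : EulerOn D d g) : EulerOn D d fun x y => f x y + g x y := by
  intro x hx y hy
  simp_rw [dY_add hD sf sg hx hy, mul_add]
  rw [Finset.sum_add_distrib, hf x hx y hy, hg x hx y hy]

lemma EulerOn.const_mul (hD : IsOpen D) (sf : SmoothOn D f) (hf : EulerOn D d f) (c : ℝ) :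
    EulerOn D d fun x y => c * f x y := by
  intro x hx y hy
  simp_rw [dY_const_mul hD sf hx hy, mul_left_comm _ c]
  rw [← Finset.mul_sum, hf x hx y hy]

lemma EulerOn.sum {ι : Type*} {s : Finset ι} {f : ι → Euc n → Euc n → ℝ} (hD : IsOpen D)
    (sf : ∀ i ∈ s, SmoothOn D (f i)) (hf : ∀ i ∈ s, EulerOn D d (f i)) :
    EulerOn D d fun x y => ∑ i ∈ s, f i x y := by
  intro x hx y hy
  simp_rw [dY_sum hD sf hx hy, Finset.mul_sum]
  rw [Finset.sum_comm]
  exact Finset.sum_congr rfl fun i hi => hf i hi x hx y hy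

lemma eulerOn_coord (j : Fin n) : EulerOn D 1 fun _ y => y j := by
  intro x _ y _
  simp [dY_coord]

lemma EulerOn.dX (hD : IsOpen D) (sf : SmoothOn D f) (hf : EulerOn D d f) (j : Fin n) :
    EulerOn D d (dX j f) := by
  intro x hx y hy
  have h1 : FinslerHol.dX j (fun x y => ∑ k, y k * FinslerHol.dY k f x y) x y =
      FinslerHol.dX j (fun x y => d * f x y) x y :=
    dX_congr hD hf hx hy j
  rw [dX_sum hD (fun k _ => (smoothOn_coord k).mul (sf.dY hD k)) hx hy,
    dX_const_mul hD sf hx hy] at h1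
  rw [← h1]
  refine Finset.sum_congr rfl fun k _ => ?_
  rw [dX_mul hD (smoothOn_coord k) (sf.dY hD k) hx hy, dX_coord, dY_dX hD sf hx hy]
  ring

/-- A fibre derivative of a function of degree `d` has degree `d - 1`. -/
lemma EulerOn.dY (hD : IsOpen D) (sf : SmoothOn D f) (hf : EulerOn D d f) (j : Fin n) :
    EulerOn D (d - 1) (dY j f) := by
  intro x hx y hy
  have h1 : FinslerHol.dY j (fun x y => ∑ k, y k * FinslerHol.dY k f x y) x y =
      FinslerHol.dY j (fun x y => d * f x y) x y :=
    dY_congr hf hx hy j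
  rw [dY_sum hD (fun k _ => (smoothOn_coord k).mul (sf.dY hD k)) hx hy,
    dY_const_mul hD sf hx hy] at h1
  have h2 : ∀ k, FinslerHol.dY j (fun x y => y k * FinslerHol.dY k f x y) x y =
      (if j = k then FinslerHol.dY k f x y else 0)
        + y k * FinslerHol.dY k (FinslerHol.dY j f) x y := fun k => by
    rw [dY_mul hD (smoothOn_coord k) (sf.dY hD k) hx hy, dY_coord, dY_dY hD sf hx hy]
    simp
  simp_rw [h2] at h1
  rw [Finset.sum_add_distrib, sum_mul_ite_left] at h1
  linarith

/-- The energy `½ L²`. -/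
noncomputable def energy (L : Euc n → Euc n → ℝ) (x y : Euc n) : ℝ := (1 / 2) * L x y ^ 2

lemma SmoothOn.energy (hL : SmoothOn D L) : SmoothOn D (energy L) := by
  have := (smoothOn_const (D := D) (1 / 2)).mul (hL.mul hL)
  exact this.congr fun x _ y _ => by rw [FinslerHol.energy]; ring

lemma EulerOn.energy (hD : IsOpen D) (sL : SmoothOn D L) (hL : EulerOn D 1 L) :
    EulerOn D 2 (energy L) := by
  have h := (EulerOn.mul hD sL sL hL hL).const_mul hD (sL.mul sL) (1 / 2)
  rw [one_add_one_eq_two] at h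
  exact h.congr fun x _ y _ => by rw [FinslerHol.energy]; ring

lemma fundTensor_eq (hD : IsOpen D) (hL : SmoothOn D L) (hx : x ∈ D) (hy : y ≠ 0) (i j : Fin n) :
    fundTensor L i j x y = dY i (dY j (energy L)) x y := by
  have h2 : SmoothOn D fun x y => L x y ^ 2 := (hL.mul hL).congr fun x _ y _ => sq _
  have h3 : ∀ x ∈ D, ∀ y ≠ 0, dY j (energy L) x y = 1 / 2 * dY j (fun x y => L x y ^ 2) x y :=
    fun x hx y hy => dY_const_mul hD h2 hx hy j _
  rw [fundTensor, dY_congr h3 hx hy, dY_const_mul hD (h2.dY hD j) hx hy]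

lemma sum_fundTensor_mul (hD : IsOpen D) (sL : SmoothOn D L) (hL : EulerOn D 1 L) (hx : x ∈ D)
    (hy : y ≠ 0) (j : Fin n) : ∑ m, fundTensor L j m x y * y m = dY j (energy L) x y := by
  have h := (hL.energy hD sL).dY hD sL.energy j x hx y hy
  rw [show (2 : ℝ) - 1 = 1 by norm_num, one_mul] at h
  rw [← h]
  refine Finset.sum_congr rfl fun k _ => ?_
  rw [fundTensor_eq hD sL hx hy, dY_dY hD sL.energy hx hy, mul_comm]

/-- The lowered geodesic coefficients are half the Euler–Lagrange expression of the energy. -/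
lemma sum_fundTensor_mul_geodCoeff (hD : IsOpen D) (sL : SmoothOn D L) (hL : EulerOn D 1 L)
    (hx : x ∈ D) (hy : y ≠ 0)
    (hdet : IsUnit (Matrix.of fun a b => fundTensor L a b x y).det) (l : Fin n) :
    ∑ i, fundTensor L l i x y * geodCoeff L i x y =
      (1 / 2) * (∑ k, y k * dX k (dY l (energy L)) x y - dX l (energy L) x y) := by
  have sE := sL.energy
  set E := energy L with hE
  set g : Matrix (Fin n) (Fin n) ℝ := Matrix.of fun a b => fundTensor L a b x y with hg
  let B : Fin n → ℝ := fun l => ∑ j, ∑ k,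
    (2 * dX k (fundTensor L j l) x y - dX l (fundTensor L j k) x y) * y j * y k
  have hgX : ∀ a b k : Fin n, dX k (fundTensor L a b) x y = dX k (dY a (dY b E)) x y :=
    fun a b k => dX_congr hD (fun x hx y hy => fundTensor_eq hD sL hx hy a b) hx hy k
  have e2 := hL.energy hD sL
  have e1 : ∀ l, EulerOn D 1 (dY l E) := fun l => by
    have := e2.dY hD sE l
    rwa [show (2 : ℝ) - 1 = 1 by norm_num] at this
  -- contracting `∂g/∂x` with `y` lowers the order of the fibre derivatives
  have hc : ∀ k l : Fin n, ∑ j, y j * dX k (dY j (dY l E)) x y = dX k (dY l E) x y := by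
    intro k l
    have := (e1 l).dX hD (sE.dY hD l) k x hx y hy
    rw [one_mul] at this
    rw [← this]
    exact Finset.sum_congr rfl fun j _ => by rw [dY_dX hD (sE.dY hD l) hx hy]
  have hc2 : ∀ l : Fin n, ∑ j, y j * dX l (dY j E) x y = 2 * dX l E x y := by
    intro l
    rw [← e2.dX hD sE l x hx y hy]
    exact Finset.sum_congr rfl fun j _ => by rw [dY_dX hD sE hx hy]
  have hB : ∀ l, B l = 2 * ∑ k, y k * dX k (dY l E) x y - 2 * dX l E x y := by
    intro l
    have h1 : B l = 2 * ∑ k, y k * ∑ j, y j * dX k (dY j (dY l E)) x y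
        - ∑ k, y k * ∑ j, y j * dX l (dY j (dY k E)) x y := by
      simp only [B, hgX, Finset.mul_sum]
      rw [Finset.sum_comm, ← Finset.sum_sub_distrib]
      refine Finset.sum_congr rfl fun k _ => ?_
      rw [← Finset.sum_sub_distrib]
      exact Finset.sum_congr rfl fun j _ => by ring
    rw [h1]
    simp_rw [hc]
    rw [hc2]
  have hG : ∀ i, geodCoeff L i x y = (1 / 4) * (g⁻¹.mulVec B) i := by
    intro i
    simp only [geodCoeff, Matrix.mulVec, dotProduct, B, Finset.mul_sum, fundTensorInv]
    refine Finset.sum_congr rfl fun l _ => Finset.sum_congr rfl fun j _ =>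
      Finset.sum_congr rfl fun k _ => by ring
  have h3 : ∑ i, fundTensor L l i x y * geodCoeff L i x y = (1 / 4) * B l := by
    have : (g.mulVec (g⁻¹.mulVec B)) l = B l := by
      rw [Matrix.mulVec_mulVec, Matrix.mul_nonsing_inv _ hdet, Matrix.one_mulVec]
    rw [← this]
    conv_rhs => rw [Matrix.mulVec, dotProduct, Finset.mul_sum]
    refine Finset.sum_congr rfl fun i _ => ?_
    rw [hG, hg, Matrix.of_apply]; ring
  rw [h3, hB]; ring

/-- What the Finsler function of a projective metric of constant flag curvature `lam` provides over
a coordinate domain `D`: `E` is the energy and `P` the projective factor. -/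
structure ProjectiveData (D : Set (Euc n)) (L E P : Euc n → Euc n → ℝ) (lam : ℝ) : Prop where
  isOpen : IsOpen D
  smooth_E : SmoothOn D E
  smooth_P : SmoothOn D P
  euler_E : EulerOn D 2 E
  euler_P : EulerOn D 1 P
  geodCoeff_eq : ∀ x ∈ D, ∀ y ≠ 0, ∀ i, geodCoeff L i x y = P x y * y i
  dX_E : ∀ x ∈ D, ∀ y ≠ 0, ∀ l, dX l E x y = 2 * dY l P x y * E x y + P x y * dY l E x y
  curv : ∀ x ∈ D, ∀ y ≠ 0, ∀ i j k, curvCoeff L i j k x y =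
    lam * ((if i = k then dY j E x y else 0) - (if i = j then dY k E x y else 0))

/-- If the geodesic coefficients are proportional to `y`, the factor is `(∑ yᵏ ∂E/∂xᵏ) / 4E`, and
the energy is constant along the horizontal directions. -/
lemma exists_projectiveData {lam : ℝ} (hD : IsOpen D) (sL : SmoothOn D L) (hL : EulerOn D 1 L)
    (hpos : ∀ x ∈ D, ∀ y ≠ 0, L x y ≠ 0)
    (hdet : ∀ x ∈ D, ∀ y ≠ 0, IsUnit (Matrix.of fun a b => fundTensor L a b x y).det)
    (hpar : ∀ x ∈ D, ∀ y ≠ 0, ∃ p : ℝ, ∀ i, geodCoeff L i x y = p * y i)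
    (hcurv : ∀ x ∈ D, ∀ y ≠ 0, ∀ i j k, curvCoeff L i j k x y =
      lam * ((if i = k then ∑ m, fundTensor L j m x y * y m else 0)
        - (if i = j then ∑ m, fundTensor L k m x y * y m else 0))) :
    ∃ P, ProjectiveData D L (energy L) P lam := by
  have sE := sL.energy
  have e2 := hL.energy hD sL
  have hE0 : ∀ x ∈ D, ∀ y ≠ 0, energy L x y ≠ 0 := fun x hx y hy => by
    have := hpos x hx y hy
    rw [energy]; positivity
  have hgE : ∀ x ∈ D, ∀ y ≠ 0, ∀ j, ∑ m, fundTensor L j m x y * y m = dY j (energy L) x y :=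
    fun x hx y hy j => sum_fundTensor_mul hD sL hL hx hy j
  have hEL : ∀ x ∈ D, ∀ y ≠ 0, ∀ p : ℝ, (∀ i, geodCoeff L i x y = p * y i) → ∀ l,
      ∑ k, y k * dX k (dY l (energy L)) x y - dX l (energy L) x y
        = 2 * p * dY l (energy L) x y := by
    intro x hx y hy p hp l
    have h1 := sum_fundTensor_mul_geodCoeff hD sL hL hx hy (hdet x hx y hy) l
    have h2 : ∑ i, fundTensor L l i x y * geodCoeff L i x y = p * dY l (energy L) x y := by
      rw [← hgE x hx y hy l, Finset.mul_sum]
      exact Finset.sum_congr rfl fun i _ => by rw [hp]; ring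
    linarith
  set E := energy L with hE
  let T : Euc n → Euc n → ℝ := fun x y => ∑ k, y k * dX k E x y
  have sT : SmoothOn D T := SmoothOn.sum fun k _ => (smoothOn_coord k).mul (sE.dX hD k)
  have eT : EulerOn D 3 T := EulerOn.sum hD (fun k _ => (smoothOn_coord k).mul (sE.dX hD k))
    fun k _ => by
      have := EulerOn.mul hD (smoothOn_coord k) (sE.dX hD k) (eulerOn_coord k) (e2.dX hD sE k)
      rwa [show (1 : ℝ) + 2 = 3 by norm_num] at this
  have hT : ∀ x ∈ D, ∀ y ≠ 0, ∀ l,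
      dY l T x y = dX l E x y + ∑ k, y k * dX k (dY l E) x y := by
    intro x hx y hy l
    rw [dY_sum hD (fun k _ => (smoothOn_coord k).mul (sE.dX hD k)) hx hy]
    have : ∀ k, dY l (fun x y => y k * dX k E x y) x y =
        (if l = k then dX k E x y else 0) + y k * dX k (dY l E) x y := fun k => by
      rw [dY_mul hD (smoothOn_coord k) (sE.dX hD k) hx hy, dY_coord, dY_dX hD sE hx hy]
      simp
    simp_rw [this]
    rw [Finset.sum_add_distrib, sum_mul_ite_left]
  have hTp : ∀ x ∈ D, ∀ y ≠ 0, ∀ p : ℝ, (∀ i, geodCoeff L i x y = p * y i) →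
      T x y = 4 * p * E x y := by
    intro x hx y hy p hp
    have h1 : ∑ l, y l * (dY l T x y - 2 * dX l E x y) = ∑ l, y l * (2 * p * dY l E x y) :=
      Finset.sum_congr rfl fun l _ => by
        rw [hT x hx y hy, ← hEL x hx y hy p hp]; ring
    have h2 : ∑ l, y l * (dY l T x y - 2 * dX l E x y) =
        (∑ l, y l * dY l T x y) - 2 * T x y := by
      simp only [T, Finset.mul_sum, ← Finset.sum_sub_distrib]
      exact Finset.sum_congr rfl fun l _ => by ring
    have h3 : ∑ l, y l * (2 * p * dY l E x y) = 2 * p * ∑ l, y l * dY l E x y := by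
      rw [Finset.mul_sum]
      exact Finset.sum_congr rfl fun l _ => by ring
    rw [h2, h3, eT x hx y hy, e2 x hx y hy] at h1
    linarith
  let P : Euc n → Euc n → ℝ := fun x y => T x y * (4 * E x y)⁻¹
  have s4E : SmoothOn D fun x y => 4 * E x y := (smoothOn_const 4).mul sE
  have sP : SmoothOn D P := sT.mul (s4E.inv fun x hx y hy => mul_ne_zero (by norm_num)
    (hE0 x hx y hy))
  have hPT : ∀ x ∈ D, ∀ y ≠ 0, T x y = 4 * (P x y * E x y) := fun x hx y hy => by
    have := hE0 x hx y hy
    simp only [P]; field_simp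
  have hG : ∀ x ∈ D, ∀ y ≠ 0, ∀ i, geodCoeff L i x y = P x y * y i := by
    intro x hx y hy i
    obtain ⟨p, hp⟩ := hpar x hx y hy
    have h1 := hTp x hx y hy p hp
    rw [hPT x hx y hy] at h1
    have h2 : P x y = p := mul_right_cancel₀ (hE0 x hx y hy) (by linarith)
    rw [hp, h2]
  have hTl : ∀ x ∈ D, ∀ y ≠ 0, ∀ l,
      dY l T x y = 4 * (dY l P x y * E x y + P x y * dY l E x y) := fun x hx y hy l => by
    rw [dY_congr hPT hx hy, dY_const_mul hD (sP.mul sE) hx hy, dY_mul hD sP sE hx hy]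
  refine ⟨P, hD, sE, sP, e2, ?_, hG, ?_, ?_⟩
  · intro x hx y hy
    have h1 : ∑ l, y l * dY l T x y =
        4 * ((∑ l, y l * dY l P x y) * E x y + P x y * ∑ l, y l * dY l E x y) := by
      rw [Finset.sum_mul, Finset.mul_sum, ← Finset.sum_add_distrib, Finset.mul_sum]
      exact Finset.sum_congr rfl fun l _ => by rw [hTl x hx y hy]; ring
    rw [eT x hx y hy, e2 x hx y hy, hPT x hx y hy] at h1
    exact mul_right_cancel₀ (hE0 x hx y hy) (by linarith)
  · intro x hx y hy l
    have h1 := hEL x hx y hy (P x y) (hG x hx y hy) l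
    have h2 := hT x hx y hy l
    rw [hTl x hx y hy] at h2
    linarith
  · intro x hx y hy i j k
    rw [hcurv x hx y hy, hgE x hx y hy, hgE x hx y hy]

end Energy

/-! ### The Berwald connection of a projective metric of constant curvature -/

section Connection

variable {n : ℕ} {D : Set (Euc n)} {f g L E P : Euc n → Euc n → ℝ} {x y : Euc n} {lam : ℝ}

/-- The vertical field `ξ` is smooth over `D` and tangent to all indicatrices. -/
structure IsTangentField (D : Set (Euc n)) (E : Euc n → Euc n → ℝ)
    (ξ : Euc n → Euc n → Euc n) : Prop where
  smooth : ∀ i, SmoothOn D fun x y => ξ x y i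
  tangent : ∀ x ∈ D, ∀ y ≠ 0, ∑ i, dY i E x y * ξ x y i = 0

namespace ProjectiveData

lemma connCoeff_eq (h : ProjectiveData D L E P lam) (hx : x ∈ D) (hy : y ≠ 0) (i j : Fin n) :
    connCoeff L i j x y = dY j P x y * y i + if i = j then P x y else 0 := by
  rw [connCoeff, dY_congr (fun x hx y hy => h.geodCoeff_eq x hx y hy i) hx hy,
    dY_mul h.isOpen h.smooth_P (smoothOn_coord i) hx hy, dY_coord]
  by_cases hij : i = j
  · subst hij; simp
  · simp [hij, Ne.symm hij]

lemma berwaldCoeff_eq (h : ProjectiveData D L E P lam) (hx : x ∈ D) (hy : y ≠ 0)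
    (i j k : Fin n) :
    berwaldCoeff L i j k x y = dY k (dY j P) x y * y i + (if i = k then dY j P x y else 0)
      + (if i = j then dY k P x y else 0) := by
  have sPj := h.smooth_P.dY h.isOpen j
  have hc : ∀ x ∈ D, ∀ y ≠ 0, connCoeff L i j x y =
      dY j P x y * y i + (if i = j then 1 else 0) * P x y := fun x hx y hy => by
    rw [h.connCoeff_eq hx hy]; simp
  rw [berwaldCoeff, dY_congr hc hx hy,
    dY_add h.isOpen (sPj.mul (smoothOn_coord i)) ((smoothOn_const _).mul h.smooth_P) hx hy,
    dY_mul h.isOpen sPj (smoothOn_coord i) hx hy, dY_const_mul h.isOpen h.smooth_P hx hy, dY_coord]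
  simp [eq_comm]

lemma sum_coord_mul_dY_dY_P (h : ProjectiveData D L E P lam) (hx : x ∈ D) (hy : y ≠ 0)
    (j : Fin n) : ∑ m, y m * dY m (dY j P) x y = 0 := by
  have := h.euler_P.dY h.isOpen h.smooth_P j x hx y hy
  simpa using this

lemma euler_dY_E (h : ProjectiveData D L E P lam) (j : Fin n) : EulerOn D 1 (dY j E) := by
  have := h.euler_E.dY h.isOpen h.smooth_E j
  rwa [show (2 : ℝ) - 1 = 1 by norm_num] at this

lemma euler_dY_P (h : ProjectiveData D L E P lam) (j : Fin n) : EulerOn D 0 (dY j P) := by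
  have := h.euler_P.dY h.isOpen h.smooth_P j
  rwa [sub_self] at this

lemma sum_connCoeff_mul (h : ProjectiveData D L E P lam) (hx : x ∈ D) (hy : y ≠ 0) (j : Fin n)
    (u : Fin n → ℝ) :
    ∑ m, connCoeff L m j x y * u m = dY j P x y * (∑ m, y m * u m) + P x y * u j := by
  have : ∀ m, connCoeff L m j x y * u m =
      dY j P x y * (y m * u m) + (if j = m then P x y * u m else 0) := fun m => by
    rw [h.connCoeff_eq hx hy]
    by_cases hm : m = j
    · simp [hm]; ring
    · simp [hm, Ne.symm hm]; ring
  simp_rw [this]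
  rw [Finset.sum_add_distrib, ← Finset.mul_sum, sum_mul_ite_left]

lemma sum_berwaldCoeff_mul (h : ProjectiveData D L E P lam) (hx : x ∈ D) (hy : y ≠ 0)
    (i j : Fin n) (u : Fin n → ℝ) :
    ∑ m, berwaldCoeff L i j m x y * u m = y i * (∑ m, dY m (dY j P) x y * u m)
      + dY j P x y * u i + (if i = j then ∑ m, dY m P x y * u m else 0) := by
  have : ∀ m, berwaldCoeff L i j m x y * u m = y i * (dY m (dY j P) x y * u m)
      + (if i = m then dY j P x y * u m else 0)
      + (if i = j then dY m P x y * u m else 0) := fun m => by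
    rw [h.berwaldCoeff_eq hx hy]
    split_ifs <;> ring
  simp_rw [this]
  rw [Finset.sum_add_distrib, Finset.sum_add_distrib, ← Finset.mul_sum, sum_mul_ite_left]
  split_ifs <;> simp

/-- The curvature in terms of the projective factor. -/
lemma curvCoeff_eq (h : ProjectiveData D L E P lam) (hx : x ∈ D) (hy : y ≠ 0) (i j k : Fin n) :
    curvCoeff L i j k x y = y i * (dX k (dY j P) x y - dX j (dY k P) x y)
      + (if i = k then P x y * dY j P x y - dX j P x y else 0)
      - (if i = j then P x y * dY k P x y - dX k P x y else 0) := by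
  have hD := h.isOpen
  have hdX : ∀ j k, dX k (connCoeff L i j) x y =
      dX k (dY j P) x y * y i + if i = j then dX k P x y else 0 := by
    intro j k
    have sPj := h.smooth_P.dY hD j
    have hc : ∀ x ∈ D, ∀ y ≠ 0, connCoeff L i j x y =
        dY j P x y * y i + (if i = j then 1 else 0) * P x y := fun x hx y hy => by
      rw [h.connCoeff_eq hx hy]; simp
    rw [dX_congr hD hc hx hy,
      dX_add hD (sPj.mul (smoothOn_coord i)) ((smoothOn_const _).mul h.smooth_P) hx hy,
      dX_mul hD sPj (smoothOn_coord i) hx hy, dX_const_mul hD h.smooth_P hx hy, dX_coord]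
    simp
  have hsum : ∀ j k, ∑ m, connCoeff L m j x y * berwaldCoeff L i k m x y =
      dY j P x y * (y i * dY k P x y + if i = k then P x y else 0)
      + P x y * berwaldCoeff L i k j x y := by
    intro j k
    rw [h.sum_connCoeff_mul hx hy]
    congr 2
    have := h.sum_berwaldCoeff_mul hx hy i k (fun m => y m)
    simp_rw [mul_comm (y _) (berwaldCoeff _ _ _ _ _ _)]
    rw [this]
    have h1 := h.sum_coord_mul_dY_dY_P hx hy k
    have h2 := h.euler_P x hx y hy
    simp_rw [mul_comm (y _)] at h1 h2
    rw [h1, h2]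
    simp [mul_comm]
  rw [curvCoeff, hdX, hdX, Finset.sum_sub_distrib, hsum, hsum, h.berwaldCoeff_eq hx hy,
    h.berwaldCoeff_eq hx hy, dY_dY hD h.smooth_P hx hy k j]
  split_ifs <;> ring

/-- Constant curvature prescribes the horizontal derivatives of the projective factor: the covector
`A_j = P P_j - ∂P/∂xʲ - lam E_j` satisfies `(n + 1) A_j = ∂(A_k yᵏ)/∂yʲ`, by tracing the curvature
tensor; contracting with `yʲ` gives `A_k yᵏ = 0` unless `n = 1`. -/
lemma dX_P (h : ProjectiveData D L E P lam) (hn : n ≠ 1) (hx : x ∈ D) (hy : y ≠ 0) (j : Fin n) :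
    dX j P x y = P x y * dY j P x y - lam * dY j E x y := by
  have hD := h.isOpen
  have sP := h.smooth_P
  have sE := h.smooth_E
  let A : Fin n → Euc n → Euc n → ℝ := fun j x y =>
    P x y * dY j P x y - dX j P x y - lam * dY j E x y
  have s1 : ∀ j, SmoothOn D fun x y => P x y * dY j P x y := fun j => sP.mul (sP.dY hD j)
  have s2 : ∀ j, SmoothOn D fun x y => P x y * dY j P x y - dX j P x y := fun j =>
    (s1 j).sub (sP.dX hD j)
  have s3 : ∀ j, SmoothOn D fun x y => lam * dY j E x y := fun j =>
    (smoothOn_const lam).mul (sE.dY hD j)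
  have sA : ∀ j, SmoothOn D (A j) := fun j => (s2 j).sub (s3 j)
  have eA : ∀ j, EulerOn D 1 (A j) := fun j => by
    have e1 : EulerOn D 1 fun x y => P x y * dY j P x y := by
      have := EulerOn.mul hD sP (sP.dY hD j) h.euler_P (h.euler_dY_P j)
      rwa [add_zero] at this
    have e2 : EulerOn D 1 fun x y => P x y * dY j P x y - dX j P x y :=
      e1.sub hD (s1 j) (sP.dX hD j) (h.euler_P.dX hD sP j)
    exact e2.sub hD (s2 j) (s3 j) ((h.euler_dY_E j).const_mul hD (sE.dY hD j) lam)
  have hAk : ∀ x ∈ D, ∀ y ≠ 0, ∀ j k, dY k (A j) x y =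
      dY k P x y * dY j P x y + P x y * dY k (dY j P) x y - dX j (dY k P) x y
        - lam * dY k (dY j E) x y := by
    intro x hx y hy j k
    rw [dY_sub hD (s2 j) (s3 j) hx hy, dY_sub hD (s1 j) (sP.dX hD j) hx hy,
      dY_mul hD sP (sP.dY hD j) hx hy, dY_const_mul hD (sE.dY hD j) hx hy, dY_dX hD sP hx hy]
  let A₀ : Euc n → Euc n → ℝ := fun x y => ∑ k, y k * A k x y
  have sA₀' : ∀ k, SmoothOn D fun x y => y k * A k x y := fun k => (smoothOn_coord k).mul (sA k)
  have eA₀ : EulerOn D 2 A₀ := EulerOn.sum hD (fun k _ => sA₀' k) fun k _ => by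
    have := EulerOn.mul hD (smoothOn_coord k) (sA k) (eulerOn_coord k) (eA k)
    rwa [one_add_one_eq_two] at this
  have hA₀ : ∀ x ∈ D, ∀ y ≠ 0, ∀ j, dY j A₀ x y = A j x y + ∑ k, y k * dY j (A k) x y := by
    intro x hx y hy j
    rw [dY_sum hD (fun k _ => sA₀' k) hx hy]
    have : ∀ k, dY j (fun x y => y k * A k x y) x y =
        (if j = k then A k x y else 0) + y k * dY j (A k) x y := fun k => by
      rw [dY_mul hD (smoothOn_coord k) (sA k) hx hy, dY_coord]
      simp
    simp_rw [this]
    rw [Finset.sum_add_distrib, sum_mul_ite_left]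
  have key : ∀ x ∈ D, ∀ y ≠ 0, ∀ j, (n + 1 : ℝ) * A j x y = dY j A₀ x y := by
    intro x hx y hy j
    have h1 : ∀ k, (A j x y + (y k * dY k (A j) x y - y k * dY j (A k) x y))
        - (if j = k then A k x y else 0) = 0 := by
      intro k
      have h2 := h.curvCoeff_eq hx hy k j k
      rw [h.curv x hx y hy k j k] at h2
      rw [← mul_sub, hAk x hx y hy, hAk x hx y hy, dY_dY hD sP hx hy k j, dY_dY hD sE hx hy k j]
      simp only [A]
      by_cases hjk : j = k
      · subst hjk; simp
      · simp only [if_true, if_neg (Ne.symm hjk), if_neg hjk] at h2 ⊢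
        linarith
    have h3 : ∑ k, ((A j x y + (y k * dY k (A j) x y - y k * dY j (A k) x y))
        - (if j = k then A k x y else 0)) = 0 := Finset.sum_eq_zero fun k _ => h1 k
    rw [Finset.sum_sub_distrib, sum_mul_ite_left, Finset.sum_add_distrib,
      Finset.sum_sub_distrib (fun k => y k * dY k (A j) x y), eA j x hx y hy] at h3
    simp only [Finset.sum_const, Finset.card_univ, Fintype.card_fin, nsmul_eq_mul] at h3
    rw [hA₀ x hx y hy]
    linarith
  have hz : ∀ x ∈ D, ∀ y ≠ 0, A₀ x y = 0 := by
    intro x hx y hy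
    have h1 : ∑ j, y j * ((n + 1 : ℝ) * A j x y) = (n + 1) * A₀ x y := by
      simp only [A₀, Finset.mul_sum]
      exact Finset.sum_congr rfl fun j _ => by ring
    have h2 := eA₀ x hx y hy
    simp_rw [← key x hx y hy] at h2
    rw [h1] at h2
    have h3 : ((n : ℝ) - 1) * A₀ x y = 0 := by linarith
    rcases mul_eq_zero.1 h3 with h4 | h4
    · exact absurd (by exact_mod_cast sub_eq_zero.1 h4) hn
    · exact h4
  have h5 := key x hx y hy j
  rw [dY_congr hz hx hy, dY_const] at h5
  rcases mul_eq_zero.1 h5 with h6 | h6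
  · exact absurd h6 (by positivity)
  · simp only [A] at h6; linarith

lemma dX_dY_E (h : ProjectiveData D L E P lam) (hx : x ∈ D) (hy : y ≠ 0) (i a : Fin n) :
    dX i (dY a E) x y = 2 * dY a (dY i P) x y * E x y + 2 * dY i P x y * dY a E x y
      + dY a P x y * dY i E x y + P x y * dY i (dY a E) x y := by
  have hD := h.isOpen
  have sP := h.smooth_P
  have sE := h.smooth_E
  have hc : ∀ x ∈ D, ∀ y ≠ 0, dX i E x y = 2 * (dY i P x y * E x y) + P x y * dY i E x y :=
    fun x hx y hy => by rw [h.dX_E x hx y hy]; ring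
  rw [← dY_dX hD sE hx hy, dY_congr hc hx hy,
    dY_add hD ((smoothOn_const _).mul ((sP.dY hD i).mul sE)) (sP.mul (sE.dY hD i)) hx hy,
    dY_const_mul hD ((sP.dY hD i).mul sE) hx hy, dY_mul hD (sP.dY hD i) sE hx hy,
    dY_mul hD sP (sE.dY hD i) hx hy, dY_dY hD sE hx hy i a]
  ring

/-! ### The horizontal covariant derivative -/

lemma covDeriv_apply (h : ProjectiveData D L E P lam) (hx : x ∈ D) (hy : y ≠ 0)
    (X : Euc n → Euc n) (ξ : Euc n → Euc n → Euc n) (i : Fin n) :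
    covDeriv L X ξ x y i = ∑ j, (dX j (fun x y => ξ x y i) x y
      - dY j P x y * (∑ k, y k * dY k (fun x y => ξ x y i) x y)
      - P x y * dY j (fun x y => ξ x y i) x y
      + y i * (∑ k, dY k (dY j P) x y * ξ x y k) + dY j P x y * ξ x y i
      + (if i = j then ∑ k, dY k P x y * ξ x y k else 0)) * X x j := by
  change ∑ j : Fin n, _ = _
  refine Finset.sum_congr rfl fun j _ => ?_
  rw [h.sum_connCoeff_mul hx hy, h.sum_berwaldCoeff_mul hx hy]
  ring

lemma smoothOn_field {X : Euc n → Euc n} (hX : ContDiffOn ℝ ∞ X D) (j : Fin n) :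
    SmoothOn D fun x _ => X x j := by
  have h1 : ContDiffOn ℝ ∞ (fun p : Euc n × Euc n => X p.1) (D ×ˢ {0}ᶜ) :=
    hX.comp contDiffOn_fst fun p hp => hp.1
  exact (EuclideanSpace.proj (𝕜 := ℝ) j).contDiff.comp_contDiffOn h1

lemma isTangentField_curvField (h : ProjectiveData D L E P lam) {X Y : Euc n → Euc n}
    (hX : ContDiffOn ℝ ∞ X D) (hY : ContDiffOn ℝ ∞ Y D) :
    IsTangentField D E (curvField L X Y) := by
  have hD := h.isOpen
  refine ⟨fun i => ?_, fun x hx y hy => ?_⟩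
  · have : SmoothOn D fun x y => ∑ j, ∑ k, lam * ((if i = k then 1 else 0) * dY j E x y
        - (if i = j then 1 else 0) * dY k E x y) * X x j * Y x k :=
      SmoothOn.sum fun j _ => SmoothOn.sum fun k _ =>
        (((smoothOn_const _).mul (((smoothOn_const _).mul (h.smooth_E.dY hD j)).sub
          ((smoothOn_const _).mul (h.smooth_E.dY hD k)))).mul (smoothOn_field hX j)).mul
          (smoothOn_field hY k)
    refine this.congr fun x hx y hy => ?_
    change ∑ j : Fin n, _ = _
    refine Finset.sum_congr rfl fun j _ => Finset.sum_congr rfl fun k _ => ?_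
    rw [h.curv x hx y hy]
    simp
  · have h1 : ∀ i, dY i E x y * curvField L X Y x y i = ∑ j, ∑ k, lam * X x j * Y x k *
        ((if i = k then dY i E x y * dY j E x y else 0)
          - (if i = j then dY i E x y * dY k E x y else 0)) := fun i => by
      rw [curvField, Finset.mul_sum]
      refine Finset.sum_congr rfl fun j _ => ?_
      rw [Finset.mul_sum]
      refine Finset.sum_congr rfl fun k _ => ?_
      rw [h.curv x hx y hy]
      split_ifs <;> ring
    simp_rw [h1]
    rw [Finset.sum_comm]
    refine Finset.sum_eq_zero fun j _ => ?_
    rw [Finset.sum_comm]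
    refine Finset.sum_eq_zero fun k _ => ?_
    rw [← Finset.mul_sum, Finset.sum_sub_distrib]
    simp [mul_comm]

/-- Horizontal derivation keeps fields tangent to the indicatrices, as the energy is constant along
horizontal directions. -/
lemma isTangentField_covDeriv (h : ProjectiveData D L E P lam) {X : Euc n → Euc n}
    {ξ : Euc n → Euc n → Euc n} (hX : ContDiffOn ℝ ∞ X D) (hξ : IsTangentField D E ξ) :
    IsTangentField D E (covDeriv L X ξ) := by
  have hD := h.isOpen
  have sP := h.smooth_P
  have sE := h.smooth_E
  refine ⟨fun i => ?_, fun x hx y hy => ?_⟩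
  · have si := hξ.smooth i
    have : SmoothOn D fun x y => ∑ j, (dX j (fun x y => ξ x y i) x y
      - dY j P x y * (∑ k, y k * dY k (fun x y => ξ x y i) x y)
      - P x y * dY j (fun x y => ξ x y i) x y
      + y i * (∑ k, dY k (dY j P) x y * ξ x y k) + dY j P x y * ξ x y i
      + (if i = j then 1 else 0) * ∑ k, dY k P x y * ξ x y k) * X x j := by
      refine SmoothOn.sum fun j _ => SmoothOn.mul ?_ (smoothOn_field hX j)
      refine ((((((si.dX hD j).sub ((sP.dY hD j).mul (SmoothOn.sum fun k _ =>
        (smoothOn_coord k).mul (si.dY hD k)))).sub (sP.mul (si.dY hD j))).add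
        ((smoothOn_coord i).mul (SmoothOn.sum fun k _ =>
          ((sP.dY hD j).dY hD k).mul (hξ.smooth k)))).add ((sP.dY hD j).mul si)).add
        ((smoothOn_const _).mul (SmoothOn.sum fun k _ => (sP.dY hD k).mul (hξ.smooth k))))
    refine this.congr fun x hx y hy => ?_
    rw [h.covDeriv_apply hx hy]
    simp
  · have h0 : ∀ i, dY i E x y * covDeriv L X ξ x y i = ∑ j, (dY i E x y *
      (dX j (fun x y => ξ x y i) x y
      - dY j P x y * (∑ k, y k * dY k (fun x y => ξ x y i) x y)
      - P x y * dY j (fun x y => ξ x y i) x y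
      + y i * (∑ k, dY k (dY j P) x y * ξ x y k) + dY j P x y * ξ x y i
      + (if i = j then ∑ k, dY k P x y * ξ x y k else 0))) * X x j := fun i => by
      rw [h.covDeriv_apply hx hy, Finset.mul_sum]
      exact Finset.sum_congr rfl fun j _ => by ring
    simp_rw [h0]
    rw [Finset.sum_comm]
    refine Finset.sum_eq_zero fun j _ => ?_
    rw [← Finset.sum_mul]
    refine mul_eq_zero_of_left ?_ _
    have s1 : ∀ i ∈ Finset.univ, SmoothOn D fun x y => dY i E x y * ξ x y i := fun i _ =>
      (sE.dY hD i).mul (hξ.smooth i)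
    have t1 : ∑ i, (dX j (dY i E) x y * ξ x y i + dY i E x y * dX j (fun x y => ξ x y i) x y)
        = 0 := by
      have := dX_congr hD hξ.tangent hx hy j
      rw [dX_const, dX_sum hD s1 hx hy] at this
      rw [← this]
      exact Finset.sum_congr rfl fun i _ => (dX_mul hD (sE.dY hD i) (hξ.smooth i) hx hy j).symm
    have t2 : ∀ k, ∑ i, dY i E x y * dY k (fun x y => ξ x y i) x y =
        - ∑ i, dY k (dY i E) x y * ξ x y i := by
      intro k
      have := dY_congr hξ.tangent hx hy k
      rw [dY_const, dY_sum hD s1 hx hy] at this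
      rw [eq_neg_iff_add_eq_zero, ← this, ← Finset.sum_add_distrib]
      refine Finset.sum_congr rfl fun i _ => ?_
      rw [dY_mul hD (sE.dY hD i) (hξ.smooth i) hx hy k]; ring
    have t3 : ∑ i, dY i E x y * (∑ k, y k * dY k (fun x y => ξ x y i) x y) = 0 := by
      have h1 : ∑ i, dY i E x y * (∑ k, y k * dY k (fun x y => ξ x y i) x y) =
          ∑ k, y k * ∑ i, dY i E x y * dY k (fun x y => ξ x y i) x y := by
        simp_rw [Finset.mul_sum]
        rw [Finset.sum_comm]
        exact Finset.sum_congr rfl fun k _ => Finset.sum_congr rfl fun i _ => by ring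
      have h2 : ∑ k, y k * (- ∑ i, dY k (dY i E) x y * ξ x y i) =
          - ∑ i, (∑ k, y k * dY k (dY i E) x y) * ξ x y i := by
        simp_rw [mul_neg, Finset.sum_neg_distrib, Finset.mul_sum, Finset.sum_mul]
        rw [Finset.sum_comm]
        congr 1
        exact Finset.sum_congr rfl fun k _ => Finset.sum_congr rfl fun i _ => by ring
      rw [h1]
      simp_rw [t2]
      rw [h2]
      simp_rw [h.euler_dY_E _ x hx y hy, one_mul]
      rw [hξ.tangent x hx y hy, neg_zero]
    have t4 := hξ.tangent x hx y hy
    have t5 : ∑ i, dX j (dY i E) x y * ξ x y i =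
        2 * E x y * (∑ i, dY i (dY j P) x y * ξ x y i)
        + dY j E x y * (∑ i, dY i P x y * ξ x y i)
        + P x y * ∑ i, dY j (dY i E) x y * ξ x y i := by
      have : ∀ i, dX j (dY i E) x y * ξ x y i = 2 * E x y * (dY i (dY j P) x y * ξ x y i)
          + 2 * dY j P x y * (dY i E x y * ξ x y i) + dY j E x y * (dY i P x y * ξ x y i)
          + P x y * (dY j (dY i E) x y * ξ x y i) := fun i => by
        rw [h.dX_dY_E hx hy]; ring
      simp_rw [this, Finset.sum_add_distrib, ← Finset.mul_sum, t4]
      ring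
    have t6 : ∑ i, dY i E x y * y i = 2 * E x y := by
      rw [← h.euler_E x hx y hy]
      exact Finset.sum_congr rfl fun i _ => mul_comm _ _
    set S1 := ∑ k, dY k (dY j P) x y * ξ x y k
    set S2 := ∑ k, dY k P x y * ξ x y k
    have t7 : ∀ i, dY i E x y * (dX j (fun x y => ξ x y i) x y
        - dY j P x y * (∑ k, y k * dY k (fun x y => ξ x y i) x y)
        - P x y * dY j (fun x y => ξ x y i) x y + y i * S1 + dY j P x y * ξ x y i
        + (if i = j then S2 else 0)) =
      (dX j (dY i E) x y * ξ x y i + dY i E x y * dX j (fun x y => ξ x y i) x y)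
      - dX j (dY i E) x y * ξ x y i
      - dY j P x y * (dY i E x y * ∑ k, y k * dY k (fun x y => ξ x y i) x y)
      - P x y * (dY i E x y * dY j (fun x y => ξ x y i) x y)
      + (dY i E x y * y i) * S1 + dY j P x y * (dY i E x y * ξ x y i)
      + (if j = i then dY i E x y * S2 else 0) := fun i => by
      by_cases hij : i = j
      · simp only [hij, if_true]; ring
      · simp only [if_neg hij, if_neg (Ne.symm hij)]; ring
    simp_rw [t7]
    rw [Finset.sum_add_distrib, Finset.sum_add_distrib, Finset.sum_add_distrib,
      Finset.sum_sub_distrib, Finset.sum_sub_distrib, Finset.sum_sub_distrib, t1, t5,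
      ← Finset.mul_sum, t3, ← Finset.mul_sum, t2, ← Finset.sum_mul, t6, ← Finset.mul_sum, t4,
      sum_mul_ite_left]
    ring

end ProjectiveData

end Connection

/-! ### The second covariant derivative of the curvature -/

section SecondDerivative

variable {n : ℕ} {D : Set (Euc n)} {f g L E P : Euc n → Euc n → ℝ} {x y : Euc n} {lam : ℝ}

/-- The derivation `∂/∂xⁱ - P ∂/∂yⁱ`.  For a projective metric with factor `P` it differs from the
horizontal derivation `∂/∂xⁱ - Gᵏ_i ∂/∂yᵏ` by a multiple of the Euler derivation. -/
noncomputable def dH (P : Euc n → Euc n → ℝ) (i : Fin n) (f : Euc n → Euc n → ℝ)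
    (x y : Euc n) : ℝ :=
  dX i f x y - P x y * dY i f x y

section Rules

variable (hD : IsOpen D) (hf : SmoothOn D f) (hg : SmoothOn D g) (hx : x ∈ D) (hy : y ≠ 0)
  (i : Fin n)
include hD hf hx hy

lemma dH_const_mul (c : ℝ) : dH P i (fun x y => c * f x y) x y = c * dH P i f x y := by
  rw [dH, dH, dX_const_mul hD hf hx hy, dY_const_mul hD hf hx hy]; ring

include hg

lemma dH_add : dH P i (fun x y => f x y + g x y) x y = dH P i f x y + dH P i g x y := by
  rw [dH, dH, dH, dX_add hD hf hg hx hy, dY_add hD hf hg hx hy]; ring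

lemma dH_sub : dH P i (fun x y => f x y - g x y) x y = dH P i f x y - dH P i g x y := by
  rw [dH, dH, dH, dX_sub hD hf hg hx hy, dY_sub hD hf hg hx hy]; ring

lemma dH_mul : dH P i (fun x y => f x y * g x y) x y =
    dH P i f x y * g x y + f x y * dH P i g x y := by
  rw [dH, dH, dH, dX_mul hD hf hg hx hy, dY_mul hD hf hg hx hy]; ring

end Rules

lemma dH_congr (hD : IsOpen D) (h : ∀ x ∈ D, ∀ y ≠ 0, f x y = g x y) (hx : x ∈ D) (hy : y ≠ 0)
    (i : Fin n) : dH P i f x y = dH P i g x y := by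
  rw [dH, dH, dX_congr hD h hx hy, dY_congr h hx hy]

lemma dH_coord (i k : Fin n) : dH P i (fun _ y => y k) x y = if k = i then - P x y else 0 := by
  rw [dH, dX_coord, dY_coord]
  by_cases h : i = k
  · simp [h]
  · simp [h, Ne.symm h]

namespace ProjectiveData

variable (h : ProjectiveData D L E P lam)
include h

lemma dH_E (hx : x ∈ D) (hy : y ≠ 0) (i : Fin n) :
    dH P i E x y = 2 * dY i P x y * E x y := by
  rw [dH, h.dX_E x hx y hy]; ring

lemma dH_dY_E (hx : x ∈ D) (hy : y ≠ 0) (i a : Fin n) :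
    dH P i (dY a E) x y = 2 * dY a (dY i P) x y * E x y + 2 * dY i P x y * dY a E x y
      + dY a P x y * dY i E x y := by
  rw [dH, h.dX_dY_E hx hy]; ring

lemma dX_dY_P (hn : n ≠ 1) (hx : x ∈ D) (hy : y ≠ 0) (i a : Fin n) :
    dX i (dY a P) x y = dY a P x y * dY i P x y + P x y * dY a (dY i P) x y
      - lam * dY a (dY i E) x y := by
  have hD := h.isOpen
  have sP := h.smooth_P
  have sE := h.smooth_E
  rw [← dY_dX hD sP hx hy, dY_congr (fun x hx y hy => h.dX_P hn hx hy i) hx hy,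
    dY_sub hD (sP.mul (sP.dY hD i)) ((smoothOn_const _).mul (sE.dY hD i)) hx hy,
    dY_mul hD sP (sP.dY hD i) hx hy, dY_const_mul hD (sE.dY hD i) hx hy]

lemma dH_dY_P (hn : n ≠ 1) (hx : x ∈ D) (hy : y ≠ 0) (i a : Fin n) :
    dH P i (dY a P) x y = dY a P x y * dY i P x y - lam * dY a (dY i E) x y := by
  rw [dH, h.dX_dY_P hn hx hy, dY_dY h.isOpen h.smooth_P hx hy i a]; ring

lemma dH_dY_dY_P (hn : n ≠ 1) (hx : x ∈ D) (hy : y ≠ 0) (i a b : Fin n) :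
    dH P i (dY b (dY a P)) x y = dY b (dY a P) x y * dY i P x y
      + dY a P x y * dY b (dY i P) x y + dY b P x y * dY a (dY i P) x y
      - lam * dY b (dY a (dY i E)) x y := by
  have hD := h.isOpen
  have sP := h.smooth_P
  have sE := h.smooth_E
  have sPa := sP.dY hD a
  have sPi := sP.dY hD i
  have h1 : dY i (dY b (dY a P)) x y = dY b (dY a (dY i P)) x y := by
    rw [dY_dY hD sPa hx hy, dY_congr (fun x hx y hy => dY_dY hD sP hx hy i a) hx hy]
  rw [dH, ← dY_dX hD sPa hx hy, dY_congr (fun x hx y hy => h.dX_dY_P hn hx hy i a) hx hy,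
    dY_sub hD ((sPa.mul sPi).add (sP.mul (sPi.dY hD a)))
      ((smoothOn_const _).mul ((sE.dY hD i).dY hD a)) hx hy,
    dY_add hD (sPa.mul sPi) (sP.mul (sPi.dY hD a)) hx hy, dY_mul hD sPa sPi hx hy,
    dY_mul hD sP (sPi.dY hD a) hx hy, dY_const_mul hD ((sE.dY hD i).dY hD a) hx hy, h1]
  ring

/-- The covariant derivative, in a constant coordinate direction, of a field of degree `1`. -/
lemma covDeriv_const_apply (hx : x ∈ D) (hy : y ≠ 0) {X : Euc n → Euc n} {i : Fin n}
    (hX : X x = EuclideanSpace.single i 1) {ξ : Euc n → Euc n → Euc n}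
    (eξ : ∀ k, EulerOn D 1 fun x y => ξ x y k) (k : Fin n) :
    covDeriv L X ξ x y k = dH P i (fun x y => ξ x y k) x y
      + y k * (∑ m, dY m (dY i P) x y * ξ x y m)
      + (if k = i then ∑ m, dY m P x y * ξ x y m else 0) := by
  rw [h.covDeriv_apply hx hy, Finset.sum_eq_single i]
  · rw [eξ k x hx y hy, hX, dH]; simp; ring
  · intro j _ hj
    rw [hX]; simp [hj]
  · simp

section Fields

variable {X Y : Euc n → Euc n} {i j : Fin n}

lemma curvField_const_apply (hx : x ∈ D) (hy : y ≠ 0)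
    (hX : X x = EuclideanSpace.single i 1) (hY : Y x = EuclideanSpace.single j 1) (k : Fin n) :
    curvField L X Y x y k =
      lam * ((if k = j then dY i E x y else 0) - (if k = i then dY j E x y else 0)) := by
  change ∑ a : Fin n, _ = _
  rw [Finset.sum_eq_single i, Finset.sum_eq_single j]
  · rw [h.curv x hx y hy, hX, hY]; simp
  · intro b _ hb; rw [hY]; simp [hb]
  · simp
  · intro a _ ha
    refine Finset.sum_eq_zero fun b _ => ?_
    rw [hX]; simp [ha]
  · simp

omit h in
lemma sum_mul_combination (hij : i ≠ j) (u : Fin n → ℝ) (c α β γ : ℝ) (y : Euc n) :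
    ∑ m, u m * (c * ((if m = j then α else 0) - (if m = i then β else 0) + y m * γ)) =
      c * (u j * α - u i * β + (∑ m, y m * u m) * γ) := by
  have : ∀ m, u m * (c * ((if m = j then α else 0) - (if m = i then β else 0) + y m * γ)) =
      (if j = m then c * (u m * α) else 0) - (if i = m then c * (u m * β) else 0)
        + y m * u m * (c * γ) := fun m => by
    by_cases h1 : m = j
    · subst h1; simp [hij, Ne.symm hij]; ring
    · by_cases h2 : m = i
      · subst h2; simp [hij, Ne.symm hij]; ring
      · simp [h1, h2, Ne.symm h1, Ne.symm h2]; ring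
  simp_rw [this]
  rw [Finset.sum_add_distrib, Finset.sum_sub_distrib, sum_mul_ite_left, sum_mul_ite_left,
    ← Finset.sum_mul]
  ring

/-- `∇_X R(X, Y)` for the constant fields `X = ∂/∂xⁱ`, `Y = ∂/∂xʲ`. -/
lemma covDeriv_curvField_apply (hij : i ≠ j) (hX : ∀ x ∈ D, X x = EuclideanSpace.single i 1)
    (hY : ∀ x ∈ D, Y x = EuclideanSpace.single j 1) (hx : x ∈ D) (hy : y ≠ 0) (k : Fin n) :
    covDeriv L X (curvField L X Y) x y k = lam *
      ((if k = j then 3 * dY i P x y * dY i E x y + 2 * dY i (dY i P) x y * E x y else 0)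
      - (if k = i then 3 * dY i P x y * dY j E x y + 2 * dY j (dY i P) x y * E x y else 0)
      + y k * (dY j (dY i P) x y * dY i E x y - dY i (dY i P) x y * dY j E x y)) := by
  have hD := h.isOpen
  have sE := h.smooth_E
  have hc : ∀ k, ∀ x ∈ D, ∀ y ≠ 0, curvField L X Y x y k =
      lam * ((if k = j then 1 else 0) * dY i E x y - (if k = i then 1 else 0) * dY j E x y) :=
    fun k x hx y hy => by
      rw [h.curvField_const_apply hx hy (hX x hx) (hY x hx)]; simp
  have s1 : ∀ (c : ℝ) a, SmoothOn D fun x y => c * dY a E x y := fun c a =>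
    (smoothOn_const c).mul (sE.dY hD a)
  have e1 : ∀ k, EulerOn D 1 fun x y => curvField L X Y x y k := fun k =>
    ((((h.euler_dY_E i).const_mul hD (sE.dY hD i) _).sub hD (s1 _ i) (s1 _ j)
      ((h.euler_dY_E j).const_mul hD (sE.dY hD j) _)).const_mul hD
      ((s1 _ i).sub (s1 _ j)) lam).congr (hc k)
  have hsum : ∀ u : Fin n → ℝ, ∑ m, u m * curvField L X Y x y m =
      lam * (u j * dY i E x y - u i * dY j E x y) := fun u => by
    have := sum_mul_combination hij u lam (dY i E x y) (dY j E x y) 0 y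
    simp only [mul_zero, add_zero] at this
    rw [← this]
    exact Finset.sum_congr rfl fun m _ => by
      rw [h.curvField_const_apply hx hy (hX x hx) (hY x hx)]
  rw [h.covDeriv_const_apply hx hy (hX x hx) e1, dH_congr hD (hc k) hx hy,
    dH_const_mul hD ((s1 _ i).sub (s1 _ j)) hx hy, dH_sub hD (s1 _ i) (s1 _ j) hx hy,
    dH_const_mul hD (sE.dY hD i) hx hy, dH_const_mul hD (sE.dY hD j) hx hy, h.dH_dY_E hx hy,
    h.dH_dY_E hx hy, hsum, hsum]
  split_ifs <;> ring

/-- `∇_X ∇_X R(X, Y)` for the constant fields `X = ∂/∂xⁱ`, `Y = ∂/∂xʲ`. -/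
lemma covDeriv_covDeriv_curvField_apply (hn : n ≠ 1) (hij : i ≠ j)
    (hX : ∀ x ∈ D, X x = EuclideanSpace.single i 1)
    (hY : ∀ x ∈ D, Y x = EuclideanSpace.single j 1) (hx : x ∈ D) (hy : y ≠ 0)
    {c l m A C S Q : ℝ} (hE : E x y = c)
    (hEi : dY i E x y = l) (hEj : dY j E x y = m) (hPi : dY i P x y = A)
    (hPii : dY i (dY i P) x y = C) (hPji : dY j (dY i P) x y = S)
    (hEii : dY i (dY i E) x y = Q)
    (hEiii : dY i (dY i (dY i E)) x y = 0) (hEjii : dY j (dY i (dY i E)) x y = 0) (k : Fin n) :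
    covDeriv L X (covDeriv L X (curvField L X Y)) x y k = lam *
      ((if k = j then 16 * A * C * c + 12 * A ^ 2 * l - 3 * lam * Q * l else 0)
      - (if k = i then 16 * A * S * c + 12 * A ^ 2 * m - 3 * lam * Q * m else 0)
      + y k * (8 * A * (S * l - C * m))) := by
  have hD := h.isOpen
  have sE := h.smooth_E
  have sP := h.smooth_P
  have sEa := fun a => sE.dY hD a
  have sPa := fun a => sP.dY hD a
  have sPab := fun a b => (sPa a).dY hD b
  have s3 := smoothOn_const (D := D) (n := n) 3
  have s2 := smoothOn_const (D := D) (n := n) 2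
  -- the coefficients of `∂/∂yʲ`, `-∂/∂yⁱ` and `y` in `∇_X R(X, Y)`
  let α : Euc n → Euc n → ℝ := fun x y =>
    3 * (dY i P x y * dY i E x y) + 2 * (dY i (dY i P) x y * E x y)
  let β : Euc n → Euc n → ℝ := fun x y =>
    3 * (dY i P x y * dY j E x y) + 2 * (dY j (dY i P) x y * E x y)
  let γ : Euc n → Euc n → ℝ := fun x y =>
    dY j (dY i P) x y * dY i E x y - dY i (dY i P) x y * dY j E x y
  have sα : SmoothOn D α :=
    (s3.mul ((sPa i).mul (sEa i))).add (s2.mul ((sPab i i).mul sE))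
  have sβ : SmoothOn D β :=
    (s3.mul ((sPa i).mul (sEa j))).add (s2.mul ((sPab i j).mul sE))
  have sγ : SmoothOn D γ := ((sPab i j).mul (sEa i)).sub ((sPab i i).mul (sEa j))
  have ePE : ∀ a, EulerOn D 1 fun x y => dY i P x y * dY a E x y := fun a => by
    have := EulerOn.mul hD (sPa i) (sEa a) (h.euler_dY_P i) (h.euler_dY_E a)
    rwa [zero_add] at this
  have ePab : ∀ a b, EulerOn D (-1) (dY b (dY a P)) := fun a b => by
    have := (h.euler_dY_P a).dY hD (sPa a) b
    rwa [zero_sub] at this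
  have ePabE : ∀ a b, EulerOn D 1 fun x y => dY b (dY a P) x y * E x y := fun a b => by
    have := EulerOn.mul hD (sPab a b) sE (ePab a b) h.euler_E
    rwa [show (-1 : ℝ) + 2 = 1 by norm_num] at this
  have ePabEc : ∀ a b d, EulerOn D 0 fun x y => dY b (dY a P) x y * dY d E x y := fun a b d => by
    have := EulerOn.mul hD (sPab a b) (sEa d) (ePab a b) (h.euler_dY_E d)
    rwa [show (-1 : ℝ) + 1 = 0 by norm_num] at this
  have eα : EulerOn D 1 α :=
    ((ePE i).const_mul hD ((sPa i).mul (sEa i)) 3).add hD (s3.mul ((sPa i).mul (sEa i)))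
      (s2.mul ((sPab i i).mul sE)) ((ePabE i i).const_mul hD ((sPab i i).mul sE) 2)
  have eβ : EulerOn D 1 β :=
    ((ePE j).const_mul hD ((sPa i).mul (sEa j)) 3).add hD (s3.mul ((sPa i).mul (sEa j)))
      (s2.mul ((sPab i j).mul sE)) ((ePabE i j).const_mul hD ((sPab i j).mul sE) 2)
  have eγ : EulerOn D 0 γ :=
    (ePabEc i j i).sub hD ((sPab i j).mul (sEa i)) ((sPab i i).mul (sEa j)) (ePabEc i i j)
  have hc : ∀ k, ∀ x ∈ D, ∀ y ≠ 0, covDeriv L X (curvField L X Y) x y k =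
      lam * (((if k = j then 1 else 0) * α x y - (if k = i then 1 else 0) * β x y)
        + y k * γ x y) := fun k x hx y hy => by
    rw [h.covDeriv_curvField_apply hij hX hY hx hy]
    simp only [α, β, γ]
    split_ifs <;> ring
  have s1 : ∀ (c : ℝ) {f}, SmoothOn D f → SmoothOn D fun x y => c * f x y := fun c f sf =>
    (smoothOn_const c).mul sf
  have syγ : ∀ k, SmoothOn D fun x y => y k * γ x y := fun k => (smoothOn_coord k).mul sγ
  have eyγ : ∀ k, EulerOn D 1 fun x y => y k * γ x y := fun k => by
    have := EulerOn.mul hD (smoothOn_coord k) sγ (eulerOn_coord k) eγ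
    rwa [add_zero] at this
  have e1 : ∀ k, EulerOn D 1 fun x y => covDeriv L X (curvField L X Y) x y k := fun k =>
    ((((eα.const_mul hD sα _).sub hD (s1 _ sα) (s1 _ sβ) (eβ.const_mul hD sβ _)).add hD
      ((s1 _ sα).sub (s1 _ sβ)) (syγ k) (eyγ k)).const_mul hD
      (((s1 _ sα).sub (s1 _ sβ)).add (syγ k)) lam).congr (hc k)
  have hsum : ∀ u : Fin n → ℝ, ∑ m, u m * covDeriv L X (curvField L X Y) x y m =
      lam * (u j * α x y - u i * β x y + (∑ m, y m * u m) * γ x y) := fun u => by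
    rw [← sum_mul_combination hij u lam (α x y) (β x y) (γ x y) y]
    exact Finset.sum_congr rfl fun m _ => by
      rw [hc m x hx y hy]; simp
  have hα : dH P i α x y = 16 * A * C * c + 12 * A ^ 2 * l - 3 * lam * Q * l := by
    rw [dH_add hD (s3.mul ((sPa i).mul (sEa i))) (s2.mul ((sPab i i).mul sE)) hx hy,
      dH_const_mul hD ((sPa i).mul (sEa i)) hx hy, dH_const_mul hD ((sPab i i).mul sE) hx hy,
      dH_mul hD (sPa i) (sEa i) hx hy, dH_mul hD (sPab i i) sE hx hy, h.dH_E hx hy,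
      h.dH_dY_E hx hy, h.dH_dY_P hn hx hy, h.dH_dY_dY_P hn hx hy, hE, hEi, hPi, hPii, hEii, hEiii]
    ring
  have hβ : dH P i β x y =
      14 * A * S * c + 3 * A * dY j P x y * l + 9 * A ^ 2 * m + 2 * dY j P x y * C * c
        - 3 * lam * Q * m := by
    rw [dH_add hD (s3.mul ((sPa i).mul (sEa j))) (s2.mul ((sPab i j).mul sE)) hx hy,
      dH_const_mul hD ((sPa i).mul (sEa j)) hx hy, dH_const_mul hD ((sPab i j).mul sE) hx hy,
      dH_mul hD (sPa i) (sEa j) hx hy, dH_mul hD (sPab i j) sE hx hy, h.dH_E hx hy,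
      h.dH_dY_E hx hy, h.dH_dY_P hn hx hy, h.dH_dY_dY_P hn hx hy, hE, hEi, hEj, hPi, hPii,
      hPji, hEii, hEjii]
    ring
  have hγ : dH P i γ x y = 5 * A * (S * l - C * m) := by
    rw [dH_sub hD ((sPab i j).mul (sEa i)) ((sPab i i).mul (sEa j)) hx hy,
      dH_mul hD (sPab i j) (sEa i) hx hy, dH_mul hD (sPab i i) (sEa j) hx hy,
      h.dH_dY_E hx hy, h.dH_dY_E hx hy, h.dH_dY_dY_P hn hx hy, h.dH_dY_dY_P hn hx hy, hEi,
      hEj, hPi, hPii, hPji, hEiii, hEjii]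
    ring
  have hα' : α x y = 3 * A * l + 2 * C * c := by simp only [α, hPi, hEi, hPii, hE]; ring
  have hβ' : β x y = 3 * A * m + 2 * S * c := by simp only [β, hPi, hEj, hPji, hE]; ring
  have hγ' : γ x y = S * l - C * m := by simp only [γ, hPji, hEi, hPii, hEj]
  rw [h.covDeriv_const_apply hx hy (hX x hx) e1, dH_congr hD (hc k) hx hy,
    dH_const_mul hD (((s1 _ sα).sub (s1 _ sβ)).add (syγ k)) hx hy,
    dH_add hD ((s1 _ sα).sub (s1 _ sβ)) (syγ k) hx hy, dH_sub hD (s1 _ sα) (s1 _ sβ) hx hy,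
    dH_const_mul hD sα hx hy, dH_const_mul hD sβ hx hy, dH_mul hD (smoothOn_coord k) sγ hx hy,
    dH_coord, hsum, hsum, h.sum_coord_mul_dY_dY_P hx hy, h.euler_P x hx y hy, hα, hβ, hγ,
    hα', hβ', hγ', hPi, hPii, hPji]
  split_ifs <;> ring

end Fields

end ProjectiveData

end SecondDerivative

/-! ### Vector fields on a round indicatrix -/

section RoundIndicatrix

variable {n : ℕ} {N : Euc n → ℝ} {c : ℝ} {X Y : indicatrix N → Euc n} {Z W : Euc n → Euc n}
  {y v : Euc n}

lemma norm_of_mem_indicatrix (hc : 0 < c) (hN : ∀ y, N y = c * ‖y‖) (hy : y ∈ indicatrix N) :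
    ‖y‖ = c⁻¹ := by
  have : c * ‖y‖ = 1 := by rw [← hN]; exact hy
  field_simp; linarith

lemma ne_zero_of_mem_indicatrix (hN : ∀ y, N y = c * ‖y‖) (hy : y ∈ indicatrix N) : y ≠ 0 := by
  rintro rfl
  have : N 0 = 1 := hy
  rw [hN] at this
  simp at this

lemma pos_of_ne_zero (hc : 0 < c) (hN : ∀ y, N y = c * ‖y‖) (hy : y ≠ 0) : 0 < N y := by
  rw [hN]; positivity

lemma inv_smul_mem_indicatrix (hc : 0 < c) (hN : ∀ y, N y = c * ‖y‖) (hy : y ≠ 0) :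
    (N y)⁻¹ • y ∈ indicatrix N := by
  have h := pos_of_ne_zero hc hN hy
  change N _ = 1
  rw [hN, norm_smul, norm_inv, Real.norm_of_nonneg h.le, mul_left_comm, ← hN y,
    inv_mul_cancel₀ h.ne']

lemma homExt_of_ne_zero (hc : 0 < c) (hN : ∀ y, N y = c * ‖y‖) (hy : y ≠ 0) :
    homExt N X y = N y • X ⟨(N y)⁻¹ • y, inv_smul_mem_indicatrix hc hN hy⟩ := by
  rw [homExt, dif_pos]

lemma homExt_of_mem (hc : 0 < c) (hN : ∀ y, N y = c * ‖y‖) (y : indicatrix N) :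
    homExt N X y = X y := by
  rw [homExt_of_ne_zero hc hN (ne_zero_of_mem_indicatrix hN y.2)]
  have h1 : N y = 1 := y.2
  have h2 : (⟨(N y)⁻¹ • (y : Euc n), inv_smul_mem_indicatrix hc hN
    (ne_zero_of_mem_indicatrix hN y.2)⟩ : indicatrix N) = y := by
    ext1; simp [h1]
  rw [h2, h1, one_smul]

/-- The restriction to the indicatrix of a map defined on the whole tangent space. -/
def restr (N : Euc n → ℝ) (Z : Euc n → Euc n) : indicatrix N → Euc n := fun y => Z y

lemma homExt_restr (hc : 0 < c) (hN : ∀ y, N y = c * ‖y‖) (hy : y ≠ 0) :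
    homExt N (restr N Z) y = N y • Z ((N y)⁻¹ • y) :=
  homExt_of_ne_zero hc hN hy

lemma contDiffOn_norm_multiple (hN : ∀ y, N y = c * ‖y‖) : ContDiffOn ℝ ∞ N {0}ᶜ := by
  have : N = fun y => c * ‖y‖ := funext hN
  rw [this]
  exact contDiffOn_const.mul (contDiffOn_id.norm ℝ fun y hy => hy)

lemma contDiffOn_radial (hc : 0 < c) (hN : ∀ y, N y = c * ‖y‖) :
    ContDiffOn ℝ ∞ (fun y => (N y)⁻¹ • y) {0}ᶜ :=
  ((contDiffOn_norm_multiple hN).inv fun _ hy => (pos_of_ne_zero hc hN hy).ne').smul contDiffOn_id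

lemma mapsTo_radial (hc : 0 < c) (hN : ∀ y, N y = c * ‖y‖) :
    Set.MapsTo (fun y => (N y)⁻¹ • y) {0}ᶜ ({0}ᶜ : Set (Euc n)) := fun _ hy =>
  ne_zero_of_mem_indicatrix hN (inv_smul_mem_indicatrix hc hN hy)

lemma contDiffOn_homExt_restr (hc : 0 < c) (hN : ∀ y, N y = c * ‖y‖)
    (hZ : ContDiffOn ℝ ∞ Z {0}ᶜ) : ContDiffOn ℝ ∞ (homExt N (restr N Z)) {0}ᶜ := by
  have := (contDiffOn_norm_multiple hN).smul
    (hZ.comp (contDiffOn_radial hc hN) (mapsTo_radial hc hN))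
  exact this.congr fun y hy => homExt_restr hc hN hy

lemma hasFDerivAt_norm_multiple (hN : ∀ y, N y = c * ‖y‖) (hy : y ≠ 0) :
    HasFDerivAt N (c • ((‖y‖)⁻¹ • innerSL ℝ y)) y := by
  have h0 : N = fun y => c * ‖y‖ := funext hN
  rw [h0]
  have h2 : HasFDerivAt (fun y : Euc n => ‖y‖) ((‖y‖)⁻¹ • innerSL ℝ y) y := by
    have h1 := (hasStrictFDerivAt_norm_sq y).hasFDerivAt.sqrt (by positivity)
    simp only [Real.sqrt_sq (norm_nonneg _)] at h1
    refine h1.congr_fderiv ?_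
    ext v
    rw [← Nat.cast_smul_eq_nsmul ℝ 2, smul_smul]
    congr 2
    field_simp
    norm_num
  exact h2.const_mul c

lemma fderiv_norm_multiple_eq_zero (hc : 0 < c) (hN : ∀ y, N y = c * ‖y‖) (hy : y ≠ 0) :
    fderiv ℝ N y v = 0 ↔ inner ℝ y v = 0 := by
  rw [(hasFDerivAt_norm_multiple hN hy).fderiv]
  simp [hc.ne', hy]

/-- Along the indicatrix, the derivative of the homogeneous extension in tangent directions is that
of any other extension. -/
lemma fderiv_homExt_restr (hc : 0 < c) (hN : ∀ y, N y = c * ‖y‖) (hy : y ∈ indicatrix N)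
    (hv : inner ℝ y v = 0) (hZ : DifferentiableAt ℝ Z y) :
    fderiv ℝ (homExt N (restr N Z)) y v = fderiv ℝ Z y v := by
  have hy0 := ne_zero_of_mem_indicatrix hN hy
  have hNy : N y = 1 := hy
  have hNd := (hasFDerivAt_norm_multiple hN hy0).differentiableAt
  have hNv : fderiv ℝ N y v = 0 := (fderiv_norm_multiple_eq_zero hc hN hy0).2 hv
  have hr : HasFDerivAt (fun y => (N y)⁻¹ • y) (fderiv ℝ (fun y => (N y)⁻¹ • y) y) y :=
    (((contDiffOn_radial hc hN).contDiffAt (isOpen_compl_singleton.mem_nhds hy0)).differentiableAt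
      (by simp)).hasFDerivAt
  have hrv : fderiv ℝ (fun y => (N y)⁻¹ • y) y v = v := by
    have h1 := ((hasDerivAt_inv (x := N y) (by rw [hNy]; exact one_ne_zero)).comp_hasFDerivAt y
      hNd.hasFDerivAt).smul (hasFDerivAt_id y)
    have h2 := h1.fderiv
    simp only [Pi.smul_def', Function.comp_def, id] at h2
    rw [h2]
    simp [hNy, hNv]
  have h1 : homExt N (restr N Z) =ᶠ[𝓝 y] fun y => N y • Z ((N y)⁻¹ • y) := by
    filter_upwards [isOpen_compl_singleton.mem_nhds hy0] with z hz using homExt_restr hc hN hz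
  have hZ' : HasFDerivAt Z (fderiv ℝ Z y) ((N y)⁻¹ • y) := by
    simpa [hNy] using hZ.hasFDerivAt
  have h2 := hNd.hasFDerivAt.smul (hZ'.comp (f := fun y => (N y)⁻¹ • y) y hr)
  rw [h1.fderiv_eq]
  have h3 := h2.fderiv
  simp only [Pi.smul_def', Function.comp_def] at h3
  rw [h3]
  simp [hNy, hNv, hrv]

/-- The bracket on the indicatrix can be computed with arbitrary extensions. -/
lemma indicatrixBracket_restr (hc : 0 < c) (hN : ∀ y, N y = c * ‖y‖)
    (hZ : Differentiable ℝ Z) (hW : Differentiable ℝ W)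
    (tZ : ∀ y ∈ indicatrix N, inner ℝ y (Z y) = 0)
    (tW : ∀ y ∈ indicatrix N, inner ℝ y (W y) = 0) :
    indicatrixBracket N (restr N Z) (restr N W) = restr N (VectorField.lieBracket ℝ Z W) := by
  funext y
  rw [indicatrixBracket, VectorField.lieBracket, homExt_of_mem hc hN, homExt_of_mem hc hN]
  change fderiv ℝ (homExt N (restr N W)) y (Z y) - fderiv ℝ (homExt N (restr N Z)) y (W y) =
    fderiv ℝ W y (Z y) - fderiv ℝ Z y (W y)
  rw [fderiv_homExt_restr hc hN y.2 (tZ y y.2) (hW y),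
    fderiv_homExt_restr hc hN y.2 (tW y y.2) (hZ y)]

lemma homExt_zero : homExt N 0 = 0 := by
  funext y; simp [homExt]

lemma homExt_add : homExt N (X + Y) = homExt N X + homExt N Y := by
  funext y
  by_cases h : (N y)⁻¹ • y ∈ indicatrix N <;> simp [homExt, h]

lemma homExt_smul (t : ℝ) : homExt N (t • X) = t • homExt N X := by
  funext y
  by_cases h : (N y)⁻¹ • y ∈ indicatrix N <;> simp [homExt, h, smul_comm t]

lemma IsIndicatrixField.inner_homExt (hc : 0 < c) (hN : ∀ y, N y = c * ‖y‖)
    (hX : IsIndicatrixField N X) (hy : y ≠ 0) : inner ℝ y (homExt N X y) = 0 := by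
  have h1 := inv_smul_mem_indicatrix hc hN hy
  have h2 := hX.tangent ⟨_, h1⟩
  rw [fderiv_norm_multiple_eq_zero hc hN (ne_zero_of_mem_indicatrix hN h1), inner_smul_left] at h2
  rw [homExt_of_ne_zero hc hN hy, inner_smul_right]
  have h3 := pos_of_ne_zero hc hN hy
  have h4 : inner ℝ y (X ⟨(N y)⁻¹ • y, h1⟩) = 0 := by simpa [h3.ne'] using h2
  rw [h4, mul_zero]

lemma isIndicatrixField_restr (hc : 0 < c) (hN : ∀ y, N y = c * ‖y‖)
    (hZ : ContDiffOn ℝ ∞ Z {0}ᶜ) (tZ : ∀ y ∈ indicatrix N, inner ℝ y (Z y) = 0) :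
    IsIndicatrixField N (restr N Z) :=
  ⟨contDiffOn_homExt_restr hc hN hZ, fun y =>
    (fderiv_norm_multiple_eq_zero hc hN (ne_zero_of_mem_indicatrix hN y.2)).2 (tZ y y.2)⟩

lemma IsIndicatrixField.bracket (hc : 0 < c) (hN : ∀ y, N y = c * ‖y‖)
    (hX : IsIndicatrixField N X) (hY : IsIndicatrixField N Y) :
    IsIndicatrixField N (indicatrixBracket N X Y) := by
  have ho : IsOpen ({0}ᶜ : Set (Euc n)) := isOpen_compl_singleton
  have key : ∀ {X : indicatrix N → Euc n}, IsIndicatrixField N X → ∀ {y : Euc n}, y ≠ 0 → ∀ v,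
      inner ℝ v (homExt N X y) + inner ℝ y (fderiv ℝ (homExt N X) y v) = 0 := by
    intro X hX y hy v
    have hd := ((hX.smooth.contDiffAt (ho.mem_nhds hy)).differentiableAt (by simp)).hasFDerivAt
    have h1 := ((hasFDerivAt_id y).inner ℝ hd).fderiv
    have h2 : (fun y => inner ℝ (id y) (homExt N X y)) =ᶠ[𝓝 y] fun _ => (0 : ℝ) := by
      filter_upwards [ho.mem_nhds hy] with z hz using hX.inner_homExt hc hN hz
    rw [h2.fderiv_eq] at h1
    have h3 := congrArg (fun A => A v) h1
    simp at h3
    linarith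
  refine isIndicatrixField_restr hc hN (Z := VectorField.lieBracket ℝ (homExt N X) (homExt N Y))
    ?_ fun y hy => ?_
  · have h1 := (hX.smooth.fderiv_of_isOpen ho (m := ∞) (by simp)).clm_apply hY.smooth
    have h2 := (hY.smooth.fderiv_of_isOpen ho (m := ∞) (by simp)).clm_apply hX.smooth
    exact h2.sub h1
  · have hy0 := ne_zero_of_mem_indicatrix hN hy
    have h1 := key hX hy0 (homExt N Y y)
    have h2 := key hY hy0 (homExt N X y)
    rw [VectorField.lieBracket, inner_sub_right]
    rw [real_inner_comm] at h1
    linarith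

/-- A Lie algebra generated by smooth tangent fields consists of smooth tangent fields. -/
lemma LieGenerated.isIndicatrixField {S : Set (indicatrix N → Euc n)} (hc : 0 < c)
    (hN : ∀ y, N y = c * ‖y‖) (hS : ∀ X ∈ S, IsIndicatrixField N X)
    (hX : LieGenerated N S X) : IsIndicatrixField N X := by
  induction hX with
  | mem X h => exact hS X h
  | zero => exact ⟨by rw [homExt_zero]; exact contDiffOn_const, fun y => by simp⟩
  | add X Y _ _ h1 h2 =>
    exact ⟨by rw [homExt_add]; exact h1.smooth.add h2.smooth, fun y => by
      rw [Pi.add_apply, map_add, h1.tangent, h2.tangent, add_zero]⟩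
  | smul a X _ h =>
    exact ⟨by rw [homExt_smul]; exact contDiffOn_const.smul h.smooth, fun y => by
      rw [Pi.smul_apply, map_smul, h.tangent, smul_zero]⟩
  | bracket X Y _ _ h1 h2 => exact h1.bracket hc hN h2

end RoundIndicatrix

/-! ### Generation of the polynomial vector fields -/

section Generation

variable {n : ℕ} {N : Euc n → ℝ} {a : ℝ} {y v : Euc n}

/-- On the sphere `a ‖y‖² = 1`, the tangential part of the constant vector field `∂/∂yʲ`. -/
noncomputable def sphField (a : ℝ) (j : Fin n) (y : Euc n) : Euc n :=
  EuclideanSpace.single j 1 - (a * y j) • y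

/-- The infinitesimal rotation in the `(i, j)`-plane. -/
noncomputable def rotField (i j : Fin n) (y : Euc n) : Euc n :=
  y i • EuclideanSpace.single j 1 - y j • EuclideanSpace.single i 1

lemma rotField_eq (a : ℝ) (i j : Fin n) (y : Euc n) :
    rotField i j y = y i • sphField a j y - y j • sphField a i y := by
  rw [rotField, sphField, sphField]
  module

lemma hasFDerivAt_coord (j : Fin n) (y : Euc n) :
    HasFDerivAt (fun y : Euc n => y j) (EuclideanSpace.proj (𝕜 := ℝ) j) y :=
  (EuclideanSpace.proj (𝕜 := ℝ) j).hasFDerivAt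

lemma contDiff_sphField (a : ℝ) (j : Fin n) : ContDiff ℝ ∞ (sphField (n := n) a j) := by
  unfold sphField; fun_prop

lemma contDiff_rotField (i j : Fin n) : ContDiff ℝ ∞ (rotField i j) := by
  unfold rotField; fun_prop

lemma fderiv_sphField (a : ℝ) (j : Fin n) (y v : Euc n) :
    fderiv ℝ (sphField a j) y v = -((a * v j) • y + (a * y j) • v) := by
  have h1 := (((hasFDerivAt_coord j y).const_mul a).smul (hasFDerivAt_id y)).const_sub
    (EuclideanSpace.single j (1 : ℝ))
  have h2 : HasFDerivAt (sphField a j) _ y := h1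
  rw [h2.fderiv]
  simp; module

lemma fderiv_rotField (i j : Fin n) (y v : Euc n) :
    fderiv ℝ (rotField i j) y v = rotField i j v := by
  have h1 := ((hasFDerivAt_coord i y).smul_const (EuclideanSpace.single j (1 : ℝ))).sub
    ((hasFDerivAt_coord j y).smul_const (EuclideanSpace.single i (1 : ℝ)))
  have h2 : HasFDerivAt (rotField i j) _ y := h1
  rw [h2.fderiv]
  simp [rotField]

lemma fderiv_smul_apply {f : Euc n → ℝ} {Z : Euc n → Euc n} (hf : Differentiable ℝ f)
    (hZ : Differentiable ℝ Z) (y v : Euc n) :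
    fderiv ℝ (fun y => f y • Z y) y v = f y • fderiv ℝ Z y v + fderiv ℝ f y v • Z y := by
  rw [fderiv_fun_smul (hf y) (hZ y)]; simp

lemma lieBracket_smul_apply {f : Euc n → ℝ} {W Z : Euc n → Euc n} (hf : Differentiable ℝ f)
    (hZ : Differentiable ℝ Z) (y : Euc n) :
    VectorField.lieBracket ℝ W (fun y => f y • Z y) y =
      f y • VectorField.lieBracket ℝ W Z y + fderiv ℝ f y (W y) • Z y := by
  simp only [VectorField.lieBracket]
  rw [fderiv_smul_apply hf hZ, map_smul]
  module

lemma lieBracket_sphField_sphField (a : ℝ) (i j : Fin n) (y : Euc n) :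
    VectorField.lieBracket ℝ (sphField a i) (sphField a j) y = a • rotField i j y := by
  simp only [VectorField.lieBracket, fderiv_sphField]
  by_cases hij : i = j
  · subst hij; simp [sphField, rotField]
  · simp only [sphField, rotField, PiLp.sub_apply, PiLp.smul_apply, PiLp.single_apply,
      smul_eq_mul, if_neg hij, if_neg (Ne.symm hij)]
    module

lemma lieBracket_sphField_rotField (a : ℝ) {i j : Fin n} (hij : i ≠ j) (y : Euc n) :
    VectorField.lieBracket ℝ (sphField a i) (rotField i j) y = sphField a j y := by
  simp only [VectorField.lieBracket, fderiv_sphField, fderiv_rotField]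
  simp only [sphField, rotField, PiLp.sub_apply, PiLp.smul_apply, PiLp.single_apply,
    smul_eq_mul, if_neg hij, if_neg (Ne.symm hij), if_true]
  module

lemma lieBracket_rotField_sphField (a : ℝ) {i j : Fin n} (hij : i ≠ j) (y : Euc n) :
    VectorField.lieBracket ℝ (rotField i j) (sphField a j) y = sphField a i y := by
  simp only [VectorField.lieBracket, fderiv_sphField, fderiv_rotField]
  simp only [sphField, rotField, PiLp.sub_apply, PiLp.smul_apply, PiLp.single_apply,
    smul_eq_mul, if_neg hij, if_neg (Ne.symm hij), if_true]
  module

lemma fderiv_coord (i : Fin n) (y v : Euc n) : fderiv ℝ (fun y : Euc n => y i) y v = v i := by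
  rw [(hasFDerivAt_coord i y).fderiv]; rfl

lemma differentiable_coord (i : Fin n) : Differentiable ℝ fun y : Euc n => y i := fun y =>
  (hasFDerivAt_coord i y).differentiableAt

/-! ### Monomials and polynomial fields -/

/-- The monomial `y^{l₁} y^{l₂} ⋯` with the list `l` of indices. -/
def mon (l : List (Fin n)) (y : Euc n) : ℝ := (l.map fun i => y i).prod

lemma mon_nil : mon ([] : List (Fin n)) = fun _ => 1 := by
  funext y; simp [mon]

lemma mon_cons (i : Fin n) (l : List (Fin n)) : mon (i :: l) = fun y => y i * mon l y := by
  funext y; simp [mon]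

lemma mon_append (l l' : List (Fin n)) : mon (l ++ l') = fun y => mon l y * mon l' y := by
  funext y; simp [mon]

lemma contDiff_mon (l : List (Fin n)) : ContDiff ℝ ∞ (mon l) := by
  induction l with
  | nil => rw [mon_nil]; exact contDiff_const
  | cons i l ih => rw [mon_cons]; exact ContDiff.mul (by fun_prop) ih

lemma differentiable_mon (l : List (Fin n)) : Differentiable ℝ (mon l) :=
  (contDiff_mon l).differentiable (by simp)

lemma fderiv_mon_cons (i : Fin n) (l : List (Fin n)) (y v : Euc n) :
    fderiv ℝ (mon (i :: l)) y v = v i * mon l y + y i * fderiv ℝ (mon l) y v := by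
  rw [mon_cons, fderiv_fun_mul (differentiable_coord i y) (differentiable_mon l y)]
  simp [fderiv_coord]; ring

lemma fderiv_mon_self (l : List (Fin n)) (y : Euc n) :
    fderiv ℝ (mon l) y y = l.length * mon l y := by
  induction l with
  | nil => rw [mon_nil]; simp
  | cons i l ih => rw [fderiv_mon_cons, ih, mon_cons]; push_cast [List.length_cons]; ring

/-- A partial derivative of a monomial is a combination of monomials of one degree less. -/
lemma fderiv_mon_single_mem (j : Fin n) (l : List (Fin n)) (Q : Submodule ℝ (Euc n → ℝ))
    (hQ : ∀ l' : List (Fin n), l'.length + 1 = l.length → mon l' ∈ Q) :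
    (fun y => fderiv ℝ (mon l) y (EuclideanSpace.single j 1)) ∈ Q := by
  induction l generalizing Q with
  | nil =>
    convert Q.zero_mem using 1
    rw [mon_nil]
    funext y; simp
  | cons i l ih =>
    let T : (Euc n → ℝ) →ₗ[ℝ] (Euc n → ℝ) := LinearMap.mulLeft ℝ fun y => y i
    have h1 := ih (Q.comap T) fun l' hl' => by
      have := hQ (i :: l') (by simp [hl'])
      rw [mon_cons] at this
      exact this
    have h2 : (fun y => fderiv ℝ (mon (i :: l)) y (EuclideanSpace.single j 1)) =
        (EuclideanSpace.single j (1 : ℝ) : Euc n) i • mon l +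
          T fun y => fderiv ℝ (mon l) y (EuclideanSpace.single j 1) := by
      funext y
      rw [fderiv_mon_cons]; rfl
    rw [h2]
    exact Q.add_mem (Q.smul_mem _ (hQ l (by simp))) h1

/-- The field `f V_j` on the indicatrix, where `V_j` is the tangential part of `∂/∂yʲ`. -/
noncomputable def polyField (N : Euc n → ℝ) (a : ℝ) (j : Fin n) :
    (Euc n → ℝ) →ₗ[ℝ] (indicatrix N → Euc n) where
  toFun f := restr N fun y => f y • sphField a j y
  map_add' f g := by funext y; simp [restr, add_smul]
  map_smul' t f := by funext y; simp [restr, mul_smul]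

/-- The linear subspace `A` of vector fields contains the restrictions of brackets of smooth maps
whose restrictions are tangent and belong to `A`. -/
def ClosedUnderBracket (A : Submodule ℝ (indicatrix N → Euc n)) : Prop :=
  ∀ Z W : Euc n → Euc n, ContDiff ℝ ∞ Z → ContDiff ℝ ∞ W →
    (∀ y ∈ indicatrix N, inner ℝ y (Z y) = 0) → (∀ y ∈ indicatrix N, inner ℝ y (W y) = 0) →
    restr N Z ∈ A → restr N W ∈ A → restr N (VectorField.lieBracket ℝ Z W) ∈ A

lemma inner_sphField (hy : a * ‖y‖ ^ 2 = 1) (j : Fin n) : inner ℝ y (sphField a j y) = 0 := by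
  rw [sphField, inner_sub_right, inner_smul_right, real_inner_self_eq_norm_sq, mul_right_comm, hy,
    EuclideanSpace.inner_single_right]
  simp

lemma inner_rotField (i j : Fin n) : inner ℝ y (rotField i j y) = 0 := by
  rw [rotField, inner_sub_right, inner_smul_right, inner_smul_right,
    EuclideanSpace.inner_single_right, EuclideanSpace.inner_single_right]
  simp; ring

lemma sum_smul_sphField (hy : a * ‖y‖ ^ 2 = 1) : ∑ i, y i • sphField a i y = 0 := by
  have h1 : ∑ i, y i • EuclideanSpace.single i (1 : ℝ) = y := by
    ext i; simp [Pi.single_apply]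
  have h2 : ∑ i, y i * (a * y i) = 1 := by
    rw [EuclideanSpace.real_norm_sq_eq, Finset.mul_sum] at hy
    rw [← hy]
    exact Finset.sum_congr rfl fun i _ => by ring
  simp only [sphField, smul_sub, smul_smul]
  rw [Finset.sum_sub_distrib, ← Finset.sum_smul, h1, h2, one_smul, sub_self]

section

variable {A : Submodule ℝ (indicatrix N → Euc n)} (hA : ClosedUnderBracket A) (ha0 : a ≠ 0)
  (ha : ∀ y ∈ indicatrix N, a * ‖y‖ ^ 2 = 1)
include hA ha0 ha

/-- The bracket of `V_z` with `f V_j`, for a monomial `f`. -/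
lemma bracket_monomial_mem {z : Fin n} (hz : polyField N a z (mon []) ∈ A) (l : List (Fin n))
    (j : Fin n) (hf : polyField N a j (mon l) ∈ A)
    (hd : ∀ l' : List (Fin n), l'.length + 1 = l.length → polyField N a j (mon l') ∈ A) :
    ((l.length : ℝ) - 1) • polyField N a j (mon (z :: l)) + polyField N a z (mon (j :: l)) ∈ A := by
  have sV := fun j => contDiff_sphField (n := n) a j
  have h1 := hA (sphField a z) (fun y => mon l y • sphField a j y) (sV z)
    ((contDiff_mon l).smul (sV j)) (fun y hy => inner_sphField (ha y hy) z)
    (fun y hy => by rw [inner_smul_right, inner_sphField (ha y hy), mul_zero])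
    (by simpa [polyField, mon_nil] using hz) hf
  have h2 := fderiv_mon_single_mem z l (A.comap (polyField N a j)) hd
  have h3 : a • (((l.length : ℝ) - 1) • polyField N a j (mon (z :: l))
      + polyField N a z (mon (j :: l))) =
      polyField N a j (fun y => fderiv ℝ (mon l) y (EuclideanSpace.single z 1))
      - restr N (VectorField.lieBracket ℝ (sphField a z) fun y => mon l y • sphField a j y) := by
    funext y
    simp only [polyField, LinearMap.coe_mk, AddHom.coe_mk, restr, Pi.sub_apply, Pi.smul_apply,
      Pi.add_apply, mon_cons]
    rw [lieBracket_smul_apply (differentiable_mon l) ((sV j).differentiable (by simp)),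
      lieBracket_sphField_sphField]
    conv_rhs => rw [sphField.eq_1 a z, map_sub, map_smul, fderiv_mon_self, rotField_eq a]
    simp only [smul_eq_mul]
    module
  have h4 := A.smul_mem a⁻¹ (A.sub_mem h2 h1)
  rwa [← h3, smul_smul, inv_mul_cancel₀ ha0, one_smul] at h4

/-- If the fields `V_j` and `yⁱ V_j` belong to `A`, all polynomial fields do.  For monomials `f'` of
degree `k`, the preceding relation exchanges `V_γ` with the first factor of `y^α y^β f' V_γ`, at the
cost of a factor `-k`; three exchanges transpose `α` and `β`, so that `1 + k³` annihilates
`y^α y^β f' V_γ` modulo `A`. -/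
lemma polyField_mon_mem (h0 : ∀ j, polyField N a j (mon []) ∈ A)
    (h1 : ∀ i j, polyField N a j (mon [i]) ∈ A) (l : List (Fin n)) (j : Fin n) :
    polyField N a j (mon l) ∈ A := by
  suffices h : ∀ k : ℕ, (∀ l : List (Fin n), l.length = k → ∀ j, polyField N a j (mon l) ∈ A) ∧
      ∀ l : List (Fin n), l.length = k + 1 → ∀ j, polyField N a j (mon l) ∈ A from
    (h l.length).1 l rfl j
  intro k
  induction k with
  | zero =>
    refine ⟨fun l hl j => ?_, fun l hl j => ?_⟩
    · rw [List.length_eq_zero_iff.1 hl]; exact h0 j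
    · obtain ⟨i, rfl⟩ := List.length_eq_one_iff.1 hl; exact h1 i j
  | succ k ih =>
    refine ⟨ih.2, fun l hl j => ?_⟩
    obtain ⟨α, l, rfl⟩ : ∃ α l', l = α :: l' := List.exists_cons_of_length_eq_add_one hl
    obtain ⟨β, l, rfl⟩ : ∃ β l', l = β :: l' :=
      List.exists_cons_of_length_eq_add_one (n := k) (by simpa using hl)
    have hlk : l.length = k := by simpa using hl
    let u : Fin n → Fin n → Fin n → (indicatrix N → Euc n) := fun α β γ =>
      polyField N a γ (mon (α :: β :: l))
    have hu : ∀ α β γ, u α β γ = u β α γ := by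
      intro α β γ
      simp only [u, mon_cons]
      congr 1; funext y; ring
    have hr : ∀ α β γ, (k : ℝ) • u α β γ + u γ β α ∈ A := by
      intro α β γ
      have := bracket_monomial_mem hA ha0 ha (h0 α) (β :: l) γ (ih.2 _ (by simp [hlk]) γ)
        fun l' hl' => ih.1 l' (by simpa [hlk] using hl') γ
      simpa [hlk] using this
    -- `u α β j = -k u j β α`, `u β j α = -k u α j β`, `u j α β = -k u β α j` modulo `A`
    have h7 : (1 + (k : ℝ) ^ 3) • u α β j ∈ A := by
      have f1 := hr j β α
      have f2 := hr α j β
      have f3 := hr β α j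
      have : (1 + (k : ℝ) ^ 3) • u α β j = ((k : ℝ) • u j β α + u α β j)
          - (k : ℝ) • ((k : ℝ) • u α j β + u β j α)
          + (k : ℝ) ^ 2 • ((k : ℝ) • u β α j + u j α β) := by
        rw [hu β j α, hu j α β, hu β α j]
        module
      rw [this]
      exact A.add_mem (A.sub_mem f1 (A.smul_mem _ f2)) (A.smul_mem _ f3)
    have h8 := A.smul_mem (1 + (k : ℝ) ^ 3)⁻¹ h7
    rwa [smul_smul, inv_mul_cancel₀ (by positivity), one_smul] at h8

/-- The curvature field, its first and its second covariant derivatives generate all polynomial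
vector fields. -/
lemma polyField_mon_mem_of_generators {c₂ lam : ℝ} (hc₂ : c₂ ≠ 0)
    (g0 : ∀ i j, i ≠ j → restr N (rotField i j) ∈ A)
    (g1 : ∀ i j, i ≠ j →
      restr N (fun y => (2 * y i) • rotField i j y + a⁻¹ • sphField a j y) ∈ A)
    (g2 : ∀ i j, i ≠ j → restr N (fun y => (4 * c₂ ^ 2 * a * y i ^ 2 - 3 * lam * a) • rotField i j y
      + (8 * c₂ ^ 2 * y i) • sphField a j y) ∈ A)
    (l : List (Fin n)) (j : Fin n) : polyField N a j (mon l) ∈ A := by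
  have sV := fun j => contDiff_sphField (n := n) a j
  have sR := fun i j => contDiff_rotField (n := n) i j
  have sc : ∀ i : Fin n, ContDiff ℝ ∞ fun y : Euc n => y i := fun i => by fun_prop
  have dV := fun j => (sV j).differentiable (by simp)
  have dR := fun i j => (sR i j).differentiable (by simp)
  have tV := fun j => fun y hy => inner_sphField (ha y hy) j
  -- the trace of the first derivatives
  have hV : ∀ j, restr N (sphField a j) ∈ A := by
    intro j
    have h1 := A.sum_mem fun i (hi : i ∈ Finset.univ.erase j) => g1 i j (Finset.ne_of_mem_erase hi)
    have h2 : ∑ i ∈ Finset.univ.erase j,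
        restr N (fun y => (2 * y i) • rotField i j y + a⁻¹ • sphField a j y) =
        ((n + 1 : ℝ) * a⁻¹) • restr N (sphField a j) := by
      funext y
      have h3 := sum_smul_sphField (ha y y.2)
      have h4 : ∑ i, y.1 i * y.1 i = a⁻¹ := by
        have := ha y y.2
        rw [EuclideanSpace.real_norm_sq_eq] at this
        rw [← eq_inv_of_mul_eq_one_right this]
        exact Finset.sum_congr rfl fun i _ => (sq _).symm
      rw [Finset.sum_apply]
      simp only [restr, Pi.smul_apply]
      rw [← add_right_cancel_iff (a := a⁻¹ • sphField a j y.1)]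
      have h5 : ∑ i ∈ Finset.univ.erase j,
          ((2 * y.1 i) • rotField i j y.1 + a⁻¹ • sphField a j y.1) + a⁻¹ • sphField a j y.1 =
          ∑ i, ((2 * y.1 i) • rotField i j y.1 + a⁻¹ • sphField a j y.1) := by
        rw [← Finset.sum_erase_add _ _ (Finset.mem_univ j)]
        congr 1
        simp [rotField]
      rw [h5]
      have h6 : ∀ i, (2 * y.1 i) • rotField i j y.1 + a⁻¹ • sphField a j y.1 =
          (2 * (y.1 i * y.1 i) + a⁻¹) • sphField a j y.1
            - (2 * y.1 j) • (y.1 i • sphField a i y.1) := fun i => by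
        rw [rotField_eq a]; module
      simp_rw [h6]
      rw [Finset.sum_sub_distrib, ← Finset.smul_sum, h3, ← Finset.sum_smul,
        Finset.sum_add_distrib, ← Finset.mul_sum, h4]
      simp only [Finset.sum_const, Finset.card_univ, Fintype.card_fin, nsmul_eq_mul]
      module
    rw [h2] at h1
    have h3 := A.smul_mem ((n + 1 : ℝ) * a⁻¹)⁻¹ h1
    rwa [smul_smul, inv_mul_cancel₀ (mul_ne_zero (by positivity) (inv_ne_zero ha0)), one_smul] at h3
  have hlR : ∀ i j, i ≠ j → restr N (fun y => y i • rotField i j y) ∈ A := by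
    intro i j hij
    have h1 := A.smul_mem (2⁻¹ : ℝ) (A.sub_mem (g1 i j hij) (A.smul_mem a⁻¹ (hV j)))
    convert h1 using 1
    funext y
    simp only [restr, Pi.smul_apply, Pi.sub_apply]
    module
  have hlV : ∀ i j, i ≠ j → restr N (fun y => y i • sphField a j y) ∈ A := by
    intro i j hij
    have h1 := hA (sphField a i) (fun y => y i • rotField i j y) (sV i)
      (ContDiff.smul (sc i) (sR i j)) (tV i)
      (fun y _ => by rw [inner_smul_right, inner_rotField, mul_zero]) (hV i) (hlR i j hij)
    have h2 := A.add_mem (g2 i j hij) (A.smul_mem (4 * c₂ ^ 2) h1)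
    have h3 := A.smul_mem (12 * c₂ ^ 2)⁻¹
      (A.sub_mem h2 (A.smul_mem (4 * c₂ ^ 2 - 3 * lam * a) (g0 i j hij)))
    convert h3 using 1
    funext y
    simp only [restr, Pi.smul_apply, Pi.sub_apply, Pi.add_apply]
    rw [lieBracket_smul_apply (differentiable_coord i) (dR i j), fderiv_coord,
      lieBracket_sphField_rotField a hij]
    have h4 : sphField a i y.1 i = 1 - a * y.1 i * y.1 i := by simp [sphField]
    rw [h4, eq_inv_smul_iff₀ (by positivity)]
    module
  have hd : ∀ i j, restr N (fun y => y i • sphField a i y - y j • sphField a j y) ∈ A := by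
    intro i j
    by_cases hij : i = j
    · subst hij
      convert A.zero_mem using 1
      funext y; simp [restr]
    have h1 := hA (rotField i j) (fun y => y i • sphField a j y) (sR i j)
      (ContDiff.smul (sc i) (sV j)) (fun y _ => inner_rotField i j)
      (fun y hy => by rw [inner_smul_right, tV j y hy, mul_zero]) (g0 i j hij) (hlV i j hij)
    convert h1 using 1
    funext y
    simp only [restr]
    rw [lieBracket_smul_apply (differentiable_coord i) (dV j), fderiv_coord,
      lieBracket_rotField_sphField a hij]
    have h4 : rotField i j y.1 i = - y.1 j := by simp [rotField, hij]
    rw [h4]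
    module
  refine polyField_mon_mem hA ha0 ha (fun j => ?_) (fun i j => ?_) l j
  · convert hV j using 1
    simp [polyField, mon_nil]
  · have h0 : polyField N a j (mon [i]) = restr N (fun y => y i • sphField a j y) := by
      simp [polyField, mon_cons, mon_nil]
    rw [h0]
    by_cases hij : i = j
    · subst hij
      have h1 := A.sum_mem fun j (_ : j ∈ Finset.univ) => hd i j
      have h2 : ∑ j, restr N (fun y => y i • sphField a i y - y j • sphField a j y) =
          (n : ℝ) • restr N (fun y => y i • sphField a i y) := by
        funext y
        rw [Finset.sum_apply]
        simp only [restr, Pi.smul_apply]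
        rw [Finset.sum_sub_distrib, sum_smul_sphField (ha y y.2)]
        simp [Nat.cast_smul_eq_nsmul]
      rw [h2] at h1
      have h3 := A.smul_mem (n : ℝ)⁻¹ h1
      have hn : (n : ℝ) ≠ 0 := by exact_mod_cast (Fin.pos i).ne'
      rwa [smul_smul, inv_mul_cancel₀ hn, one_smul] at h3
    · exact hlV i j hij

end

end Generation

/-! ### The curvature and its derivatives at a point of spherical symmetry -/

section AtPoint

variable {n : ℕ} {D : Set (Euc n)} {f g L E P : Euc n → Euc n → ℝ} {x y : Euc n} {lam : ℝ}

lemma dY_congr_fibre (h : ∀ y ≠ 0, f x y = g x y) (hy : y ≠ 0) (i : Fin n) :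
    dY i f x y = dY i g x y := by
  unfold dY
  congr 1
  apply Filter.EventuallyEq.fderiv_eq
  filter_upwards [isOpen_compl_singleton.mem_nhds hy] with y' hy' using h y' hy'

lemma smoothOn_norm : SmoothOn D fun _ y => ‖y‖ :=
  contDiffOn_snd.norm ℝ fun _ hp => hp.2

lemma dY_norm (hy : y ≠ 0) (i : Fin n) : dY i (fun _ y => ‖y‖) x y = y i * ‖y‖⁻¹ := by
  unfold dY
  have h := (hasFDerivAt_norm_multiple (N := fun y : Euc n => ‖y‖) (c := 1) (by simp) hy).fderiv
  rw [h]
  simp [EuclideanSpace.inner_single_right, mul_comm]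

lemma dY_coord_mul_inv_norm (hy : y ≠ 0) (i j : Fin n) :
    dY j (fun _ y => y i * ‖y‖⁻¹) x y =
      (if i = j then ‖y‖⁻¹ else 0) - y i * y j * ‖y‖⁻¹ ^ 3 := by
  have hn : ∀ y : Euc n, y ≠ 0 → ‖y‖ ≠ 0 := fun y hy => norm_ne_zero_iff.2 hy
  have s1 : SmoothOn (Set.univ : Set (Euc n)) fun _ y => ‖y‖ := smoothOn_norm
  have s2 : SmoothOn (Set.univ : Set (Euc n)) fun _ y => ‖y‖⁻¹ := s1.inv fun _ _ y hy => hn y hy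
  -- differentiate `‖y‖ · ‖y‖⁻¹ = 1`
  have h1 : dY j (fun _ y => ‖y‖ * ‖y‖⁻¹) x y = dY j (fun _ _ => 1) x y :=
    dY_congr_fibre (fun y hy => mul_inv_cancel₀ (hn y hy)) hy j
  rw [dY_mul isOpen_univ s1 s2 (Set.mem_univ x) hy, dY_const, dY_norm hy] at h1
  rw [dY_mul isOpen_univ (smoothOn_coord i) s2 (Set.mem_univ x) hy, dY_coord]
  have h2 : dY j (fun _ y => ‖y‖⁻¹) x y = - (y j * ‖y‖⁻¹ ^ 3) := by
    have := hn y hy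
    have h3 : ‖y‖ * (dY j (fun _ y => ‖y‖⁻¹) x y) = ‖y‖ * (- (y j * ‖y‖⁻¹ ^ 3)) := by
      rw [eq_neg_of_add_eq_zero_right h1]
      field_simp
    exact mul_left_cancel₀ this h3
  rw [h2]
  by_cases hij : i = j
  · simp [hij]; ring
  · simp [hij, Ne.symm hij]; ring

variable {a c₂ : ℝ}

lemma dY_half_norm_sq (hE : ∀ y ≠ 0, E x y = a / 2 * ‖y‖ ^ 2) (hy : y ≠ 0) (i : Fin n) :
    dY i E x y = a * y i := by
  have s1 : SmoothOn (Set.univ : Set (Euc n)) fun _ y => ‖y‖ := smoothOn_norm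
  have h1 : ∀ y ≠ 0, E x y = (fun _ y => a / 2 * (‖y‖ * ‖y‖)) x y := fun y hy => by
    rw [hE y hy]; ring
  rw [dY_congr_fibre (g := fun _ y => a / 2 * (‖y‖ * ‖y‖)) h1 hy,
    dY_const_mul isOpen_univ (s1.mul s1) (Set.mem_univ x) hy,
    dY_mul isOpen_univ s1 s1 (Set.mem_univ x) hy, dY_norm hy]
  have : ‖y‖ ≠ 0 := norm_ne_zero_iff.2 hy
  field_simp
  ring

lemma dY_dY_half_norm_sq (hE : ∀ y ≠ 0, E x y = a / 2 * ‖y‖ ^ 2) (hy : y ≠ 0) (i j : Fin n) :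
    dY j (dY i E) x y = if i = j then a else 0 := by
  have h1 : ∀ y ≠ 0, dY i E x y = (fun _ y => a * y i) x y := fun y hy => dY_half_norm_sq hE hy i
  rw [dY_congr_fibre (g := fun _ y => a * y i) h1 hy,
    dY_const_mul isOpen_univ (smoothOn_coord i) (Set.mem_univ x) hy,
    dY_coord]
  simp [eq_comm]

lemma dY_dY_dY_half_norm_sq (hE : ∀ y ≠ 0, E x y = a / 2 * ‖y‖ ^ 2) (hy : y ≠ 0)
    (i j k : Fin n) : dY k (dY j (dY i E)) x y = 0 := by
  have h1 : ∀ y ≠ 0, dY j (dY i E) x y = (fun _ _ => if i = j then a else 0) x y :=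
    fun y hy => dY_dY_half_norm_sq hE hy i j
  rw [dY_congr_fibre (g := fun _ _ => if i = j then a else 0) h1 hy, dY_const]

lemma dY_norm_multiple (hP : ∀ y ≠ 0, P x y = c₂ * ‖y‖) (hy : y ≠ 0) (i : Fin n) :
    dY i P x y = c₂ * (y i * ‖y‖⁻¹) := by
  have h1 : ∀ y ≠ 0, P x y = (fun _ y => c₂ * ‖y‖) x y := hP
  rw [dY_congr_fibre (g := fun _ y => c₂ * ‖y‖) h1 hy,
    dY_const_mul isOpen_univ smoothOn_norm (Set.mem_univ x) hy, dY_norm hy]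

lemma dY_dY_norm_multiple (hP : ∀ y ≠ 0, P x y = c₂ * ‖y‖) (hy : y ≠ 0) (i j : Fin n) :
    dY j (dY i P) x y = c₂ * ((if i = j then ‖y‖⁻¹ else 0) - y i * y j * ‖y‖⁻¹ ^ 3) := by
  have h1 : ∀ y ≠ 0, dY i P x y = (fun _ y => c₂ * (y i * ‖y‖⁻¹)) x y :=
    fun y hy => dY_norm_multiple hP hy i
  have s1 : SmoothOn (Set.univ : Set (Euc n)) fun _ y => ‖y‖⁻¹ :=
    smoothOn_norm.inv fun _ _ y hy => norm_ne_zero_iff.2 hy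
  rw [dY_congr_fibre (g := fun _ y => c₂ * (y i * ‖y‖⁻¹)) h1 hy,
    dY_const_mul isOpen_univ ((smoothOn_coord i).mul s1) (Set.mem_univ x) hy,
    dY_coord_mul_inv_norm hy]

namespace ProjectiveData

variable {X Y : Euc n → Euc n} {i j : Fin n} (h : ProjectiveData D L E P lam) (hij : i ≠ j)
  (hX : ∀ x ∈ D, X x = EuclideanSpace.single i 1) (hY : ∀ x ∈ D, Y x = EuclideanSpace.single j 1)
  (hx : x ∈ D) (hE : ∀ y ≠ 0, E x y = a / 2 * ‖y‖ ^ 2) (hy : y ≠ 0)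
include h hX hY hx hE hy

lemma curvField_at : curvField L X Y x y = (lam * a) • rotField i j y := by
  ext k
  rw [h.curvField_const_apply hx hy (hX x hx) (hY x hx), dY_half_norm_sq hE hy,
    dY_half_norm_sq hE hy]
  simp only [rotField, PiLp.sub_apply, PiLp.smul_apply, PiLp.single_apply, smul_eq_mul]
  split_ifs <;> ring

variable (hP : ∀ y ≠ 0, P x y = c₂ * ‖y‖) (ha : a * ‖y‖ ^ 2 = 1)
include hij hP ha

lemma covDeriv_curvField_at : covDeriv L X (curvField L X Y) x y =
    (lam * c₂ * a * ‖y‖⁻¹) • ((2 * y i) • rotField i j y + a⁻¹ • sphField a j y) := by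
  have hr : ‖y‖ ≠ 0 := norm_ne_zero_iff.2 hy
  have hr2 : a = ‖y‖⁻¹ ^ 2 := by field_simp; exact ha
  ext k
  rw [h.covDeriv_curvField_apply hij hX hY hx hy, dY_half_norm_sq hE hy, dY_half_norm_sq hE hy,
    dY_norm_multiple hP hy, dY_dY_norm_multiple hP hy, dY_dY_norm_multiple hP hy, hE y hy,
    if_pos rfl, if_neg hij]
  simp only [rotField, sphField, PiLp.sub_apply, PiLp.add_apply, PiLp.smul_apply,
    PiLp.single_apply, smul_eq_mul]
  rw [hr2]
  generalize ‖y‖ = r at hr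
  have hji := Ne.symm hij
  by_cases h1 : k = j
  · subst h1; simp only [if_true, if_neg hji]; field_simp; ring
  · by_cases h2 : k = i
    · subst h2; simp only [if_true, if_neg h1]; field_simp; ring
    · simp only [if_neg h1, if_neg h2]; field_simp; ring

lemma covDeriv_covDeriv_curvField_at (hn : n ≠ 1) :
    covDeriv L X (covDeriv L X (curvField L X Y)) x y =
      (lam * a) • ((4 * c₂ ^ 2 * a * y i ^ 2 - 3 * lam * a) • rotField i j y
        + (8 * c₂ ^ 2 * y i) • sphField a j y) := by
  have hr : ‖y‖ ≠ 0 := norm_ne_zero_iff.2 hy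
  have hr2 : a = ‖y‖⁻¹ ^ 2 := by field_simp; exact ha
  ext k
  rw [h.covDeriv_covDeriv_curvField_apply hn hij hX hY hx hy (hE y hy) (dY_half_norm_sq hE hy i)
    (dY_half_norm_sq hE hy j) (dY_norm_multiple hP hy i) (dY_dY_norm_multiple hP hy i i)
    (dY_dY_norm_multiple hP hy i j) (dY_dY_half_norm_sq hE hy i i)
    (dY_dY_dY_half_norm_sq hE hy i i i) (dY_dY_dY_half_norm_sq hE hy i i j), if_pos rfl, if_pos rfl,
    if_neg hij]
  simp only [rotField, sphField, PiLp.sub_apply, PiLp.add_apply, PiLp.smul_apply,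
    PiLp.single_apply, smul_eq_mul]
  rw [hr2]
  generalize ‖y‖ = r at hr
  have hji := Ne.symm hij
  by_cases h1 : k = j
  · subst h1; simp only [if_true, if_neg hji]; field_simp; ring
  · by_cases h2 : k = i
    · subst h2; simp only [if_true, if_neg h1]; field_simp; ring
    · simp only [if_neg h1, if_neg h2]; field_simp; ring

end ProjectiveData

end AtPoint

/-! ### Geodesics of a projective Finsler function -/

section Geodesics

variable {n : ℕ} {D : Set (Euc n)} {L : Euc n → Euc n → ℝ} {x y : Euc n}

lemma SmoothOn.det {A : Fin n → Fin n → Euc n → Euc n → ℝ} (hA : ∀ i j, SmoothOn D (A i j)) :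
    SmoothOn D fun x y => (Matrix.of fun i j => A i j x y).det := by
  have h : SmoothOn D fun x y => ∑ σ : Equiv.Perm (Fin n),
      (((Equiv.Perm.sign σ : ℤ) : ℝ)) * ∏ i, A (σ i) i x y :=
    SmoothOn.sum fun σ _ => (smoothOn_const _).mul (SmoothOn.prod fun i _ => hA (σ i) i)
  exact h.congr fun x _ y _ => by rw [Matrix.det_apply']; rfl

lemma smoothOn_fundTensor (hD : IsOpen D) (hL : SmoothOn D L) (i j : Fin n) :
    SmoothOn D (fundTensor L i j) := by
  have h2 : SmoothOn D fun x y => L x y ^ 2 := (hL.mul hL).congr fun x _ y _ => sq _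
  exact (smoothOn_const _).mul ((h2.dY hD j).dY hD i)

lemma smoothOn_fundTensorInv (hD : IsOpen D) (hL : SmoothOn D L)
    (hdet : ∀ x ∈ D, ∀ y ≠ 0, IsUnit (Matrix.of fun a b => fundTensor L a b x y).det)
    (i j : Fin n) : SmoothOn D (fundTensorInv L i j) := by
  have hg := smoothOn_fundTensor hD hL
  have h1 : SmoothOn D fun x y => (Matrix.of fun a b =>
      (if a = j then (if b = i then 1 else 0) else fundTensor L a b x y)).det := by
    refine SmoothOn.det fun a b => ?_
    by_cases h : a = j
    · simpa [h] using smoothOn_const _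
    · simpa [h] using hg a b
  have h2 := (SmoothOn.det hg).inv fun x hx y hy => (hdet x hx y hy).ne_zero
  refine (h2.mul h1).congr fun x hx y hy => ?_
  rw [fundTensorInv, Matrix.inv_def, Ring.inverse_eq_inv', Matrix.smul_apply, smul_eq_mul,
    Matrix.adjugate_apply]
  congr 2
  ext a b
  by_cases h : a = j
  · subst h; simp [Pi.single_apply]
  · simp [h]

lemma smoothOn_geodCoeff (hD : IsOpen D) (hL : SmoothOn D L)
    (hdet : ∀ x ∈ D, ∀ y ≠ 0, IsUnit (Matrix.of fun a b => fundTensor L a b x y).det)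
    (i : Fin n) : SmoothOn D (geodCoeff L i) := by
  have hg := smoothOn_fundTensor hD hL
  refine (smoothOn_const _).mul (SmoothOn.sum fun l _ => SmoothOn.sum fun j _ =>
    SmoothOn.sum fun k _ => (((smoothOn_fundTensorInv hD hL hdet i l).mul ?_).mul
      (smoothOn_coord j)).mul (smoothOn_coord k))
  exact ((smoothOn_const 2).mul ((hg j l).dX hD k)).sub ((hg j k).dX hD l)

lemma mem_of_hasDerivAt {S : Submodule ℝ (Euc n)} {g : ℝ → Euc n} {w : Euc n} {t : ℝ}
    (hg : HasDerivAt g w t) (hS : ∀ᶠ s in 𝓝 t, g s - g t ∈ S) : w ∈ S := by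
  have hc : IsClosed (S : Set (Euc n)) := S.closed_of_finiteDimensional
  refine hc.mem_of_tendsto (hasDerivAt_iff_tendsto_slope.1 hg) ?_
  filter_upwards [mem_nhdsWithin_of_mem_nhds hS] with s hs
  exact S.smul_mem _ hs

/-- If all geodesics are straight lines, the acceleration of the geodesic with initial velocity `y`
is parallel to `y`, so the geodesic coefficients are proportional to `y`. -/
lemma exists_factor_of_isProjectiveOn (hD : IsOpen D) (hG : ∀ i, SmoothOn D (geodCoeff L i))
    (hproj : IsProjectiveOn L D) (hx : x ∈ D) (hy : y ≠ 0) :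
    ∃ p : ℝ, ∀ i, geodCoeff L i x y = p * y i := by
  let w : Euc n × Euc n → Euc n := fun p => WithLp.toLp 2 fun i => -2 * geodCoeff L i p.1 p.2
  have hw : ContDiffAt ℝ 1 (fun p : Euc n × Euc n => (p.2, w p)) (x, y) := by
    refine contDiffAt_snd.prodMk ?_
    rw [contDiffAt_euclidean]
    intro i
    exact contDiffAt_const.mul (((hG i).contDiffAt hD hx hy).of_le (by norm_cast))
  obtain ⟨α, hα0, ε, hε, hα⟩ :=
    hw.exists_forall_mem_closedBall_exists_eq_forall_mem_Ioo_hasDerivAt₀ 0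
  simp only [zero_sub, zero_add] at hα
  have hcont : ContinuousAt α 0 := (hα 0 ⟨by linarith, hε⟩).continuousAt
  have hU : ∀ᶠ t in 𝓝 (0 : ℝ), α t ∈ D ×ˢ ({0}ᶜ : Set (Euc n)) :=
    hcont.eventually_mem ((isOpen_slit hD).mem_nhds (by rw [hα0]; exact ⟨hx, hy⟩))
  obtain ⟨δ, hδ, hδU⟩ := Metric.eventually_nhds_iff.1 hU
  set r := min ε δ with hr
  have hr0 : 0 < r := lt_min hε hδ
  have hαr : ∀ t ∈ Set.Ioo (-r) r, HasDerivAt α ((α t).2, w (α t)) t := fun t ht =>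
    hα t ⟨by linarith [ht.1, min_le_left ε δ], ht.2.trans_le (min_le_left _ _)⟩
  have hUr : ∀ t ∈ Set.Ioo (-r) r, α t ∈ D ×ˢ ({0}ᶜ : Set (Euc n)) := fun t ht =>
    hδU (by rw [Real.dist_eq, sub_zero, abs_lt]
            exact ⟨by linarith [ht.1, min_le_right ε δ], ht.2.trans_le (min_le_right _ _)⟩)
  let c : ℝ → Euc n := fun t => (α t).1
  have hc : ∀ t ∈ Set.Ioo (-r) r, HasDerivAt c (α t).2 t := fun t ht => (hαr t ht).fst
  have hv : ∀ t ∈ Set.Ioo (-r) r, HasDerivAt (fun t => (α t).2) (w (α t)) t := fun t ht =>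
    (hαr t ht).snd
  have hdc : ∀ t ∈ Set.Ioo (-r) r, deriv c =ᶠ[𝓝 t] fun t => (α t).2 := fun t ht => by
    filter_upwards [Ioo_mem_nhds ht.1 ht.2] with s hs using (hc s hs).deriv
  have hgeo : IsGeodesicOn L D (-r) r c := by
    intro t ht
    have h1 := (hc t ht).deriv
    have h2 : HasDerivAt (deriv c) (w (α t)) t := (hv t ht).congr_of_eventuallyEq (hdc t ht)
    refine ⟨(hUr t ht).1, (hc t ht).differentiableAt, by rw [h1]; exact (hUr t ht).2,
      h2.differentiableAt, fun i => ?_⟩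
    rw [h2.deriv, h1]
    simp [w, c]
  have h0 : (0 : ℝ) ∈ Set.Ioo (-r) r := ⟨by linarith, hr0⟩
  obtain ⟨u, hu⟩ := (collinear_iff_of_mem (Set.mem_image_of_mem c h0)).1 (hproj _ _ c hgeo)
  let S : Submodule ℝ (Euc n) := Submodule.span ℝ {u}
  have hS : ∀ t ∈ Set.Ioo (-r) r, c t - c 0 ∈ S := fun t ht => by
    obtain ⟨s, hs⟩ := hu (c t) (Set.mem_image_of_mem c ht)
    rw [hs]
    simpa using S.smul_mem s (Submodule.mem_span_singleton_self u)
  have hvS : ∀ t ∈ Set.Ioo (-r) r, (α t).2 ∈ S := fun t ht => by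
    refine mem_of_hasDerivAt (hc t ht) ?_
    filter_upwards [Ioo_mem_nhds ht.1 ht.2] with s hs
    have := S.sub_mem (hS s hs) (hS t ht)
    rwa [sub_sub_sub_cancel_right] at this
  have hwS : w (α 0) ∈ S := by
    refine mem_of_hasDerivAt (hv 0 h0) ?_
    filter_upwards [Ioo_mem_nhds h0.1 h0.2] with s hs using S.sub_mem (hvS s hs) (hvS 0 h0)
  have hyS := hvS 0 h0
  rw [hα0] at hwS hyS
  obtain ⟨s, hs⟩ := Submodule.mem_span_singleton.1 hyS
  obtain ⟨s', hs'⟩ := Submodule.mem_span_singleton.1 hwS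
  have hs0 : s ≠ 0 := by
    rintro rfl
    exact hy (by simpa using hs.symm)
  refine ⟨-(s' / s) / 2, fun i => ?_⟩
  have e1 : y i = s * u i := by
    have := congrArg (fun z : Euc n => z i) hs.symm
    simpa using this
  have e2 : -2 * geodCoeff L i x y = s' * u i := by
    have := congrArg (fun z : Euc n => z i) hs'.symm
    simpa [w] using this
  rw [e1]
  field_simp
  linarith

end Geodesics

/-! ### Coordinate expressions on the manifold -/

section Coordinates

open Bundle

variable {n : ℕ} {M : Type*} [TopologicalSpace M] [ChartedSpace (Euc n) M]
  [IsManifold (𝓡 n) ∞ M] {F : TangentBundle (𝓡 n) M → ℝ}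
  {φ : OpenPartialHomeomorph M (Euc n)} {x y : Euc n}

omit [IsManifold (𝓡 n) ∞ M] in
lemma mdifferentiable_of_mem_maximalAtlas (hφ : φ ∈ IsManifold.maximalAtlas (𝓡 n) ∞ M) :
    φ.MDifferentiable (𝓡 n) (𝓡 n) :=
  ⟨(contMDiffOn_of_mem_maximalAtlas hφ).mdifferentiableOn (by simp),
    (contMDiffOn_symm_of_mem_maximalAtlas hφ).mdifferentiableOn (by simp)⟩

lemma contMDiff_tangentMk : ContMDiff 𝓘(ℝ, Euc n × Euc n) (𝓡 n).tangent ∞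
    fun p : Euc n × Euc n => (⟨p.1, p.2⟩ : TangentBundle (𝓡 n) (Euc n)) := by
  intro p
  apply Bundle.contMDiffAt_totalSpace.2
  refine ⟨contDiff_fst.contMDiff.contMDiffAt, ?_⟩
  convert! (contDiff_snd (𝕜 := ℝ) (E := Euc n) (F := Euc n)).contMDiff.contMDiffAt with q
  simp
  rfl

/-- The bundle chart `(x, y) ↦ d(φ⁻¹)_x y`. -/
lemma contMDiffOn_tangent_symm (hφ : φ ∈ IsManifold.maximalAtlas (𝓡 n) ∞ M) :
    ContMDiffOn 𝓘(ℝ, Euc n × Euc n) (𝓡 n).tangent ∞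
      (fun p : Euc n × Euc n =>
        (⟨φ.symm p.1, mfderiv (𝓡 n) (𝓡 n) φ.symm p.1 p.2⟩ : TangentBundle (𝓡 n) M))
      (φ.target ×ˢ Set.univ) := by
  have h1 := (contMDiffOn_symm_of_mem_maximalAtlas hφ).contMDiffOn_tangentMapWithin (m := ∞)
    (by simp) φ.open_target.uniqueMDiffOn
  have h2 := h1.comp (contMDiff_tangentMk.contMDiffOn (s := φ.target ×ˢ Set.univ))
    fun p hp => hp.1
  refine h2.congr fun p hp => ?_
  simp only [Function.comp_def, tangentMapWithin]
  rw [mfderivWithin_of_isOpen φ.open_target hp.1]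

omit [IsManifold (𝓡 n) ∞ M] in
lemma mfderiv_symm_ne_zero (hφ : φ ∈ IsManifold.maximalAtlas (𝓡 n) ∞ M) (hx : x ∈ φ.target)
    (hy : y ≠ 0) : mfderiv (𝓡 n) (𝓡 n) φ.symm x y ≠ 0 := by
  intro h
  have h1 := (mdifferentiable_of_mem_maximalAtlas hφ).comp_symm_deriv hx
  have h2 := congrArg (fun A => A y) h1
  apply hy
  have h3 : (mfderiv (𝓡 n) (𝓡 n) φ (φ.symm x)) (mfderiv (𝓡 n) (𝓡 n) φ.symm x y) = y := h2
  rw [h, map_zero] at h3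
  exact h3.symm

lemma smoothOn_coordFun (hF : IsFinsler F) (hφ : φ ∈ IsManifold.maximalAtlas (𝓡 n) ∞ M) :
    SmoothOn φ.target (coordFun F φ) := by
  have h := hF.smooth.comp ((contMDiffOn_tangent_symm hφ).mono
    (Set.prod_mono subset_rfl (Set.subset_univ ({0}ᶜ : Set (Euc n)))))
    fun p hp => mfderiv_symm_ne_zero hφ hp.1 hp.2
  exact contMDiffOn_iff_contDiffOn.1 h

lemma coordFun_smul (hF : IsFinsler F) (x y : Euc n) {t : ℝ} (ht : 0 < t) :
    coordFun F φ x (t • y) = t * coordFun F φ x y := by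
  let A : Euc n →L[ℝ] TangentSpace (𝓡 n) (φ.symm x) := mfderiv (𝓡 n) (𝓡 n) φ.symm x
  exact (congrArg (fun v => F ⟨φ.symm x, v⟩) (A.map_smul t y)).trans (hF.homogeneous _ _ t ht)

/-- The second derivative along `u` of a function on a vector space, in coordinates. -/
lemma deriv_deriv_eq_sum {f : Euc n → ℝ} (hf : ContDiffAt ℝ ∞ f y) (u : Euc n) :
    deriv (fun s : ℝ => deriv (fun t : ℝ => f (y + s • u + t • u)) 0) 0 =
      ∑ i, ∑ j, u i * u j * fderiv ℝ (fun z => fderiv ℝ f z (EuclideanSpace.single j 1)) y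
        (EuclideanSpace.single i 1) := by
  have hd : DifferentiableAt ℝ (fderiv ℝ f) y :=
    (hf.fderiv_right (m := 1) (by norm_cast)).differentiableAt (by simp)
  have hl : ∀ z : Euc n, HasDerivAt (fun s : ℝ => z + s • u) u 0 := fun z => by
    simpa using ((hasDerivAt_id (0 : ℝ)).smul_const u).const_add z
  have h1 : (fun s : ℝ => deriv (fun t : ℝ => f (y + s • u + t • u)) 0) =ᶠ[𝓝 0]
      fun s => fderiv ℝ f (y + s • u) u := by
    have hc : Filter.Tendsto (fun s : ℝ => y + s • u) (𝓝 0) (𝓝 y) := by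
      simpa using (hl y).continuousAt.tendsto
    have he : ∀ᶠ z in 𝓝 y, DifferentiableAt ℝ f z := by
      filter_upwards [(hf.of_le (m := 1) (by norm_cast)).eventually (by simp)] with z hz
      exact hz.differentiableAt (by simp)
    filter_upwards [hc.eventually he] with s hs
    have h2 : HasFDerivAt f (fderiv ℝ f (y + s • u)) (y + s • u + (0 : ℝ) • u) := by
      simpa using hs.hasFDerivAt
    exact (h2.comp_hasDerivAt (0 : ℝ) (hl (y + s • u))).deriv
  rw [h1.deriv_eq]
  have h3 : HasFDerivAt (fun z => fderiv ℝ f z u) ((fderiv ℝ (fderiv ℝ f) y).flip u)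
      (y + (0 : ℝ) • u) := by
    simpa using hd.hasFDerivAt.clm_apply (hasFDerivAt_const u y)
  have h5 := (h3.comp_hasDerivAt (0 : ℝ) (hl y)).deriv
  simp only [Function.comp_def] at h5
  rw [h5]
  have hu : u = ∑ i, u i • EuclideanSpace.single i (1 : ℝ) := by
    ext i; simp [Pi.single_apply]
  have h4 : ∀ j, fderiv ℝ (fun z => fderiv ℝ f z (EuclideanSpace.single j 1)) y =
      (fderiv ℝ (fderiv ℝ f) y).flip (EuclideanSpace.single j 1) := fun j => by
    rw [fderiv_clm_apply hd (by fun_prop)]; simp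
  simp_rw [h4]
  simp only [ContinuousLinearMap.flip_apply]
  conv_lhs => rw [hu]
  simp only [map_sum, map_smul, _root_.sum_apply, _root_.smul_apply,
    smul_eq_mul, Finset.mul_sum]
  rw [Finset.sum_comm]
  exact Finset.sum_congr rfl fun i _ => Finset.sum_congr rfl fun j _ => by ring

lemma sum_fundTensor_pos (hF : IsFinsler F) (hφ : φ ∈ IsManifold.maximalAtlas (𝓡 n) ∞ M)
    (hx : x ∈ φ.target) (hy : y ≠ 0) {u : Euc n} (hu : u ≠ 0) :
    0 < ∑ i, ∑ j, u i * u j * fundTensor (coordFun F φ) i j x y := by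
  have h := hF.posDef (φ.symm x) (mfderiv (𝓡 n) (𝓡 n) φ.symm x y) (mfderiv_symm_ne_zero hφ hx hy)
    (mfderiv (𝓡 n) (𝓡 n) φ.symm x u) (mfderiv_symm_ne_zero hφ hx hu)
  have hs : SmoothOn φ.target fun x y => coordFun F φ x y ^ 2 :=
    ((smoothOn_coordFun hF hφ).mul (smoothOn_coordFun hF hφ)).congr fun x _ y _ => sq _
  have hf : ContDiffAt ℝ ∞ (fun z => coordFun F φ x z ^ 2) y :=
    (hs.contDiffAt φ.open_target hx hy).comp y (contDiffAt_const.prodMk contDiffAt_id)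
  have h1 := deriv_deriv_eq_sum hf u
  have h2 : (fun s : ℝ => deriv (fun t : ℝ => F ⟨φ.symm x, mfderiv (𝓡 n) (𝓡 n) φ.symm x y
      + s • mfderiv (𝓡 n) (𝓡 n) φ.symm x u + t • mfderiv (𝓡 n) (𝓡 n) φ.symm x u⟩ ^ 2) 0) =
      fun s : ℝ => deriv (fun t : ℝ => coordFun F φ x (y + s • u + t • u) ^ 2) 0 := by
    let A : Euc n →L[ℝ] TangentSpace (𝓡 n) (φ.symm x) := mfderiv (𝓡 n) (𝓡 n) φ.symm x
    have hA : ∀ s t : ℝ, A (y + s • u + t • u) = A y + s • A u + t • A u := fun s t => by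
      rw [A.map_add, A.map_add, A.map_smul, A.map_smul]
    funext s
    congr 1
    funext t
    exact congrArg (fun v => F ⟨φ.symm x, v⟩ ^ 2) (hA s t).symm
  rw [h2, h1] at h
  have h3 : ∑ i, ∑ j, u i * u j * fundTensor (coordFun F φ) i j x y =
      (1 / 2) * ∑ i, ∑ j, u i * u j *
        fderiv ℝ (fun z => fderiv ℝ (fun z => coordFun F φ x z ^ 2) z (EuclideanSpace.single j 1)) y
        (EuclideanSpace.single i 1) := by
    simp only [Finset.mul_sum]
    refine Finset.sum_congr rfl fun i _ => Finset.sum_congr rfl fun j _ => ?_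
    rw [fundTensor, dY]
    simp only [dY]
    ring
  rwa [h3]

lemma isUnit_det_fundTensor (hF : IsFinsler F) (hφ : φ ∈ IsManifold.maximalAtlas (𝓡 n) ∞ M)
    (hx : x ∈ φ.target) (hy : y ≠ 0) :
    IsUnit (Matrix.of fun a b => fundTensor (coordFun F φ) a b x y).det := by
  rw [isUnit_iff_ne_zero]
  intro h
  obtain ⟨v, hv, hv'⟩ := Matrix.exists_mulVec_eq_zero_iff.2 h
  have hu : (WithLp.toLp 2 v : Euc n) ≠ 0 := fun h => hv (by simpa using h)
  have h1 := sum_fundTensor_pos hF hφ hx hy hu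
  have h2 : ∑ i, ∑ j, v i * v j * fundTensor (coordFun F φ) i j x y = 0 := by
    refine Finset.sum_eq_zero fun i _ => ?_
    have h3 := congrFun hv' i
    simp only [Matrix.mulVec, dotProduct, Matrix.of_apply, Pi.zero_apply] at h3
    rw [← mul_zero (v i), ← h3, Finset.mul_sum]
    exact Finset.sum_congr rfl fun j _ => by ring
  exact h1.ne' h2

lemma coordFun_ne_zero (hF : IsFinsler F) (hφ : φ ∈ IsManifold.maximalAtlas (𝓡 n) ∞ M)
    (hx : x ∈ φ.target) (hy : y ≠ 0) : coordFun F φ x y ≠ 0 := by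
  have sL := smoothOn_coordFun hF hφ
  have eL : EulerOn φ.target 1 (coordFun F φ) :=
    eulerOn_of_homogeneous φ.open_target sL fun x _ y _ t ht => coordFun_smul hF x y ht
  have h1 := sum_fundTensor_pos hF hφ hx hy hy
  intro h
  have h2 : ∑ i, ∑ j, y i * y j * fundTensor (coordFun F φ) i j x y =
      ∑ i, y i * dY i (energy (coordFun F φ)) x y := by
    refine Finset.sum_congr rfl fun i _ => ?_
    rw [← sum_fundTensor_mul φ.open_target sL eL hx hy, Finset.mul_sum]
    exact Finset.sum_congr rfl fun j _ => by ring
  rw [h2, eL.energy φ.open_target sL x hx y hy, energy, h] at h1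
  norm_num at h1

lemma exists_projectiveData_of_chart (hF : IsFinsler F) {lam : ℝ}
    (hcurv : HasConstantCurvature F lam) (hφ : IsProjectiveChart F φ) :
    ∃ P, ProjectiveData φ.target (coordFun F φ) (energy (coordFun F φ)) P lam := by
  have hm := hφ.mem_maximalAtlas
  have sL := smoothOn_coordFun hF hm
  have hdet := fun x (hx : x ∈ φ.target) y (hy : y ≠ 0) => isUnit_det_fundTensor hF hm hx hy
  refine exists_projectiveData φ.open_target sL
    (eulerOn_of_homogeneous φ.open_target sL fun x _ y _ t ht => coordFun_smul hF x y ht)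
    (fun x hx y hy => coordFun_ne_zero hF hm hx hy) hdet (fun x hx y hy => ?_) (hcurv φ hm)
  exact exists_factor_of_isProjectiveOn φ.open_target
    (smoothOn_geodCoeff φ.open_target sL hdet) hφ.projective hx hy

lemma contDiffOn_coordField (hφ : φ ∈ IsManifold.maximalAtlas (𝓡 n) ∞ M)
    {X : (p : M) → TangentSpace (𝓡 n) p} (hX : IsSmoothField X) :
    ContDiffOn ℝ ∞ (coordField X φ) φ.target := by
  have h1 := (contMDiffOn_of_mem_maximalAtlas hφ).contMDiffOn_tangentMapWithin (m := ∞)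
    (by simp) φ.open_source.uniqueMDiffOn
  have h2 := h1.comp (hX.comp_contMDiffOn (contMDiffOn_symm_of_mem_maximalAtlas hφ))
    fun p hp => φ.map_target hp
  have h3 := (contMDiff_snd_tangentBundle_modelSpace (n := ∞) (Euc n) (𝓡 n)).comp_contMDiffOn h2
  refine (contMDiffOn_iff_contDiffOn.1 h3).congr fun p hp => ?_
  have h4 := mfderivWithin_of_isOpen (I := 𝓡 n) (I' := 𝓡 n) (f := φ) φ.open_source
    (φ.map_target hp)
  exact congrArg (fun A => A (X (φ.symm p))) h4.symm

/-- Every vector is the value, near a given point, of the coordinate expression of a global smooth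
field. -/
lemma exists_smoothField_const [T2Space M] (hφ : φ ∈ IsManifold.maximalAtlas (𝓡 n) ∞ M) {p : M}
    (hp : p ∈ φ.source) (e : Euc n) : ∃ X : (q : M) → TangentSpace (𝓡 n) q, IsSmoothField X ∧
      ∀ᶠ z in 𝓝 (φ p), coordField X φ z = e := by
  obtain ⟨χ, hχ, -⟩ := (SmoothBumpFunction.nhds_basis_support (I := 𝓡 n)
    (φ.open_source.mem_nhds hp)).mem_iff.1 (φ.open_source.mem_nhds hp)
  let s : (q : M) → TangentSpace (𝓡 n) q := fun q =>
    (mfderiv (𝓡 n) (𝓡 n) φ.symm (φ q) e : Euc n)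
  have hs : ContMDiffOn (𝓡 n) (𝓡 n).tangent ∞
      (fun q => (⟨q, s q⟩ : TangentBundle (𝓡 n) M)) φ.source := by
    have hc : ContMDiffOn (𝓡 n) 𝓘(ℝ, Euc n × Euc n) ∞ (fun q => (φ q, e)) φ.source :=
      (contMDiffOn_of_mem_maximalAtlas hφ).prodMk_space contMDiffOn_const
    have h1 := (contMDiffOn_tangent_symm hφ).comp hc fun q hq => ⟨φ.map_source hq, trivial⟩
    refine h1.congr fun q hq => ?_
    simp only [Function.comp_def, s]
    congr 1
    exact (φ.left_inv hq).symm
  refine ⟨(χ : M → ℝ) • s, ContMDiffOn.smul_section_of_tsupport χ.contMDiff.contMDiffOn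
    φ.open_source hχ hs, ?_⟩
  have hc : Filter.Tendsto φ.symm (𝓝 (φ p)) (𝓝 p) := by
    have := φ.continuousAt_symm (φ.map_source hp)
    rwa [ContinuousAt, φ.left_inv hp] at this
  filter_upwards [hc.eventually χ.eventuallyEq_one, φ.open_target.mem_nhds (φ.map_source hp)]
    with z hz hzt
  have h1 : ((χ : M → ℝ) • s) (φ.symm z) = mfderiv (𝓡 n) (𝓡 n) φ.symm z e := by
    have h2 : s (φ.symm z) = (mfderiv (𝓡 n) (𝓡 n) φ.symm z e : Euc n) := by
      simp only [s]
      rw [φ.right_inv hzt]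
    change χ (φ.symm z) • s (φ.symm z) = _
    rw [hz, h2]
    exact one_smul ℝ _
  rw [coordField, h1]
  have h2 := congrArg (fun A => A e) ((mdifferentiable_of_mem_maximalAtlas hφ).comp_symm_deriv hzt)
  exact h2

end Coordinates

/-! ### Polynomial approximation of smooth functions with their derivatives -/

section PolynomialApproximation

open MeasureTheory Convolution ContinuousLinearMap

variable {n : ℕ}

/-- The vector space of polynomial functions on `ℝⁿ`. -/
def polyFun (n : ℕ) : Submodule ℝ (Euc n → ℝ) := Submodule.span ℝ (Set.range mon)

lemma mon_mem_polyFun (l : List (Fin n)) : mon l ∈ polyFun n := Submodule.subset_span ⟨l, rfl⟩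

lemma mul_mem_polyFun {p q : Euc n → ℝ} (hp : p ∈ polyFun n) (hq : q ∈ polyFun n) :
    p * q ∈ polyFun n := by
  have h : polyFun n * polyFun n ≤ polyFun n := by
    rw [polyFun, Submodule.span_mul_span]
    refine Submodule.span_le.2 ?_
    rintro _ ⟨_, ⟨l, rfl⟩, _, ⟨l', rfl⟩, rfl⟩
    have := mon_mem_polyFun (l ++ l')
    rwa [mon_append] at this
  exact h (Submodule.mul_mem_mul hp hq)

lemma contDiff_of_mem_polyFun {p : Euc n → ℝ} (hp : p ∈ polyFun n) : ContDiff ℝ ∞ p := by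
  induction hp using Submodule.span_induction with
  | mem x h => obtain ⟨l, rfl⟩ := h; exact contDiff_mon l
  | zero => exact contDiff_const
  | add x y _ _ h h' => exact h.add h'
  | smul t x _ h => exact contDiff_const.smul h

/-- The Stone–Weierstrass theorem for polynomials on a compact set. -/
lemma exists_polyFun_near {f : Euc n → ℝ} (hf : Continuous f) {K : Set (Euc n)} (hK : IsCompact K)
    {ε : ℝ} (hε : 0 < ε) : ∃ q ∈ polyFun n, ∀ x ∈ K, |q x - f x| < ε := by
  let X : Fin n → C(Euc n, ℝ) := fun i => ⟨fun y => y i, by fun_prop⟩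
  have hsep : (Algebra.adjoin ℝ (Set.range X)).SeparatesPoints := by
    intro x y hxy
    obtain ⟨i, hi⟩ : ∃ i, x i ≠ y i := by
      by_contra! h
      exact hxy (PiLp.ext h)
    exact ⟨X i, ⟨X i, Algebra.subset_adjoin ⟨i, rfl⟩, rfl⟩, hi⟩
  obtain ⟨g, hg, h⟩ :=
    ContinuousMap.exists_mem_subalgebra_near_continuous_of_isCompact_of_separatesPoints hsep
      ⟨f, hf⟩ hK hε
  refine ⟨g, ?_, h⟩
  clear h
  induction hg using Algebra.adjoin_induction with
  | mem x h =>
    obtain ⟨i, rfl⟩ := h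
    have := mon_mem_polyFun [i]
    simp only [mon_cons, mon_nil, mul_one] at this
    exact this
  | algebraMap t =>
    have := (polyFun n).smul_mem t (mon_mem_polyFun (n := n) [])
    convert this using 1
    rw [mon_nil]; funext y; simp
  | add x y _ _ h h' => exact (polyFun n).add_mem h h'
  | mul x y _ _ h h' => exact mul_mem_polyFun h h'

/-- Convolution of a polynomial with a compactly supported function gives a polynomial. -/
lemma integral_mul_mem_polyFun {q : Euc n → ℝ} (hq : q ∈ polyFun n) {h : Euc n → ℝ}
    (hh : Continuous h) (hs : HasCompactSupport h) :
    (fun x => ∫ w, q (x - w) * h w) ∈ polyFun n := by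
  have hint : ∀ {q h : Euc n → ℝ}, Continuous q → Continuous h → HasCompactSupport h → ∀ x,
      Integrable fun w => q (x - w) * h w := fun hq hh hs x =>
    Continuous.integrable_of_hasCompactSupport (by fun_prop) hs.mul_left
  induction hq using Submodule.span_induction generalizing h with
  | mem q hq =>
    obtain ⟨l, rfl⟩ := hq
    induction l generalizing h with
    | nil =>
      have := (polyFun n).smul_mem (∫ w, h w) (mon_mem_polyFun (n := n) [])
      convert this using 1
      rw [mon_nil]; funext x; simp
    | cons i l ih =>
      have c1 : Continuous fun w : Euc n => w i * h w := by fun_prop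
      have s1 : HasCompactSupport fun w : Euc n => w i * h w := hs.mul_left
      have h1 := mul_mem_polyFun (mon_mem_polyFun [i]) (ih hh hs)
      have h2 := (polyFun n).sub_mem h1 (ih c1 s1)
      convert h2 using 1
      funext x
      simp only [mon_cons, mon_nil, Pi.sub_apply, Pi.mul_apply, mul_one]
      rw [← integral_const_mul, ← integral_sub
        ((hint (contDiff_mon l).continuous hh hs x).const_mul _)
        (hint (contDiff_mon l).continuous c1 s1 x)]
      congr 1; funext w
      rw [PiLp.sub_apply]; ring
  | zero => simp only [Pi.zero_apply, zero_mul, integral_zero]; exact (polyFun n).zero_mem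
  | add p q hp hq ih ih' =>
    have := (polyFun n).add_mem (ih hh hs) (ih' hh hs)
    convert this using 1
    funext x
    simp only [Pi.add_apply, add_mul]
    exact integral_add (hint (contDiff_of_mem_polyFun hp).continuous hh hs x)
      (hint (contDiff_of_mem_polyFun hq).continuous hh hs x)
  | smul t q hq ih =>
    have := (polyFun n).smul_mem t (ih hh hs)
    convert this using 1
    funext x
    simp only [Pi.smul_apply, smul_eq_mul, mul_assoc]
    exact integral_const_mul _ _

/-- An approximate identity for functions with bounded gradient is one for all higher
derivatives, because convolution commutes with derivatives. -/
lemma norm_iteratedFDeriv_convolution_sub_le {ψ : Euc n → ℝ} (hψ : LocallyIntegrable ψ) {ε C : ℝ}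
    (H : ∀ (F : Type) [NormedAddCommGroup F] [NormedSpace ℝ F] [CompleteSpace F] (g : Euc n → F),
      ContDiff ℝ ∞ g → HasCompactSupport g → (∀ x, ‖g x‖ ≤ C) → (∀ x, ‖fderiv ℝ g x‖ ≤ C) →
      ∀ x, ‖(ψ ⋆[lsmul ℝ ℝ, volume] g) x - g x‖ ≤ ε) (k : ℕ) {F : Type} [NormedAddCommGroup F]
    [NormedSpace ℝ F] [CompleteSpace F] {g : Euc n → F} (hg : ContDiff ℝ ∞ g)
    (hs : HasCompactSupport g) (h0 : ∀ x, ‖iteratedFDeriv ℝ k g x‖ ≤ C)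
    (h1 : ∀ x, ‖iteratedFDeriv ℝ (k + 1) g x‖ ≤ C) (x : Euc n) :
    ‖iteratedFDeriv ℝ k (fun x => (ψ ⋆[lsmul ℝ ℝ, volume] g) x - g x) x‖ ≤ ε := by
  induction k generalizing F with
  | zero =>
    rw [norm_iteratedFDeriv_zero]
    simp only [norm_iteratedFDeriv_zero] at h0
    refine H F g hg hs h0 (fun x => ?_) x
    have := h1 x
    rwa [zero_add, norm_iteratedFDeriv_one] at this
  | succ k ih =>
    rw [← norm_iteratedFDeriv_fderiv]
    have h2 : fderiv ℝ (fun x => (ψ ⋆[lsmul ℝ ℝ, volume] g) x - g x) =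
        fun x => (ψ ⋆[lsmul ℝ ℝ, volume] fderiv ℝ g) x - fderiv ℝ g x := by
      funext x
      have h3 := hs.hasFDerivAt_convolution_right (lsmul ℝ ℝ) hψ (hg.of_le (by simp)) x
      have h4 := (h3.sub ((hg.differentiable (by simp) x).hasFDerivAt)).fderiv
      exact h4
    rw [h2]
    refine ih (hg.fderiv_right (by simp)) (hs.fderiv ℝ) (fun x => ?_) fun x => ?_
    · rw [norm_iteratedFDeriv_fderiv]; exact h0 x
    · rw [norm_iteratedFDeriv_fderiv]; exact h1 x

/-- A smooth compactly supported function can be approximated by polynomials, uniformly on balls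
with all derivatives up to a given order: mollify, and replace the mollifier by a polynomial that is
close to it on a large ball. -/
lemma exists_polyFun_iteratedFDeriv_near {g : Euc n → ℝ} (hg : ContDiff ℝ ∞ g)
    (hs : HasCompactSupport g) (m : ℕ) {ε : ℝ} (hε : 0 < ε) (R : ℝ) :
    ∃ p ∈ polyFun n, ∀ k ≤ m, ∀ x ∈ Metric.ball (0 : Euc n) R,
      ‖iteratedFDeriv ℝ k (fun x => p x - g x) x‖ ≤ ε := by
  -- a common bound for the derivatives of `g`
  obtain ⟨C, hC0, hC⟩ : ∃ C > 0, ∀ k ≤ m + 1, ∀ x, ‖iteratedFDeriv ℝ k g x‖ ≤ C := by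
    have : ∀ k, ∃ C, ∀ x, ‖iteratedFDeriv ℝ k g x‖ ≤ C := fun k =>
      Continuous.bounded_above_of_compact_support
        (hg.continuous_iteratedFDeriv (by exact_mod_cast le_top)) (hs.iteratedFDeriv k)
    choose c hc using this
    refine ⟨1 + ∑ k ∈ Finset.range (m + 2), |c k|, by positivity, fun k hk x => ?_⟩
    have := Finset.single_le_sum (f := fun k => |c k|) (fun k _ => abs_nonneg _)
      (Finset.mem_range.2 (by lia : k < m + 2))
    linarith [hc k x, le_abs_self (c k)]
  obtain ⟨ρ, hρ⟩ := hs.isCompact.isBounded.subset_closedBall (0 : Euc n)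
  let δ : ℝ := min 1 (ε / (2 * C))
  have hδ : 0 < δ := by positivity
  let f : ContDiffBump (0 : Euc n) := ⟨δ / 2, δ, by positivity, by linarith⟩
  let B := Metric.closedBall (0 : Euc n) (max 1 (R + ρ))
  let v := volume.real B
  obtain ⟨q, hq, hqf⟩ := exists_polyFun_near (f.continuous_normed (μ := volume))
    (isCompact_closedBall (0 : Euc n) (max 1 (R + ρ)))
    (ε := ε / (2 * C * (v + 1))) (by positivity)
  have hqc := (contDiff_of_mem_polyFun hq).continuous
  let ψ : Euc n → ℝ := B.indicator q
  have hψi : Integrable ψ :=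
    (integrable_indicator_iff Metric.isClosed_closedBall.measurableSet).2
      (hqc.continuousOn.integrableOn_compact (isCompact_closedBall _ _))
  refine ⟨fun x => ∫ w, q (x - w) * g w, integral_mul_mem_polyFun hq hg.continuous hs,
    fun k hk x hx => ?_⟩
  have h1 : (fun x => (∫ w, q (x - w) * g w) - g x) =ᶠ[𝓝 x]
      fun x => (ψ ⋆[lsmul ℝ ℝ, volume] g) x - g x := by
    filter_upwards [Metric.isOpen_ball.mem_nhds hx] with x hx
    rw [convolution_lsmul_swap]
    congr 2
    funext w
    by_cases hw : w ∈ tsupport g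
    · have h2 : x - w ∈ B := by
        have h3 := mem_closedBall_zero_iff.1 (hρ hw)
        have h4 := mem_ball_zero_iff.1 hx
        refine mem_closedBall_zero_iff.2 (le_max_of_le_right ?_)
        linarith [norm_sub_le x w]
      simp [ψ, h2]
    · simp [image_eq_zero_of_notMem_tsupport hw]
  rw [h1.iteratedFDeriv ℝ k |>.eq_of_nhds]
  refine norm_iteratedFDeriv_convolution_sub_le (C := C) hψi.locallyIntegrable ?_ k hg hs
    (hC k (by lia)) (hC (k + 1) (by lia)) x
  intro F _ _ _ g hg hs h0 h1 x
  have e1 : ‖(f.normed volume ⋆[lsmul ℝ ℝ, volume] g) x - g x‖ ≤ ε / 2 := by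
    rw [← dist_eq_norm]
    refine f.dist_normed_convolution_le hg.continuous.aestronglyMeasurable fun z hz => ?_
    have h2 := Convex.norm_image_sub_le_of_norm_fderiv_le (𝕜 := ℝ) (f := g) (s := Set.univ)
      (fun z _ => hg.differentiable (by simp) z) (fun z _ => h1 z) convex_univ
      (Set.mem_univ x) (Set.mem_univ z)
    rw [dist_eq_norm]
    have h3 : ‖z - x‖ ≤ ε / (2 * C) := by
      rw [← dist_eq_norm]
      exact hz.le.trans (min_le_right _ _)
    calc _ ≤ C * ‖z - x‖ := h2
      _ ≤ C * (ε / (2 * C)) := by gcongr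
      _ = ε / 2 := by field_simp
  have e2 : ‖(ψ ⋆[lsmul ℝ ℝ, volume] g) x - (f.normed volume ⋆[lsmul ℝ ℝ, volume] g) x‖ ≤
      ε / 2 := by
    have hgx : Continuous fun t => g (x - t) := hg.continuous.comp (by fun_prop)
    have i1 : ∀ u : Euc n → ℝ, Integrable u → Integrable fun t => u t • g (x - t) := fun u hu =>
      hu.smul_bdd C hgx.aestronglyMeasurable (.of_forall fun t => h0 _)
    rw [convolution_lsmul, convolution_lsmul, ← integral_sub (i1 _ hψi) (i1 _ f.integrable_normed)]
    have h2 : ∀ t ∉ B, ψ t • g (x - t) - f.normed volume t • g (x - t) = 0 := by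
      intro t ht
      have h3 : f.normed volume t = 0 := by
        rw [← Function.notMem_support, f.support_normed_eq]
        refine fun h => ht (Metric.ball_subset_closedBall (Metric.ball_subset_ball ?_ h))
        exact (min_le_left _ _).trans (le_max_left _ _)
      rw [h3]; simp [ψ, ht]
    rw [← setIntegral_eq_integral_of_forall_compl_eq_zero (s := B) h2]
    have h4 := norm_setIntegral_le_of_norm_le_const (μ := volume) (s := B)
      (f := fun t => ψ t • g (x - t) - f.normed volume t • g (x - t))
      (C := ε / (2 * C * (v + 1)) * C) (isCompact_closedBall _ _).measure_lt_top fun t ht => by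
        rw [← sub_smul, norm_smul]
        have h5 : ψ t = q t := by simp [ψ, ht]
        rw [h5]
        exact mul_le_mul (hqf t ht).le (h0 _) (norm_nonneg _) (by positivity)
    refine h4.trans ?_
    change ε / (2 * C * (v + 1)) * C * v ≤ ε / 2
    have hv : 0 ≤ v := measureReal_nonneg
    rw [div_mul_eq_mul_div, div_mul_eq_mul_div, div_le_div_iff₀ (by positivity) (by positivity)]
    nlinarith [mul_pos hε hC0]
  calc _ = ‖((ψ ⋆[lsmul ℝ ℝ, volume] g) x - (f.normed volume ⋆[lsmul ℝ ℝ, volume] g) x) +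
        ((f.normed volume ⋆[lsmul ℝ ℝ, volume] g) x - g x)‖ := by rw [sub_add_sub_cancel]
    _ ≤ ε / 2 + ε / 2 := (norm_add_le _ _).trans (add_le_add e2 e1)
    _ = ε := by ring

end PolynomialApproximation

/-! ### Density of the polynomial vector fields -/

section Density

variable {n : ℕ} {N : Euc n → ℝ} {c a : ℝ}

lemma isCompact_indicatrix (hc : 0 < c) (hN : ∀ y, N y = c * ‖y‖) : IsCompact (indicatrix N) := by
  have h : indicatrix N = Metric.sphere (0 : Euc n) c⁻¹ := by
    ext y
    rw [mem_sphere_zero_iff_norm]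
    refine ⟨norm_of_mem_indicatrix hc hN, fun h => ?_⟩
    change N y = 1
    rw [hN, h, mul_inv_cancel₀ hc.ne']
  rw [h]; exact isCompact_sphere _ _

/-- The derivatives up to a given order of a map that is smooth off the origin are bounded on the
indicatrix. -/
lemma exists_bound_iteratedFDeriv (hc : 0 < c) (hN : ∀ y, N y = c * ‖y‖) {Z : Euc n → Euc n}
    (hZ : ContDiffOn ℝ ∞ Z {0}ᶜ) (m : ℕ) :
    ∃ D, 1 ≤ D ∧ ∀ k ≤ m, ∀ y ∈ indicatrix N, ‖iteratedFDerivWithin ℝ k Z {0}ᶜ y‖ ≤ D := by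
  have ho : IsOpen ({0}ᶜ : Set (Euc n)) := isOpen_compl_singleton
  have h : ∀ k : ℕ, ∃ D, ∀ y ∈ indicatrix N, ‖iteratedFDerivWithin ℝ k Z {0}ᶜ y‖ ≤ D := fun k =>
    (isCompact_indicatrix hc hN).exists_bound_of_continuousOn
      ((hZ.continuousOn_iteratedFDerivWithin (m := k) (by exact_mod_cast le_top)
        ho.uniqueDiffOn).mono fun y hy => ne_zero_of_mem_indicatrix hN hy)
  choose d hd using h
  refine ⟨1 + ∑ k ∈ Finset.range (m + 1), |d k|, le_add_of_nonneg_right (by positivity),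
    fun k hk y hy => ?_⟩
  have := Finset.single_le_sum (f := fun k => |d k|) (fun k _ => abs_nonneg _)
    (Finset.mem_range.2 (by lia : k < m + 1))
  linarith [hd k y hy, le_abs_self (d k)]

/-- The map `y ↦ h(y / N(y)) Z(y)` is small on the indicatrix, with its derivatives, if `h` is. -/
lemma exists_bound_radial_smul (hc : 0 < c) (hN : ∀ y, N y = c * ‖y‖) {Z : Euc n → Euc n}
    (hZ : ContDiffOn ℝ ∞ Z {0}ᶜ) (m : ℕ) :
    ∃ K, 0 < K ∧ ∀ (ε : ℝ) (h : Euc n → ℝ), ContDiff ℝ ∞ h →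
      (∀ k ≤ m, ∀ y ∈ indicatrix N, ‖iteratedFDeriv ℝ k h y‖ ≤ ε) →
      ∀ k ≤ m, ∀ y ∈ indicatrix N,
        ‖iteratedFDeriv ℝ k (fun y => h ((N y)⁻¹ • y) • Z y) y‖ ≤ K * ε := by
  have ho : IsOpen ({0}ᶜ : Set (Euc n)) := isOpen_compl_singleton
  have hu := ho.uniqueDiffOn (𝕜 := ℝ)
  have hr := contDiffOn_radial hc hN
  obtain ⟨D, hD1, hD⟩ := exists_bound_iteratedFDeriv hc hN hr m
  obtain ⟨D', hD1', hD'⟩ := exists_bound_iteratedFDeriv hc hN hZ m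
  refine ⟨2 ^ m * (m.factorial * D ^ m * D'), by positivity, fun ε h hh hε k hk y hy => ?_⟩
  have hy0 := ne_zero_of_mem_indicatrix hN hy
  have hε0 : 0 ≤ ε := (norm_nonneg _).trans (hε 0 (Nat.zero_le _) y hy)
  have hcomp : ContDiffOn ℝ ∞ (h ∘ fun y => (N y)⁻¹ • y) {0}ᶜ := hh.comp_contDiffOn hr
  have h1 : ∀ i ≤ m, ‖iteratedFDerivWithin ℝ i (h ∘ fun y => (N y)⁻¹ • y) {0}ᶜ y‖ ≤
      m.factorial * ε * D ^ m := by
    intro i hi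
    have h2 := norm_iteratedFDerivWithin_comp_le (n := i) hh.contDiffOn hr
      (by exact_mod_cast le_top) uniqueDiffOn_univ hu (Set.mapsTo_univ _ _) hy0 (C := ε) (D := D)
      (fun j hj => by
        rw [iteratedFDerivWithin_univ]
        have h3 : (N y)⁻¹ • y = y := by
          rw [show N y = 1 from hy, inv_one, one_smul]
        rw [h3]
        exact hε j (hj.trans hi) y hy)
      (fun j hj1 hj => (hD j (hj.trans hi) y hy).trans (le_self_pow₀ hD1 (by lia)))
    refine h2.trans ?_
    gcongr
  rw [← iteratedFDerivWithin_of_isOpen k ho hy0]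
  refine (norm_iteratedFDerivWithin_smul_le (n := k) hcomp hZ hu hy0
    (by exact_mod_cast le_top)).trans ?_
  calc _ ≤ ∑ i ∈ Finset.range (k + 1), (k.choose i : ℝ) * (m.factorial * ε * D ^ m) * D' := by
        refine Finset.sum_le_sum fun i hi => ?_
        have hi' : i ≤ k := Nat.lt_succ_iff.1 (Finset.mem_range.1 hi)
        gcongr
        · exact h1 i (hi'.trans hk)
        · exact hD' (k - i) (by lia) y hy
    _ = 2 ^ k * (m.factorial * D ^ m * D') * ε := by
        rw [← Finset.sum_mul, ← Finset.sum_mul]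
        have := Nat.sum_range_choose k
        rw [← Nat.cast_sum, this]
        push_cast; ring
    _ ≤ 2 ^ m * (m.factorial * D ^ m * D') * ε := by
        gcongr
        norm_num

/-- A smooth field on the indicatrix extends to a smooth compactly supported map. -/
lemma IsIndicatrixField.exists_extension (hc : 0 < c) (hN : ∀ y, N y = c * ‖y‖)
    {X : indicatrix N → Euc n} (hX : IsIndicatrixField N X) :
    ∃ g : Euc n → Euc n, ContDiff ℝ ∞ g ∧ HasCompactSupport g ∧ ∀ y : indicatrix N, g y = X y := by
  let f₁ : ContDiffBump (0 : Euc n) := ⟨c⁻¹, 2 * c⁻¹, by positivity, by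
    linarith [inv_pos.2 hc]⟩
  let f₂ : ContDiffBump (0 : Euc n) := ⟨c⁻¹ / 4, c⁻¹ / 2, by positivity, by
    linarith [inv_pos.2 hc]⟩
  refine ⟨fun y => (f₁ y * (1 - f₂ y)) • homExt N X y, contDiff_iff_contDiffAt.2 fun y => ?_,
    (f₁.hasCompactSupport.mul_right).smul_right, fun y => ?_⟩
  · by_cases hy : y = 0
    · have h : (fun y => (f₁ y * (1 - f₂ y)) • homExt N X y) =ᶠ[𝓝 y] fun _ => 0 := by
        rw [hy]
        filter_upwards [f₂.eventuallyEq_one] with z hz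
        rw [hz]; simp
      exact contDiffAt_const.congr_of_eventuallyEq h
    · exact ((f₁.contDiff.mul (contDiff_const.sub f₂.contDiff)).contDiffAt).smul
        (hX.smooth.contDiffAt (isOpen_compl_singleton.mem_nhds hy))
  · have hy := norm_of_mem_indicatrix hc hN y.2
    have h1 : f₁ y = 1 := f₁.one_of_mem_closedBall (by simp [f₁, hy])
    have h2 : f₂ y = 0 := f₂.zero_of_le_dist (by
      simp only [f₂, dist_zero_right, hy]; linarith [inv_pos.2 hc])
    simp [h1, h2, homExt_of_mem hc hN]

lemma sum_smul_sphField_of_inner_eq_zero {y v : Euc n} (h : inner ℝ y v = 0) :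
    ∑ j, v j • sphField a j y = v := by
  have h1 : ∑ i, v i • EuclideanSpace.single i (1 : ℝ) = v := by
    ext i; simp [Pi.single_apply]
  have h2 : ∑ i, v i * (a * y i) = 0 := by
    have h3 : ∑ i, v i * y i = 0 := by simpa [PiLp.inner_apply] using h
    have h4 : ∑ i, v i * (a * y i) = a * ∑ i, v i * y i := by
      rw [Finset.mul_sum]; exact Finset.sum_congr rfl fun i _ => by ring
    rw [h4, h3, mul_zero]
  simp only [sphField, smul_sub, smul_smul]
  rw [Finset.sum_sub_distrib, ← Finset.sum_smul, h1, h2, zero_smul, sub_zero]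

/-- Every smooth field on the indicatrix is close, with its derivatives up to order `m`, to a
polynomial field `∑ pⱼ Vⱼ`: approximate the components of an extension. -/
lemma exists_polyField_near (hc : 0 < c) (hN : ∀ y, N y = c * ‖y‖) {X : indicatrix N → Euc n}
    (hX : IsIndicatrixField N X) (m : ℕ) {ε : ℝ} (hε : 0 < ε) :
    ∃ p : Fin n → Euc n → ℝ, (∀ j, p j ∈ polyFun n) ∧ ∀ k ≤ m, ∀ y ∈ indicatrix N,
      ‖iteratedFDeriv ℝ k (homExt N (∑ j, polyField N a j (p j))) y
        - iteratedFDeriv ℝ k (homExt N X) y‖ ≤ ε := by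
  have ho : IsOpen ({0}ᶜ : Set (Euc n)) := isOpen_compl_singleton
  obtain ⟨g, hg, hgs, hgX⟩ := hX.exists_extension hc hN
  let W : Fin n → Euc n → Euc n := fun j => homExt N (restr N (sphField a j))
  have hW : ∀ j, ContDiffOn ℝ ∞ (W j) {0}ᶜ := fun j =>
    contDiffOn_homExt_restr hc hN (contDiff_sphField a j).contDiffOn
  have hgj : ∀ j, ContDiff ℝ ∞ fun y => g y j := fun j =>
    (EuclideanSpace.proj (𝕜 := ℝ) j).contDiff.comp hg
  have hgsj : ∀ j, HasCompactSupport fun y => g y j := fun j =>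
    hgs.comp_left (g := fun v : Euc n => v j) rfl
  choose K hK0 hK using fun j => exists_bound_radial_smul hc hN (hW j) m
  have hp : ∀ j, ∃ p ∈ polyFun n, ∀ k ≤ m, ∀ x ∈ Metric.ball (0 : Euc n) (c⁻¹ + 1),
      ‖iteratedFDeriv ℝ k (fun x => p x - g x j) x‖ ≤ ε / ((n + 1) * K j) := fun j =>
    exists_polyFun_iteratedFDeriv_near (hgj j) (hgsj j) m
      (by have := hK0 j; positivity) _
  choose p hp hpn using hp
  refine ⟨p, hp, fun k hk y hy => ?_⟩
  have hy0 := ne_zero_of_mem_indicatrix hN hy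
  have hps : ∀ j, ContDiff ℝ ∞ (p j) := fun j => contDiff_of_mem_polyFun (hp j)
  let u : Fin n → Euc n → Euc n := fun j y => (p j ((N y)⁻¹ • y) - g ((N y)⁻¹ • y) j) • W j y
  have hu : ∀ j, ContDiffOn ℝ ∞ (u j) {0}ᶜ := fun j =>
    (((hps j).sub (hgj j)).comp_contDiffOn (contDiffOn_radial hc hN)).smul (hW j)
  have hZ : ContDiffOn ℝ ∞ (homExt N (∑ j, polyField N a j (p j))) {0}ᶜ := by
    have h1 : ∑ j, polyField N a j (p j) = restr N fun y => ∑ j, p j y • sphField a j y := by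
      funext y
      rw [Finset.sum_apply]; rfl
    rw [h1]
    exact contDiffOn_homExt_restr hc hN (ContDiff.contDiffOn
      (ContDiff.sum fun j _ => (hps j).smul (contDiff_sphField a j)))
  have hdiff : homExt N (∑ j, polyField N a j (p j)) - homExt N X =ᶠ[𝓝 y] fun y => ∑ j, u j y := by
    filter_upwards [ho.mem_nhds hy0] with z hz
    have h1 := inv_smul_mem_indicatrix hc hN hz
    have h2 := hX.tangent ⟨_, h1⟩
    rw [fderiv_norm_multiple_eq_zero hc hN (ne_zero_of_mem_indicatrix hN h1), ← hgX] at h2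
    rw [Pi.sub_apply, homExt_of_ne_zero hc hN hz, homExt_of_ne_zero hc hN hz, ← hgX,
      Finset.sum_apply]
    simp only [u, W, homExt_restr hc hN hz, sub_smul, Finset.sum_sub_distrib]
    congr 1
    · rw [Finset.smul_sum]
      exact Finset.sum_congr rfl fun j _ => smul_comm _ _ _
    · conv_lhs => rw [← sum_smul_sphField_of_inner_eq_zero (a := a) h2]
      rw [Finset.smul_sum]
      exact Finset.sum_congr rfl fun j _ => smul_comm _ _ _
  have hmk : (k : WithTop ℕ∞) ≤ ∞ := by exact_mod_cast le_top
  have hat : ∀ {f : Euc n → Euc n}, ContDiffOn ℝ ∞ f {0}ᶜ → ContDiffAt ℝ k f y := fun h =>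
    (h.contDiffAt (ho.mem_nhds hy0)).of_le hmk
  rw [← iteratedFDeriv_sub_apply (hat hZ) (hat hX.smooth), (hdiff.iteratedFDeriv ℝ k).eq_of_nhds,
    iteratedFDeriv_fun_sum_apply fun j _ => hat (hu j)]
  have hbound : ∀ j, ‖iteratedFDeriv ℝ k (u j) y‖ ≤ ε / (n + 1) := fun j => by
    have h1 := hK j (ε / ((n + 1) * K j)) (fun x => p j x - g x j) ((hps j).sub (hgj j))
      (fun k hk y hy => hpn j k hk y (by
        rw [mem_ball_zero_iff, norm_of_mem_indicatrix hc hN hy]; linarith)) k hk y hy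
    refine h1.trans (le_of_eq ?_)
    have := hK0 j
    field_simp
  calc _ ≤ ∑ _j : Fin n, ε / (n + 1) := norm_sum_le_of_le _ fun j _ => hbound j
    _ = ε * (n / (n + 1)) := by
      rw [Finset.sum_const, Finset.card_univ, Fintype.card_fin, nsmul_eq_mul]; ring
    _ ≤ ε * 1 := by
      gcongr
      rw [div_le_one (by positivity)]; linarith
    _ = ε := mul_one ε

/-- A linear space of vector fields that contains the polynomial fields is dense. -/
lemma dense_of_polyField_mem (hc : 0 < c) (hN : ∀ y, N y = c * ‖y‖)
    (ha : ∀ y ∈ indicatrix N, a * ‖y‖ ^ 2 = 1) {A : Submodule ℝ (indicatrix N → Euc n)}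
    (hA : ∀ l j, polyField N a j (mon l) ∈ A) :
    Dense {Z : IndicatrixField N | Z.1 ∈ A} := by
  have hA' : ∀ j, ∀ p ∈ polyFun n, polyField N a j p ∈ A := fun j p hp => by
    have h : polyFun n ≤ A.comap (polyField N a j) := Submodule.span_le.2 (by
      rintro _ ⟨l, rfl⟩; exact hA l j)
    exact h hp
  intro X
  choose p hp hpn using fun m : ℕ => exists_polyField_near (a := a) hc hN X.2 m
    (ε := 1 / ((m : ℝ) + 1)) (by positivity)
  have hZ : ∀ m, IsIndicatrixField N (∑ j, polyField N a j (p m j)) := fun m => by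
    have h1 : ∑ j, polyField N a j (p m j) = restr N fun y => ∑ j, p m j y • sphField a j y := by
      funext y
      rw [Finset.sum_apply]; rfl
    rw [h1]
    refine isIndicatrixField_restr hc hN (ContDiff.contDiffOn (ContDiff.sum fun j _ =>
      (contDiff_of_mem_polyFun (hp m j)).smul (contDiff_sphField a j))) fun y hy => ?_
    rw [inner_sum]
    exact Finset.sum_eq_zero fun j _ => by
      rw [inner_smul_right, inner_sphField (ha y hy), mul_zero]
  let Z : ℕ → IndicatrixField N := fun m => ⟨_, hZ m⟩
  have hlim : Filter.Tendsto Z Filter.atTop (𝓝 X) := by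
    rw [nhds_iInf, Filter.tendsto_iInf]
    intro k
    rw [nhds_induced, Filter.tendsto_comap_iff, UniformFun.tendsto_iff_tendstoUniformly]
    refine Metric.tendstoUniformly_iff.2 fun ε hε => ?_
    obtain ⟨m₀, hm₀⟩ := exists_nat_one_div_lt hε
    filter_upwards [Filter.eventually_ge_atTop (max k m₀)] with m hm y
    rw [dist_comm, dist_eq_norm]
    refine (hpn m k ((le_max_left _ _).trans hm) y y.2).trans_lt (lt_of_le_of_lt ?_ hm₀)
    have : m₀ ≤ m := (le_max_right _ _).trans hm
    gcongr
  exact mem_closure_of_tendsto hlim (.of_forall fun m =>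
    show ∑ j, polyField N a j (p m j) ∈ A from A.sum_mem fun j _ => hA' j _ (hp m j))

end Density

/-! ### The infinitesimal holonomy algebra at a point of spherical symmetry -/

section Holonomy

lemma ProjectiveData.mono {n : ℕ} {D D' : Set (Euc n)} {L E P : Euc n → Euc n → ℝ} {lam : ℝ}
    (h : ProjectiveData D L E P lam) (hD' : IsOpen D') (hsub : D' ⊆ D) :
    ProjectiveData D' L E P lam where
  isOpen := hD'
  smooth_E := h.smooth_E.mono hsub
  smooth_P := h.smooth_P.mono hsub
  euler_E := fun x hx => h.euler_E x (hsub hx)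
  euler_P := fun x hx => h.euler_P x (hsub hx)
  geodCoeff_eq := fun x hx => h.geodCoeff_eq x (hsub hx)
  dX_E := fun x hx => h.dX_E x (hsub hx)
  curv := fun x hx => h.curv x (hsub hx)

/-- The Lie algebra generated by `S`, as a linear subspace. -/
def lieSpan {n : ℕ} (N : Euc n → ℝ) (S : Set (indicatrix N → Euc n)) :
    Submodule ℝ (indicatrix N → Euc n) where
  carrier := {X | LieGenerated N S X}
  zero_mem' := .zero
  add_mem' := .add _ _
  smul_mem' := fun t _ => .smul t _

lemma closedUnderBracket_lieSpan {n : ℕ} {N : Euc n → ℝ} {c : ℝ} (hc : 0 < c)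
    (hN : ∀ y, N y = c * ‖y‖) (S : Set (indicatrix N → Euc n)) :
    ClosedUnderBracket (lieSpan N S) := by
  intro Z W hZ hW tZ tW mZ mW
  rw [← indicatrixBracket_restr hc hN (hZ.differentiable (by simp)) (hW.differentiable (by simp))
    tZ tW]
  exact .bracket _ _ mZ mW

variable {n : ℕ} {M : Type*} [TopologicalSpace M] [ChartedSpace (Euc n) M]
  {F : TangentBundle (𝓡 n) M → ℝ} {φ : OpenPartialHomeomorph M (Euc n)} {x₀ : M}

/-- The constant in the definition of spherical symmetry is positive. -/
lemma IsSphericallySymmetricAt.exists_pos [IsManifold (𝓡 n) ∞ M] (hF : IsFinsler F)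
    (hsph : IsSphericallySymmetricAt F x₀ φ) :
    ∃ c : ℝ, 0 < c ∧ ∀ y, fibreNorm F φ x₀ y = c * ‖y‖ := by
  obtain ⟨c, hc, h⟩ := hsph.norm_multiple
  rcases subsingleton_or_nontrivial (Euc n) with hn | hn
  · refine ⟨1, one_pos, fun y => ?_⟩
    rw [fibreNorm, h, Subsingleton.elim y 0]; simp
  · obtain ⟨y, hy⟩ := exists_ne (0 : Euc n)
    refine ⟨c, lt_of_le_of_ne ?_ hc.symm, h⟩
    have h1 : 0 ≤ c * ‖y‖ := by rw [← h]; exact hF.nonneg _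
    exact nonneg_of_mul_nonneg_left h1 (norm_pos_iff.2 hy)

variable {E P : Euc n → Euc n → ℝ} {lam : ℝ}

lemma IsCurvatureDerivative.isTangentField [IsManifold (𝓡 n) ∞ M]
    (hφ : φ ∈ IsManifold.maximalAtlas (𝓡 n) ∞ M)
    (h : ProjectiveData φ.target (coordFun F φ) E P lam) {ξ : Euc n → Euc n → Euc n}
    (hξ : IsCurvatureDerivative F φ ξ) : IsTangentField φ.target E ξ := by
  induction hξ with
  | curv X Y hX hY =>
    exact h.isTangentField_curvField (contDiffOn_coordField hφ hX) (contDiffOn_coordField hφ hY)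
  | cov X ξ hX _ ih => exact h.isTangentField_covDeriv (contDiffOn_coordField hφ hX) ih

lemma IsTangentField.isIndicatrixField_restr {D : Set (Euc n)} {ξ : Euc n → Euc n → Euc n}
    {N : Euc n → ℝ} {c a : ℝ} {x : Euc n} (hξ : IsTangentField D E ξ) (hc : 0 < c)
    (hN : ∀ y, N y = c * ‖y‖) (hx : x ∈ D) (ha : a ≠ 0)
    (hE : ∀ y ≠ 0, E x y = a / 2 * ‖y‖ ^ 2) : IsIndicatrixField N (restr N (ξ x)) := by
  refine FinslerHol.isIndicatrixField_restr hc hN ?_ fun y hy => ?_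
  · refine contDiffOn_euclidean.2 fun i => ?_
    exact ContDiffOn.comp (hξ.smooth i) (f := fun y => (x, y))
      (contDiffOn_const.prodMk contDiffOn_id) fun y hy => ⟨hx, hy⟩
  · have hy0 := ne_zero_of_mem_indicatrix hN hy
    have h1 := hξ.tangent x hx y hy0
    simp only [dY_half_norm_sq hE hy0, mul_assoc] at h1
    rw [← Finset.mul_sum] at h1
    have h2 := (mul_eq_zero.1 h1).resolve_left ha
    rw [PiLp.inner_apply, ← h2]
    exact Finset.sum_congr rfl fun i _ => by simp [mul_comm]

/-- The infinitesimal holonomy algebra at a point of spherical symmetry contains all polynomial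
fields. -/
lemma polyField_mem_lieSpan [T2Space M] [IsManifold (𝓡 n) ∞ M]
    (hφ : φ ∈ IsManifold.maximalAtlas (𝓡 n) ∞ M) (hx₀ : x₀ ∈ φ.source)
    (h : ProjectiveData φ.target (coordFun F φ) E P lam) (hlam : lam ≠ 0) {N : Euc n → ℝ}
    {c c₂ : ℝ} (hc : 0 < c) (hN : ∀ y, N y = c * ‖y‖)
    (hE : ∀ y ≠ 0, E (φ x₀) y = c ^ 2 / 2 * ‖y‖ ^ 2) (hc₂ : c₂ ≠ 0)
    (hP : ∀ y ≠ 0, P (φ x₀) y = c₂ * ‖y‖) (l : List (Fin n)) (j : Fin n) :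
    polyField N (c ^ 2) j (mon l) ∈
      lieSpan N {Y | ∃ ξ, IsCurvatureDerivative F φ ξ ∧ Y = restr N (ξ (φ x₀))} := by
  set A := lieSpan N {Y | ∃ ξ, IsCurvatureDerivative F φ ξ ∧ Y = restr N (ξ (φ x₀))} with hAdef
  have ha0 : c ^ 2 ≠ 0 := by positivity
  have ha : ∀ y ∈ indicatrix N, c ^ 2 * ‖y‖ ^ 2 = 1 := fun y hy => by
    rw [norm_of_mem_indicatrix hc hN hy, ← mul_pow, mul_inv_cancel₀ hc.ne', one_pow]
  have hgen : ∀ ξ, IsCurvatureDerivative F φ ξ → restr N (ξ (φ x₀)) ∈ A := fun ξ hξ =>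
    LieGenerated.mem _ ⟨ξ, hξ, rfl⟩
  have hscale : ∀ (t : ℝ) (ξ : Euc n → Euc n → Euc n) (Z : Euc n → Euc n), t ≠ 0 →
      IsCurvatureDerivative F φ ξ → (∀ y ∈ indicatrix N, ξ (φ x₀) y = t • Z y) →
      restr N Z ∈ A := fun t ξ Z ht hξ hZ => by
    have h1 : restr N (ξ (φ x₀)) = t • restr N Z := funext fun y => hZ y y.2
    have h2 := hgen ξ hξ
    rwa [h1, A.smul_mem_iff ht] at h2
  -- coordinate fields that are constant near the point
  have hfield : ∀ i j : Fin n, ∃ X Y : (p : M) → TangentSpace (𝓡 n) p, IsSmoothField X ∧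
      IsSmoothField Y ∧ ∃ D, ProjectiveData D (coordFun F φ) E P lam ∧ φ x₀ ∈ D ∧
      (∀ x ∈ D, coordField X φ x = EuclideanSpace.single i 1) ∧
      ∀ x ∈ D, coordField Y φ x = EuclideanSpace.single j 1 := fun i j => by
    obtain ⟨X, hX, eX⟩ := exists_smoothField_const hφ hx₀ (EuclideanSpace.single i (1 : ℝ))
    obtain ⟨Y, hY, eY⟩ := exists_smoothField_const hφ hx₀ (EuclideanSpace.single j (1 : ℝ))
    obtain ⟨D, hD, hDo, hxD⟩ := eventually_nhds_iff.1
      ((eX.and eY).and (φ.open_target.mem_nhds (φ.map_source hx₀)))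
    exact ⟨X, Y, hX, hY, D, h.mono hDo fun x hx => (hD x hx).2, hxD, fun x hx => (hD x hx).1.1,
      fun x hx => (hD x hx).1.2⟩
  refine polyField_mon_mem_of_generators (closedUnderBracket_lieSpan hc hN _) ha0 ha (lam := lam)
    hc₂ (fun i j _ => ?_) (fun i j hij => ?_) (fun i j hij => ?_) l j
  all_goals obtain ⟨X, Y, hX, hY, D, hD, hxD, eX, eY⟩ := hfield i j
  · exact hscale (lam * c ^ 2) _ _ (mul_ne_zero hlam ha0) (.curv X Y hX hY) fun y hy =>
      hD.curvField_at eX eY hxD hE (ne_zero_of_mem_indicatrix hN hy)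
  · refine hscale (lam * c₂ * c ^ 2 * c) _ _
      (mul_ne_zero (mul_ne_zero (mul_ne_zero hlam hc₂) ha0) hc.ne')
      (.cov X _ hX (.curv X Y hX hY)) fun y hy => ?_
    rw [hD.covDeriv_curvField_at hij eX eY hxD hE (ne_zero_of_mem_indicatrix hN hy) hP (ha y hy),
      norm_of_mem_indicatrix hc hN hy, inv_inv]
  · have hn : n ≠ 1 := by
      rintro rfl
      exact hij (Subsingleton.elim i j)
    exact hscale (lam * c ^ 2) _ _ (mul_ne_zero hlam ha0)
      (.cov X _ hX (.cov X _ hX (.curv X Y hX hY))) fun y hy =>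
      hD.covDeriv_covDeriv_curvField_at hij eX eY hxD hE (ne_zero_of_mem_indicatrix hN hy) hP
        (ha y hy) hn

end Holonomy

end FinslerHol

theorem mainTheorem3 {n : ℕ} {M : Type*} [TopologicalSpace M] [T2Space M]
    [ChartedSpace (EuclideanSpace ℝ (Fin n)) M] [IsManifold (𝓡 n) ∞ M]
    (F : TangentBundle (𝓡 n) M → ℝ) (hF : IsFinsler F) (hflat : IsProjectivelyFlat F)
    (lam : ℝ) (hlam : lam ≠ 0) (hcurv : HasConstantCurvature F lam)
    (x₀ : M) (φ : OpenPartialHomeomorph M (EuclideanSpace ℝ (Fin n)))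
    (hsph : IsSphericallySymmetricAt F x₀ φ) :
    (∀ X ∈ infHol F φ x₀, IsIndicatrixField (fibreNorm F φ x₀) X) ∧
      Dense {Z : IndicatrixField (fibreNorm F φ x₀) | Z.1 ∈ infHol F φ x₀} := by
  have hφ := hsph.chart.mem_maximalAtlas
  have hx₀ := φ.map_source hsph.mem_source
  obtain ⟨c, hc, hN⟩ := hsph.exists_pos hF
  obtain ⟨c₂, hc₂, hfac⟩ := hsph.factor_multiple
  obtain ⟨P, hD⟩ := exists_projectiveData_of_chart hF hcurv hsph.chart
  have hE : ∀ y ≠ 0, energy (coordFun F φ) (φ x₀) y = c ^ 2 / 2 * ‖y‖ ^ 2 := fun y _ => by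
    have h1 : coordFun F φ (φ x₀) y = c * ‖y‖ := hN y
    rw [energy, h1]; ring
  have hP : ∀ y ≠ 0, P (φ x₀) y = c₂ * ‖y‖ := fun y hy => by
    obtain ⟨i, hi⟩ : ∃ i, y i ≠ 0 := by
      by_contra! h
      exact hy (PiLp.ext h)
    exact mul_right_cancel₀ hi ((hD.geodCoeff_eq _ hx₀ y hy i).symm.trans (hfac y hy i))
  have ha : ∀ y ∈ indicatrix (fibreNorm F φ x₀), c ^ 2 * ‖y‖ ^ 2 = 1 := fun y hy => by
    rw [norm_of_mem_indicatrix hc hN hy, ← mul_pow, mul_inv_cancel₀ hc.ne', one_pow]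
  refine ⟨fun X hX => LieGenerated.isIndicatrixField hc hN ?_ hX, ?_⟩
  · rintro _ ⟨ξ, hξ, rfl⟩
    exact (hξ.isTangentField hφ hD).isIndicatrixField_restr hc hN hx₀
      (pow_ne_zero 2 hc.ne') hE
  · exact dense_of_polyField_mem hc hN ha fun l j =>
      polyField_mem_lieSpan hφ hsph.mem_source hD hlam hc hN hE hc₂ hP l j
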